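/- A shared memory program over a finite data domain consists of threads that communicate through one memory cell. A thread is a nondeterministic finite automaton with $\varepsilon$-transitions over the operations $!a$ (write $a$) and $?a$ (read $a$; enabled only if the memory holds $a$). A configuration gives the state of each thread and the value in memory. An instance of Leader Contributor Reachability ($\mathsf{LCR}$) consists of a data domain of size $D$ with an initial value, a leader thread with $L$ states, a contributor thread with $C$ states, and a set of unsafe states of the leader. The question is whether there is a $t\in\mathbb{N}$ such that the program consisting of the leader and $t$ copies of the contributor has a computation from its initial configuration to a configuration in which the leader is in an unsafe state. Theorem. $\mathsf{LCR}$ can be solved in time $O(\mathit{Wit}(L,D)\cdot \mathit{Valid}(L,D,C))$, where $$\mathit{Wit}(L,D)=(L\cdot(D+1))^{L\cdot D}\cdot D^{D}\cdot L,\qquad \mathit{Valid}(L,D,C)=L^3\cdot D^2\cdot C^2 .$$ That is, there are a program for the word RAM (unit-cost addition, subtraction, multiplication, indirect access and jumps) and a constant $c$ such that on every instance, given as a binary word $x$ (sizes, initial states and initial value in unary, and transition relations and unsafe states as bit tables), the program halts with the correct answer after at most $c\cdot \mathit{Wit}(L,D)\cdot\mathit{Valid}(L,D,C)$ steps, all stored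 numbers being at most $(|x|+2)^c$. Consequently $\mathsf{LCR}$ parameterized by $D$ and $L$ (parameter $k=D+L$) is fixed-parameter tractable: the set of pairs $(x,k)$ in which $x$ encodes a positive instance with $D+L=k$ is decided, on all pairs of a binary word $x$ and a $k\in\mathbb{N}$, in time $f(k)\cdot|x|^{O(1)}$ for a computable function $f$. -/

import Mathlib

/-! ### Shared memory programs -/

/-- Operations on the shared memory over the data domain `D`: `write a` is `!a`, `read a` is `?a`. -/
inductive MemOp (D : Type*) where
  | write (a : D) : MemOp D
  | read (a : D) : MemOp D

/-- A thread over the domain `D` with states `Q`: a nondeterministic automaton over the operations,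
with `ε`-transitions (label `none`). Final states are supplied by the verification task. -/
structure Thread (D Q : Type*) where
  init : Q
  trans : Q → Option (MemOp D) → Q → Prop

/-- A shared memory program with threads indexed by `ι`, thread `i` having the states `Q i`. -/
structure SMProgram (D ι : Type*) (Q : ι → Type*) where
  init : D
  thread : (i : ι) → Thread D (Q i)

namespace SMProgram

variable {D ι : Type*} {Q : ι → Type*}

/-- A configuration: the current state of every thread, and the value in memory. -/
abbrev Config (_A : SMProgram D ι Q) := ((i : ι) → Q i) × D

def initConfig (A : SMProgram D ι Q) : A.Config := (fun i => (A.thread i).init, A.init)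

/-- The labelled transition relation among configurations. -/
inductive Step [DecidableEq ι] (A : SMProgram D ι Q) :
    A.Config → Option (MemOp D) → A.Config → Prop
  | read (pc : (i : ι) → Q i) (i : ι) (a : D) (q' : Q i)
      (h : (A.thread i).trans (pc i) (some (MemOp.read a)) q') :
      Step A (pc, a) (some (MemOp.read a)) (Function.update pc i q', a)
  | write (pc : (i : ι) → Q i) (i : ι) (a b : D) (q' : Q i)
      (h : (A.thread i).trans (pc i) (some (MemOp.write b)) q') :
      Step A (pc, a) (some (MemOp.write b)) (Function.update pc i q', b)
  | eps (pc : (i : ι) → Q i) (i : ι) (a : D) (q' : Q i)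
      (h : (A.thread i).trans (pc i) none q') :
      Step A (pc, a) none (Function.update pc i q', a)

/-- `c →* c'`: some computation leads from `c` to `c'`. -/
def Reaches [DecidableEq ι] (A : SMProgram D ι Q) : A.Config → A.Config → Prop :=
  Relation.ReflTransGen (fun c c' => ∃ l, A.Step c l c')

end SMProgram

/-! ### Leader contributor reachability -/

/-- An instance of leader contributor reachability: domain of size `D`, a leader with `L` states,
a contributor with `C` states, an initial memory value, and the unsafe states of the leader. -/
structure LCRInstance where
  L : ℕ
  D : ℕ
  C : ℕ
  init : Fin D
  leader : Thread (Fin D) (Fin L)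
  contributor : Thread (Fin D) (Fin C)
  unsafeStates : Set (Fin L)

namespace LCRInstance

/-- Thread states of the program with one leader (index `none`) and `t` contributors. -/
def States (I : LCRInstance) (t : ℕ) : Option (Fin t) → Type
  | none => Fin I.L
  | some _ => Fin I.C

/-- The program with the leader and exactly `t` copies of the contributor. -/
def copies (I : LCRInstance) (t : ℕ) : SMProgram (Fin I.D) (Option (Fin t)) (I.States t) where
  init := I.init
  thread := fun i => match i with
    | none => I.leader
    | some _ => I.contributor

/-- For some number `t` of contributors, a configuration in which the leader is in an unsafe state
is reachable from the initial configuration. -/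
def Holds (I : LCRInstance) : Prop :=
  ∃ (t : ℕ) (c : (I.copies t).Config),
    (I.copies t).Reaches (I.copies t).initConfig c ∧
      (show Fin I.L from c.1 none) ∈ I.unsafeStates

/-! ### Encoding of instances as binary words -/

/-- Unary code of a number. -/
def unary (n : ℕ) : List Bool := List.replicate n true ++ [false]

/-- All transition labels over `Fin d`: `ε`, `!0`, `?0`, `!1`, `?1`, ... -/
def labels (d : ℕ) : List (Option (MemOp (Fin d))) :=
  none :: (List.finRange d).flatMap (fun a => [some (MemOp.write a), some (MemOp.read a)])

open Classical in
/-- The transition relation of a thread, as a table of `n * (2 * d + 1) * n` bits. -/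
noncomputable def transBits {d n : ℕ} (T : Thread (Fin d) (Fin n)) : List Bool :=
  (List.finRange n).flatMap fun q => (labels d).flatMap fun l =>
    (List.finRange n).map fun q' => decide (T.trans q l q')

open Classical in
/-- The input word of an instance: sizes and initial states and value in unary, then the two
transition tables, then the characteristic vector of the unsafe states. -/
noncomputable def encode (I : LCRInstance) : List Bool :=
  unary I.L ++ unary I.D ++ unary I.C ++
  unary I.init ++ unary I.leader.init ++ unary I.contributor.init ++
  transBits I.leader ++ transBits I.contributor ++
  (List.finRange I.L).map fun q => decide (q ∈ I.unsafeStates)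

end LCRInstance

/-! ### Random access machines with a step count -/

namespace RAM

/-- Instructions of a deterministic random access machine. `M` denotes the memory. -/
inductive Instr where
  /-- `M[i] := n` -/
  | const (i n : ℕ)
  /-- `M[i] := M[j] + M[k]` -/
  | add (i j k : ℕ)
  /-- `M[i] := M[j] - M[k]`, or `0` if this is negative -/
  | sub (i j k : ℕ)
  /-- `M[i] := M[j] * M[k]` -/
  | mul (i j k : ℕ)
  /-- `M[i] := M[M[j]]` -/
  | load (i j : ℕ)
  /-- `M[M[i]] := M[j]` -/
  | store (i j : ℕ)
  /-- jump to instruction `l` -/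
  | jump (l : ℕ)
  /-- jump to instruction `l` if `M[i] = 0` -/
  | jumpZero (i l : ℕ)
  /-- halt and accept (`true`) or reject (`false`) -/
  | halt (b : Bool)

/-- A program is a finite list of instructions, numbered from `0`. -/
abbrev Prog := List Instr

/-- Program counter and memory. -/
structure State where
  pc : ℕ
  mem : ℕ → ℕ

/-- The initial state: `M[0]` is the length of the input, `M[1], M[2], ...` are its entries, and all
other cells are `0`. -/
def initState (input : List ℕ) : State where
  pc := 0
  mem := fun i => if i = 0 then input.length else input.getD (i - 1) 0

/-- Execution of one instruction; the state does not change once the machine has halted (or has left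
the program). -/
def step (p : Prog) (s : State) : State :=
  match p[s.pc]? with
  | none => s
  | some (Instr.halt _) => s
  | some (Instr.const i n) => ⟨s.pc + 1, Function.update s.mem i n⟩
  | some (Instr.add i j k) => ⟨s.pc + 1, Function.update s.mem i (s.mem j + s.mem k)⟩
  | some (Instr.sub i j k) => ⟨s.pc + 1, Function.update s.mem i (s.mem j - s.mem k)⟩
  | some (Instr.mul i j k) => ⟨s.pc + 1, Function.update s.mem i (s.mem j * s.mem k)⟩
  | some (Instr.load i j) => ⟨s.pc + 1, Function.update s.mem i (s.mem (s.mem j))⟩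
  | some (Instr.store i j) => ⟨s.pc + 1, Function.update s.mem (s.mem i) (s.mem j)⟩
  | some (Instr.jump l) => ⟨l, s.mem⟩
  | some (Instr.jumpZero i l) => ⟨if s.mem i = 0 then l else s.pc + 1, s.mem⟩

/-- The state after `n` steps on the given input. -/
def run (p : Prog) (input : List ℕ) (n : ℕ) : State := (step p)^[n] (initState input)

/-- On the given input, `p` halts after at most `T` steps, accepts if and only if `ans` holds, and
up to then no memory cell ever holds a number larger than `V`. -/
def DecidesWithin (p : Prog) (input : List ℕ) (ans : Prop) (T V : ℕ) : Prop :=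
  ∃ n ≤ T, ∃ b : Bool, p[(run p input n).pc]? = some (Instr.halt b) ∧ (b = true ↔ ans) ∧
    ∀ m ≤ n, ∀ i, (run p input m).mem i ≤ V

/-- A binary word as an input, one bit per memory cell. -/
def bits (x : List Bool) : List ℕ := x.map Bool.toNat

end RAM

/-! ### Fixed-parameter tractability -/

/-- A parameterized problem over the binary alphabet is fixed-parameter tractable if a deterministic
algorithm decides `(x, k) ∈ P` in time `f k * |x| ^ O(1)` for a computable function `f`. The stored
numbers obey the same bound, so that a step handles words of length logarithmic in the time bound.
The input of the machine is `k` followed by the bits of `x`. -/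
def IsFPT (P : Set (List Bool × ℕ)) : Prop :=
  ∃ (p : RAM.Prog) (f : ℕ → ℕ) (c : ℕ), Computable f ∧ ∀ (x : List Bool) (k : ℕ),
    RAM.DecidesWithin p (k :: RAM.bits x) ((x, k) ∈ P)
      (f k * (x.length + 1) ^ c) (f k * (x.length + 1) ^ c)

/-- Leader contributor reachability parameterized by the size of the data domain and the number of
leader states. -/
def LCRByDomainAndLeader : Set (List Bool × ℕ) :=
  {y | ∃ I : LCRInstance, y = (I.encode, I.D + I.L) ∧ I.Holds}

/-! ### The two factors of the running time -/

def Wit (L D : ℕ) : ℕ := (L * (D + 1)) ^ (L * D) * D ^ D * L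

def Valid (L D C : ℕ) : ℕ := L ^ 3 * D ^ 2 * C ^ 2

/-!
Leader contributor reachability is decided by enumerating `N ^ (L + 1)` guides, `N = L * (D + 1)`, and
checking each of them in time `O(L ^ 3 * (D + 1) ^ 4 * C ^ 2)`.

*Abstraction.* Since the number of contributors is arbitrary, a contributor state that has been occupied
once can be occupied by as many contributors as desired. So it suffices to track the set `R` of such
states, together with a node: the leader state, and the value in memory or the information that it is
irrelevant. While it is irrelevant, any value that some state in `R` can write may be supplied at any
time (`LCRInstance.holds_iff_reach`).

*Guides.* Inside the strongly connected component of a node with irrelevant memory, the leader can cycle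
at will, so contributors get everything that is possible at the nodes on these cycles. This can
make further values writable and the component larger, but at most `D` times; after `D + 1` saturations
nothing more is to be gained. Hence a computation is described by its moves between components: the
target state, and the memory part of the node where contributors act on the way. No leader state is the
target of two such moves, as otherwise the leader could have returned and the second move would have
stayed within the component. So guides of length `L`, each entry one of the `N` nodes, suffice, and one
more entry takes the leader to the state that is asked for (`AbsSys.exists_reach_iff_exists_guide`).

*Time.* A guide is checked by graph searches. The algorithm is written in a small language of loops whose
bounds are fixed variables. It is compiled to the random access machine, with a static time bound
(`Loop.Machine.cmd_runs`) that is a polynomial in the loop bounds; its exponents are computed from the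
syntax (`Loop.Cmd.cost_le`). The total time is `O(N ^ (L + 1) * L ^ 3 * (D + 1) ^ 4 * C ^ 2)`, and
`N ^ (L + 1) * (D + 1) ^ 4` is at most a constant times `(L * (D + 1)) ^ (L * D) * D ^ D * D ^ 2 * L`
(`Loop.rounds_le`).

*Fixed-parameter tractability.* Arbitrary words are validated before the search: the unary numbers are
parsed, and the length of the rest is compared with the size of the tables. Since
`N ≤ (k + 2) ^ 2` for `k = D + L`, the time is at most `f k` times a power of the length of the input,
where `f k` is a constant times `(k + 2) ^ (2 * k + e)` for a constant `e`.
-/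

open Relation

/-! ### The copy-saturated abstraction of a leader contributor program -/

/-- A leader contributor program with all data numbered. Labels of transitions are numbered too:
`0` is `ε`, `2 * b + 1` is `!b`, and `2 * b + 2` is `?b`. -/
structure AbsSys where
  L : ℕ
  D : ℕ
  C : ℕ
  /-- transitions of the leader: source, label, target -/
  lead : ℕ → ℕ → ℕ → Prop
  /-- transitions of the contributor: source, label, target -/
  cont : ℕ → ℕ → ℕ → Prop
  /-- initial value of the memory -/
  mem0 : ℕ
  /-- initial state of the leader -/
  lead0 : ℕ
  /-- initial state of the contributors -/
  cont0 : ℕ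
  mem0_lt : mem0 < D
  lead0_lt : lead0 < L
  cont0_lt : cont0 < C
  lead_lt : ∀ {q l q'}, lead q l q' → q' < L
  cont_lt : ∀ {p l p'}, cont p l p' → p' < C

namespace AbsSys

variable (Y : AbsSys)

/-- The values that a contributor in one of the states `R` can write. -/
def writable (R : Set ℕ) : Set ℕ := {b | b < Y.D ∧ ∃ p ∈ R, ∃ p', Y.cont p (2 * b + 1) p'}

/-- Moves of the leader, given the set `S` of values that contributors can write. The node
`q * (D + 1) + (b + 1)` stands for the leader in `q` with the value `b` in memory, and the node
`q * (D + 1)` for the leader in `q` with an irrelevant value in memory, which may be overwritten by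
any value in `S` at any time. The four cases are: an `ε`-step or a read of the leader while the memory
is relevant; forgetting the value in memory; an `ε`-step or a read of the leader while the memory is
irrelevant, where the value to be read is supplied by a contributor; a write of the leader. Before it
writes, the leader can forget the value in memory, so a write needs no case of relevant memory. -/
def Edge (S : Set ℕ) (u w : ℕ) : Prop :=
  (u % (Y.D + 1) ≠ 0 ∧ w % (Y.D + 1) = u % (Y.D + 1) ∧
    (Y.lead (u / (Y.D + 1)) 0 (w / (Y.D + 1)) ∨
      Y.lead (u / (Y.D + 1)) (2 * (u % (Y.D + 1))) (w / (Y.D + 1)))) ∨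
  (w / (Y.D + 1) = u / (Y.D + 1) ∧ w % (Y.D + 1) = 0) ∨
  (u % (Y.D + 1) = 0 ∧ w % (Y.D + 1) = 0 ∧
    (Y.lead (u / (Y.D + 1)) 0 (w / (Y.D + 1)) ∨
      ∃ b ∈ S, Y.lead (u / (Y.D + 1)) (2 * b + 2) (w / (Y.D + 1)))) ∨
  (u % (Y.D + 1) = 0 ∧ w % (Y.D + 1) ≠ 0 ∧
    Y.lead (u / (Y.D + 1)) (2 * (w % (Y.D + 1)) - 1) (w / (Y.D + 1)))

/-- The labels of contributor transitions that are enabled if the memory part of the node ranges over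
`X` and contributors can write the values `S`. The memory part `0` stands for irrelevant memory; only
then contributors may write. -/
def Enabled (X : ℕ → Prop) (S : Set ℕ) (l : ℕ) : Prop :=
  l = 0 ∨ (∃ b < Y.D, l = 2 * b + 1 ∧ X 0) ∨ (∃ b < Y.D, l = 2 * b + 2 ∧ (X (b + 1) ∨ X 0 ∧ b ∈ S))

/-- Reachability of a node together with a set of contributor states, each of which can be occupied by
arbitrarily many contributors at the same time. In `cont` the source `p` is not removed: some
contributors stay behind there. -/
inductive Reach : ℕ → Set ℕ → Prop
  | init : Reach (Y.lead0 * (Y.D + 1) + (Y.mem0 + 1)) {Y.cont0}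
  | lead {u w R} : Reach u R → Y.Edge (Y.writable R) u w → Reach w R
  | cont {u R p l p'} : Reach u R → p ∈ R → Y.Enabled (· = u % (Y.D + 1)) (Y.writable R) l →
      Y.cont p l p' → Reach u (insert p' R)

variable {Y}

theorem writable_mono {R R' : Set ℕ} (h : R ⊆ R') : Y.writable R ⊆ Y.writable R' := by
  rintro b ⟨hb, p, hp, ht⟩
  exact ⟨hb, p, h hp, ht⟩

theorem reach_bounds {u : ℕ} {R : Set ℕ} (h : Y.Reach u R) :
    (∀ p ∈ R, p < Y.C) ∧ u / (Y.D + 1) < Y.L := by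
  have hpos : 0 < Y.D + 1 := Nat.succ_pos _
  induction h with
  | init =>
    refine ⟨by simp [Y.cont0_lt], ?_⟩
    rw [Nat.div_lt_iff_lt_mul hpos]
    have := Y.mem0_lt
    have := Y.lead0_lt
    nlinarith
  | lead _ he ih =>
    refine ⟨ih.1, ?_⟩
    rcases he with ⟨-, -, h | h⟩ | ⟨h, -⟩ | ⟨-, -, h | ⟨b, -, h⟩⟩ | ⟨-, -, h⟩
    · exact Y.lead_lt h
    · exact Y.lead_lt h
    · rw [h]; exact ih.2
    · exact Y.lead_lt h
    · exact Y.lead_lt h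
    · exact Y.lead_lt h
  | cont _ _ _ ht ih =>
    refine ⟨?_, ih.2⟩
    rintro s (rfl | hs)
    · exact Y.cont_lt ht
    · exact ih.1 s hs

end AbsSys

namespace LCRInstance

/-- The number of a label. -/
def labelIdx {d : ℕ} : Option (MemOp (Fin d)) → ℕ
  | none => 0
  | some (MemOp.write a) => 2 * a + 1
  | some (MemOp.read a) => 2 * a + 2

theorem labelIdx_eq_zero {d : ℕ} {l : Option (MemOp (Fin d))} (h : labelIdx l = 0) : l = none := by
  rcases l with _ | ⟨a⟩ | ⟨a⟩ <;> simp_all [labelIdx]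

theorem labelIdx_eq_write {d b : ℕ} {l : Option (MemOp (Fin d))} (h : labelIdx l = 2 * b + 1) :
    ∃ hb : b < d, l = some (MemOp.write ⟨b, hb⟩) := by
  rcases l with _ | ⟨a⟩ | ⟨a⟩
  · simp [labelIdx] at h
  · have : b = a := by simp only [labelIdx] at h; omega
    subst this
    exact ⟨a.2, rfl⟩
  · simp only [labelIdx] at h; omega

theorem labelIdx_eq_read {d b : ℕ} {l : Option (MemOp (Fin d))} (h : labelIdx l = 2 * b + 2) :
    ∃ hb : b < d, l = some (MemOp.read ⟨b, hb⟩) := by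
  rcases l with _ | ⟨a⟩ | ⟨a⟩
  · simp [labelIdx] at h
  · simp only [labelIdx] at h; omega
  · have : b = a := by simp only [labelIdx] at h; omega
    subst this
    exact ⟨a.2, rfl⟩

/-- The transition relation of a thread on numbers. -/
def numTrans {d n : ℕ} (T : Thread (Fin d) (Fin n)) (q l q' : ℕ) : Prop :=
  ∃ x lab y, x.val = q ∧ labelIdx lab = l ∧ y.val = q' ∧ T.trans x lab y

theorem numTrans_zero {d n : ℕ} {T : Thread (Fin d) (Fin n)} {q : Fin n} {q' : ℕ}
    (h : numTrans T q 0 q') : ∃ y : Fin n, y.val = q' ∧ T.trans q none y := by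
  obtain ⟨x, lab, y, hx, hl, hy, ht⟩ := h
  obtain rfl := Fin.ext hx
  obtain rfl := labelIdx_eq_zero hl
  exact ⟨y, hy, ht⟩

theorem numTrans_write {d n b : ℕ} {T : Thread (Fin d) (Fin n)} {q : Fin n} {q' : ℕ}
    (h : numTrans T q (2 * b + 1) q') :
    ∃ (hb : b < d) (y : Fin n), y.val = q' ∧ T.trans q (some (MemOp.write ⟨b, hb⟩)) y := by
  obtain ⟨x, lab, y, hx, hl, hy, ht⟩ := h
  obtain rfl := Fin.ext hx
  obtain ⟨hb, rfl⟩ := labelIdx_eq_write hl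
  exact ⟨hb, y, hy, ht⟩

theorem numTrans_read {d n b : ℕ} {T : Thread (Fin d) (Fin n)} {q : Fin n} {q' : ℕ}
    (h : numTrans T q (2 * b + 2) q') :
    ∃ (hb : b < d) (y : Fin n), y.val = q' ∧ T.trans q (some (MemOp.read ⟨b, hb⟩)) y := by
  obtain ⟨x, lab, y, hx, hl, hy, ht⟩ := h
  obtain rfl := Fin.ext hx
  obtain ⟨hb, rfl⟩ := labelIdx_eq_read hl
  exact ⟨hb, y, hy, ht⟩

/-- The abstraction of an instance. -/
def toAbs (I : LCRInstance) : AbsSys where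
  L := I.L
  D := I.D
  C := I.C
  lead := numTrans I.leader
  cont := numTrans I.contributor
  mem0 := I.init
  lead0 := I.leader.init
  cont0 := I.contributor.init
  mem0_lt := I.init.2
  lead0_lt := I.leader.init.2
  cont0_lt := I.contributor.init.2
  lead_lt := by rintro q l q' ⟨x, lab, y, -, -, rfl, -⟩; exact y.2
  cont_lt := by rintro q l q' ⟨x, lab, y, -, -, rfl, -⟩; exact y.2

variable (I : LCRInstance)

/-- The leader state of a configuration. -/
def leadState {I : LCRInstance} {t : ℕ} (c : (I.copies t).Config) : Fin I.L := c.1 none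

/-- The state of the `i`-th contributor in a configuration. -/
def contState {I : LCRInstance} {t : ℕ} (c : (I.copies t).Config) (i : Fin t) : Fin I.C := c.1 (some i)

/-- The number of contributors in the state with number `p`. -/
def count {I : LCRInstance} {t : ℕ} (c : (I.copies t).Config) (p : ℕ) : ℕ :=
  (Finset.univ.filter fun i => (contState c i).val = p).card

variable {I}

/-- One step of the leader. -/
theorem exists_leadStep {t : ℕ} (c : (I.copies t).Config) {q' : Fin I.L}
    (lab : Option (MemOp (Fin I.D))) (h : I.leader.trans (leadState c) lab q')
    (hm : ∀ a, lab = some (MemOp.read a) → c.2 = a) :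
    ∃ c' : (I.copies t).Config, (I.copies t).Step c lab c' ∧ leadState c' = q' ∧
      contState c' = contState c ∧
      (∀ a, lab = some (MemOp.write a) → c'.2 = a) ∧
      ((∀ a, lab ≠ some (MemOp.write a)) → c'.2 = c.2) := by
  obtain ⟨pc, m⟩ := c
  have h1 : ∀ m', leadState (I := I) (t := t) (Function.update pc none q', m') = q' := by
    intro m'; exact Function.update_self (β := I.States t) none q' pc
  have h2 : ∀ m', contState (I := I) (t := t) (Function.update pc none q', m') =
      contState (I := I) (t := t) (pc, m) := by
    intro m'; funext i
    exact Function.update_of_ne (β := I.States t) (Option.some_ne_none i) q' pc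
  rcases lab with _ | ⟨a⟩ | ⟨a⟩
  · exact ⟨_, SMProgram.Step.eps pc none m q' h, h1 _, h2 _, by simp, by simp⟩
  · exact ⟨_, SMProgram.Step.write pc none m a q' h, h1 _, h2 _, by simp, by simp⟩
  · obtain rfl : m = a := hm a rfl
    exact ⟨_, SMProgram.Step.read pc none m q' h, h1 _, h2 _, by simp, by simp⟩

/-- One step of a contributor. -/
theorem exists_contStep {t : ℕ} (c : (I.copies t).Config) (i : Fin t) {p' : Fin I.C}
    (lab : Option (MemOp (Fin I.D))) (h : I.contributor.trans (contState c i) lab p')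
    (hm : ∀ a, lab = some (MemOp.read a) → c.2 = a) :
    ∃ c' : (I.copies t).Config, (I.copies t).Step c lab c' ∧ leadState c' = leadState c ∧
      contState c' = Function.update (contState c) i p' ∧
      (∀ a, lab = some (MemOp.write a) → c'.2 = a) ∧
      ((∀ a, lab ≠ some (MemOp.write a)) → c'.2 = c.2) := by
  obtain ⟨pc, m⟩ := c
  have h1 : ∀ m', leadState (I := I) (t := t) (Function.update pc (some i) p', m') =
      leadState (I := I) (t := t) (pc, m) := by
    intro m'; exact Function.update_of_ne (β := I.States t) (Option.some_ne_none i).symm p' pc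
  have h2 : ∀ m', contState (I := I) (t := t) (Function.update pc (some i) p', m') =
      Function.update (contState (I := I) (t := t) (pc, m)) i p' := by
    intro m'; funext j
    by_cases hj : j = i
    · subst hj
      rw [Function.update_self]
      exact Function.update_self (β := I.States t) (some j) p' pc
    · rw [Function.update_of_ne hj]
      exact Function.update_of_ne (β := I.States t) (fun h => hj (Option.some.inj h)) p' pc
  rcases lab with _ | ⟨a⟩ | ⟨a⟩
  · exact ⟨_, SMProgram.Step.eps pc (some i) m p' h, h1 _, h2 _, by simp, by simp⟩
  · exact ⟨_, SMProgram.Step.write pc (some i) m a p' h, h1 _, h2 _, by simp, by simp⟩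
  · obtain rfl : m = a := hm a rfl
    exact ⟨_, SMProgram.Step.read pc (some i) m p' h, h1 _, h2 _, by simp, by simp⟩

/-- Several contributors in the same state can perform the same transition one after the other. -/
theorem exists_contSteps {t : ℕ} (c : (I.copies t).Config) {p p' : Fin I.C}
    (lab : Option (MemOp (Fin I.D))) (h : I.contributor.trans p lab p')
    (hm : ∀ a, lab = some (MemOp.read a) → c.2 = a) (J : Finset (Fin t))
    (hJ : ∀ i ∈ J, contState c i = p) :
    ∃ c' : (I.copies t).Config, (I.copies t).Reaches c c' ∧ leadState c' = leadState c ∧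
      (∀ i, contState c' i = if i ∈ J then p' else contState c i) ∧
      ((∀ a, lab ≠ some (MemOp.write a)) → c'.2 = c.2) := by
  induction J using Finset.induction_on with
  | empty => exact ⟨c, ReflTransGen.refl, rfl, by simp, by simp⟩
  | insert j J hj ih =>
    obtain ⟨c1, hr, hl, hc, hm1⟩ := ih fun i hi => hJ i (Finset.mem_insert_of_mem hi)
    have hcj : contState c1 j = p := by
      rw [hc, if_neg hj]; exact hJ j (Finset.mem_insert_self _ _)
    obtain ⟨c2, hs, hl2, hc2, -, hm2⟩ := exists_contStep c1 j lab (hcj ▸ h) (by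
      intro a ha
      rw [hm1 (by simp [ha])]
      exact hm a ha)
    refine ⟨c2, hr.tail ⟨lab, hs⟩, hl2.trans hl, ?_, fun hw => (hm2 hw).trans (hm1 hw)⟩
    intro i
    rw [hc2]
    by_cases hi : i = j
    · subst hi; simp
    · rw [Function.update_of_ne hi, hc]; simp [hi]

/-- A move of `k` contributors out of a state occupied by `k + k'` ones leaves `k'` there. -/
theorem exists_moveMany {t : ℕ} (c : (I.copies t).Config) {p p' : Fin I.C} {k k' : ℕ} {R : Set ℕ}
    (lab : Option (MemOp (Fin I.D))) (h : I.contributor.trans p lab p')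
    (hm : ∀ a, lab = some (MemOp.read a) → c.2 = a)
    (hp : p.val ∈ R) (hR : ∀ s ∈ R, k + k' ≤ count c s) :
    ∃ c' : (I.copies t).Config, (I.copies t).Reaches c c' ∧ leadState c' = leadState c ∧
      (∀ s ∈ R, k' ≤ count c' s) ∧ k ≤ count c' p' ∧
      ((∀ a, lab ≠ some (MemOp.write a)) → c'.2 = c.2) := by
  obtain ⟨J, hJ, hJk⟩ := Finset.exists_subset_card_eq ((Nat.le_add_right k k').trans (hR _ hp))
  have hJ' : ∀ i ∈ J, contState c i = p := fun i hi => Fin.ext (Finset.mem_filter.1 (hJ hi)).2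
  obtain ⟨c', hr, hl, hc, hm'⟩ := exists_contSteps c lab h hm J hJ'
  refine ⟨c', hr, hl, ?_, ?_, hm'⟩
  · intro s hs
    have h1 : (Finset.univ.filter fun i => (contState c i).val = s) \ J ⊆
        Finset.univ.filter fun i => (contState c' i).val = s := by
      intro i hi
      simp only [Finset.mem_sdiff, Finset.mem_filter, Finset.mem_univ, true_and] at hi ⊢
      rw [hc, if_neg hi.2]; exact hi.1
    have h2 := Finset.card_le_card h1
    have h3 := Finset.le_card_sdiff J (Finset.univ.filter fun i => (contState c i).val = s)
    have h4 := hR s hs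
    simp only [count] at h4 ⊢
    omega
  · rw [← hJk]
    apply Finset.card_le_card
    intro i hi
    simp [hc, hi]

/-- A contributor can bring any writable value into memory, at the expense of one copy. -/
theorem exists_write {t : ℕ} (c : (I.copies t).Config) {k b : ℕ} {R : Set ℕ}
    (hb : b ∈ I.toAbs.writable R) (hRC : ∀ p ∈ R, p < I.C) (hR : ∀ s ∈ R, k + 1 ≤ count c s) :
    ∃ c' : (I.copies t).Config, (I.copies t).Reaches c c' ∧ leadState c' = leadState c ∧
      (∀ s ∈ R, k ≤ count c' s) ∧ c'.2.val = b := by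
  obtain ⟨hbD, p, hp, p', ht⟩ := hb
  have hpos : 0 < count c p := by have := hR p hp; omega
  obtain ⟨i, hi⟩ := Finset.card_pos.1 hpos
  obtain ⟨hb', y, rfl, ht'⟩ := numTrans_write (q := ⟨p, hRC p hp⟩) ht
  have hci : contState c i = ⟨p, hRC p hp⟩ := Fin.ext (Finset.mem_filter.1 hi).2
  obtain ⟨c', hs, hl, hc, hm, -⟩ := exists_contStep c i _ (hci ▸ ht') (by simp)
  refine ⟨c', ReflTransGen.single ⟨_, hs⟩, hl, ?_, by rw [hm _ rfl]⟩
  intro s hs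
  have h1 : (Finset.univ.filter fun i => (contState c i).val = s).erase i ⊆
      Finset.univ.filter fun i => (contState c' i).val = s := by
    intro j hj
    simp only [Finset.mem_erase, Finset.mem_filter, Finset.mem_univ, true_and] at hj ⊢
    rw [hc, Function.update_of_ne hj.1]; exact hj.2
  have h2 := Finset.card_le_card h1
  have h3 := Finset.pred_card_le_card_erase (a := i)
    (s := Finset.univ.filter fun i => (contState c i).val = s)
  have h4 := hR s hs
  simp only [count] at h4 ⊢
  omega

/-- Every abstract computation is realised by programs with sufficiently many contributors. The number
`k` of copies left in each state is arbitrary, so that the induction can start from more copies than it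
has to leave: a transition of contributors splits `k + k` copies, and supplying a value costs one. -/
theorem exists_run_of_reach {u : ℕ} {R : Set ℕ} (h : I.toAbs.Reach u R) (k : ℕ) :
    ∃ (t : ℕ) (c : (I.copies t).Config), (I.copies t).Reaches (I.copies t).initConfig c ∧
      (leadState c).val = u / (I.D + 1) ∧ (∀ s ∈ R, k ≤ count c s) ∧
      (u % (I.D + 1) ≠ 0 → u % (I.D + 1) = c.2.val + 1) := by
  induction h generalizing k with
  | init =>
    refine ⟨k, _, ReflTransGen.refl, ?_, ?_, ?_⟩
    · change (I.leader.init).val = _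
      have : I.toAbs.mem0 + 1 < I.D + 1 := Nat.succ_lt_succ I.toAbs.mem0_lt
      change _ = (I.toAbs.lead0 * (I.D + 1) + (I.toAbs.mem0 + 1)) / (I.D + 1)
      rw [mul_comm, Nat.mul_add_div (by omega), Nat.div_eq_of_lt this]; rfl
    · rintro s rfl
      have : ∀ i : Fin k, (contState (I.copies k).initConfig i).val = I.toAbs.cont0 := fun i => rfl
      simp [count, this]
    · intro _
      have : I.toAbs.mem0 + 1 < I.D + 1 := Nat.succ_lt_succ I.toAbs.mem0_lt
      change (I.toAbs.lead0 * (I.D + 1) + (I.toAbs.mem0 + 1)) % (I.D + 1) = _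
      rw [mul_comm, Nat.mul_add_mod, Nat.mod_eq_of_lt this]; rfl
  | @lead u w R hr he ih =>
    have hRC := (AbsSys.reach_bounds hr).1
    rcases he with ⟨h0, h1, h | h⟩ | ⟨h1, h0⟩ | ⟨h0, h1, h | ⟨b, hb, h⟩⟩ | ⟨h0, h1, h⟩
    · obtain ⟨t, c, hc, hl, hk, hm⟩ := ih k
      rw [show I.toAbs.D = I.D from rfl, ← hl] at h
      obtain ⟨y, hy, ht⟩ := numTrans_zero h
      obtain ⟨c', hs, hl', hc', -, hm'⟩ := exists_leadStep c none ht (by simp)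
      refine ⟨t, c', hc.tail ⟨_, hs⟩, by rw [hl', hy], ?_, ?_⟩
      · simpa only [count, hc'] using hk
      · intro _
        rw [hm' (by simp)]
        exact h1.trans (hm h0)
    · obtain ⟨t, c, hc, hl, hk, hm⟩ := ih k
      rw [show I.toAbs.D = I.D from rfl, ← hl, hm h0, mul_add] at h
      obtain ⟨hb, y, hy, ht⟩ := numTrans_read h
      obtain ⟨c', hs, hl', hc', -, hm'⟩ := exists_leadStep c _ ht (by
        rintro a ⟨⟩; rfl)
      refine ⟨t, c', hc.tail ⟨_, hs⟩, by rw [hl', hy], ?_, ?_⟩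
      · simpa only [count, hc'] using hk
      · intro _
        rw [hm' (by simp)]
        exact h1.trans (hm h0)
    · obtain ⟨t, c, hc, hl, hk, hm⟩ := ih k
      exact ⟨t, c, hc, hl.trans h1.symm, hk, fun h => absurd h0 h⟩
    · obtain ⟨t, c, hc, hl, hk, hm⟩ := ih k
      rw [show I.toAbs.D = I.D from rfl, ← hl] at h
      obtain ⟨y, hy, ht⟩ := numTrans_zero h
      obtain ⟨c', hs, hl', hc', -, -⟩ := exists_leadStep c none ht (by simp)
      refine ⟨t, c', hc.tail ⟨_, hs⟩, by rw [hl', hy], ?_, fun h => absurd h1 h⟩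
      simpa only [count, hc'] using hk
    · obtain ⟨t, c, hc, hl, hk, hm⟩ := ih (k + 1)
      obtain ⟨c1, hc1, hl1, hk1, hb1⟩ := exists_write c hb hRC hk
      rw [show I.toAbs.D = I.D from rfl, ← hl, ← hl1] at h
      obtain ⟨hb, y, hy, ht⟩ := numTrans_read h
      obtain ⟨c', hs, hl', hc', -, -⟩ := exists_leadStep c1 _ ht (by
        rintro a ⟨⟩; exact Fin.ext hb1)
      refine ⟨t, c', (hc.trans hc1).tail ⟨_, hs⟩, by rw [hl', hy], ?_, fun h => absurd h1 h⟩
      simpa only [count, hc'] using hk1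
    · obtain ⟨t, c, hc, hl, hk, hm⟩ := ih k
      rw [show I.toAbs.D = I.D from rfl] at h h1
      obtain ⟨b, hb⟩ := Nat.exists_eq_succ_of_ne_zero h1
      rw [← hl, hb, show 2 * b.succ - 1 = 2 * b + 1 by omega] at h
      obtain ⟨hbD, y, hy, ht⟩ := numTrans_write h
      obtain ⟨c', hs, hl', hc', hm', -⟩ := exists_leadStep c _ ht (by simp)
      refine ⟨t, c', hc.tail ⟨_, hs⟩, by rw [hl', hy], ?_, ?_⟩
      · simpa only [count, hc'] using hk
      · intro _
        rw [hm' _ rfl, hb]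
  | @cont u R p l p' hr hp hl ht ih =>
    have hRC := (AbsSys.reach_bounds hr).1
    rcases hl with rfl | ⟨b, hb, rfl, h0⟩ | ⟨b, hb, rfl, h0 | ⟨h0, hbS⟩⟩
    · obtain ⟨t, c, hc, hl, hk, hm⟩ := ih (k + k)
      obtain ⟨y, rfl, ht'⟩ := numTrans_zero (q := ⟨p, hRC p hp⟩) ht
      obtain ⟨c', hc', hl', hk', hk2, hm'⟩ := exists_moveMany c none ht' (by simp) hp hk
      refine ⟨t, c', hc.trans hc', by rw [hl', hl], ?_, ?_⟩
      · rintro s (rfl | hs)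
        exacts [hk2, hk' s hs]
      · intro h; rw [hm' (by simp)]; exact hm h
    · obtain ⟨t, c, hc, hl, hk, hm⟩ := ih (k + k)
      obtain ⟨hb', y, rfl, ht'⟩ := numTrans_write (q := ⟨p, hRC p hp⟩) ht
      obtain ⟨c', hc', hl', hk', hk2, hm'⟩ := exists_moveMany c _ ht' (by simp) hp hk
      refine ⟨t, c', hc.trans hc', by rw [hl', hl], ?_, fun h => absurd h0.symm h⟩
      rintro s (rfl | hs)
      exacts [hk2, hk' s hs]
    · obtain ⟨t, c, hc, hl, hk, hm⟩ := ih (k + k)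
      obtain ⟨hb', y, rfl, ht'⟩ := numTrans_read (q := ⟨p, hRC p hp⟩) ht
      rw [show I.toAbs.D = I.D from rfl] at h0
      obtain ⟨c', hc', hl', hk', hk2, hm'⟩ := exists_moveMany c _ ht' (by
        rintro a ⟨⟩
        have := hm (by omega)
        exact Fin.ext (by simp only; omega)) hp hk
      refine ⟨t, c', hc.trans hc', by rw [hl', hl], ?_, ?_⟩
      · rintro s (rfl | hs)
        exacts [hk2, hk' s hs]
      · intro h; rw [hm' (by simp)]; exact hm h
    · obtain ⟨t, c, hc, hl, hk, hm⟩ := ih (k + k + 1)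
      obtain ⟨c1, hc1, hl1, hk1, hb1⟩ := exists_write c hbS hRC hk
      obtain ⟨hb', y, rfl, ht'⟩ := numTrans_read (q := ⟨p, hRC p hp⟩) ht
      obtain ⟨c', hc', hl', hk', hk2, hm'⟩ := exists_moveMany c1 _ ht' (by
        rintro a ⟨⟩
        exact Fin.ext hb1) hp hk1
      refine ⟨t, c', (hc.trans hc1).trans hc', by rw [hl', hl1, hl], ?_, fun h => absurd h0.symm h⟩
      rintro s (rfl | hs)
      exacts [hk2, hk' s hs]

/-- Every computation of a program with any number of contributors is covered by an abstract one. The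
node of the latter either records the value in memory, or it leaves the value open, which then must be
one that contributors can write. -/
theorem exists_reach_of_run {t : ℕ} {c : (I.copies t).Config}
    (h : (I.copies t).Reaches (I.copies t).initConfig c) :
    ∃ u R, I.toAbs.Reach u R ∧ (∀ i, (contState c i).val ∈ R) ∧ u / (I.D + 1) = leadState c ∧
      (u % (I.D + 1) = c.2.val + 1 ∨ u % (I.D + 1) = 0 ∧ c.2.val ∈ I.toAbs.writable R) := by
  have hdiv : ∀ q m, m < I.D + 1 → (q * (I.D + 1) + m) / (I.D + 1) = q := by
    intro q m hm
    rw [mul_comm, Nat.mul_add_div (by omega), Nat.div_eq_of_lt hm, add_zero]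
  have hmod : ∀ q m, m < I.D + 1 → (q * (I.D + 1) + m) % (I.D + 1) = m := by
    intro q m hm
    rw [mul_comm, Nat.mul_add_mod, Nat.mod_eq_of_lt hm]
  induction h with
  | refl =>
    have : I.toAbs.mem0 + 1 < I.D + 1 := Nat.succ_lt_succ I.toAbs.mem0_lt
    exact ⟨_, _, AbsSys.Reach.init, fun i => rfl, hdiv _ _ this, Or.inl (hmod _ _ this)⟩
  | @tail c c' _ hs ih =>
    obtain ⟨u, R, hr, hR, hq, hm⟩ := ih
    -- the node with the same leader state and irrelevant memory
    have hdrop : I.toAbs.Reach (u / (I.D + 1) * (I.D + 1) + 0) R :=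
      hr.lead (Or.inr (Or.inl ⟨hdiv _ _ (Nat.succ_pos _), hmod _ _ (Nat.succ_pos _)⟩))
    have hd1 := hdiv (u / (I.D + 1)) 0 (Nat.succ_pos _)
    have hd2 := hmod (u / (I.D + 1)) 0 (Nat.succ_pos _)
    obtain ⟨l, hs⟩ := hs
    cases hs with
    | read pc i a q' ht =>
      have ha : a.val + 1 < I.D + 1 := Nat.succ_lt_succ a.2
      rcases i with _ | i
      · have ht' : I.toAbs.lead (u / (I.D + 1)) (2 * a + 2) q'.val := by
          rw [hq]; exact ⟨_, _, _, rfl, rfl, rfl, ht⟩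
        rcases hm with hm | ⟨hm, hw⟩
        · have hm : u % (I.D + 1) = a.val + 1 := hm
          refine ⟨q'.val * (I.D + 1) + (a.val + 1), R, hr.lead (Or.inl ?_), hR, ?_, ?_⟩
          · change u % (I.D + 1) ≠ 0 ∧ _ % (I.D + 1) = u % (I.D + 1) ∧
              (_ ∨ I.toAbs.lead (u / (I.D + 1)) (2 * (u % (I.D + 1))) (_ / (I.D + 1)))
            rw [hdiv _ _ ha, hmod _ _ ha, hm]
            exact ⟨by omega, rfl, Or.inr ht'⟩
          · rw [hdiv _ _ ha]; simp [leadState]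
          · left; rw [hmod _ _ ha]
        · refine ⟨q'.val * (I.D + 1) + 0, R, hr.lead (Or.inr (Or.inr (Or.inl ⟨hm, ?_, ?_⟩))),
            hR, ?_, ?_⟩
          · exact hmod _ _ (Nat.succ_pos _)
          · right
            refine ⟨a, hw, ?_⟩
            change I.toAbs.lead (u / (I.D + 1)) _ (_ / (I.D + 1))
            rw [hdiv _ _ (Nat.succ_pos _)]; exact ht'
          · rw [hdiv _ _ (Nat.succ_pos _)]; simp [leadState]
          · right; exact ⟨hmod _ _ (Nat.succ_pos _), hw⟩
      · refine ⟨u, insert q'.val R, hr.cont (hR i) (l := 2 * a + 2) ?_ ⟨_, _, _, rfl, rfl, rfl, ht⟩,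
          ?_, hq, ?_⟩
        · right; right
          refine ⟨a, a.2, rfl, ?_⟩
          rcases hm with hm | ⟨hm, hw⟩
          · left; exact hm.symm
          · right; exact ⟨hm.symm, hw⟩
        · intro j
          by_cases hj : j = i
          · subst hj; left; simp [contState]
          · right; simpa [contState, hj] using hR j
        · exact hm.imp id fun h => ⟨h.1, AbsSys.writable_mono (Set.subset_insert _ _) h.2⟩
    | write pc i a b q' ht =>
      have hb : b.val + 1 < I.D + 1 := Nat.succ_lt_succ b.2
      rcases i with _ | i
      · have ht' : I.toAbs.lead (u / (I.D + 1)) (2 * b + 1) q'.val := by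
          rw [hq]; exact ⟨_, _, _, rfl, rfl, rfl, ht⟩
        refine ⟨q'.val * (I.D + 1) + (b.val + 1), R,
          hdrop.lead (Or.inr (Or.inr (Or.inr ⟨hd2, ?_, ?_⟩))), hR, ?_, ?_⟩
        · change _ % (I.D + 1) ≠ 0
          rw [hmod _ _ hb]; omega
        · change I.toAbs.lead (_ / (I.D + 1)) (2 * (_ % (I.D + 1)) - 1) (_ / (I.D + 1))
          rw [hd1, hdiv _ _ hb, hmod _ _ hb]
          exact ht'
        · rw [hdiv _ _ hb]; simp [leadState]
        · left; rw [hmod _ _ hb]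
      · have ht' : I.toAbs.cont (contState (I := I) (t := t) (pc, a) i).val (2 * b + 1) q'.val :=
          ⟨_, _, _, rfl, rfl, rfl, ht⟩
        refine ⟨_, insert q'.val R, hdrop.cont (hR i) (l := 2 * b + 1) ?_ ht', ?_, ?_, ?_⟩
        · exact Or.inr (Or.inl ⟨b, b.2, rfl, hd2.symm⟩)
        · intro j
          by_cases hj : j = i
          · subst hj; left; simp [contState]
          · right; simpa [contState, hj] using hR j
        · rw [hd1]; exact hq
        · right
          exact ⟨hd2, b.2, _, Set.mem_insert_of_mem _ (hR i), _, ht'⟩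
    | eps pc i a q' ht =>
      have ha : a.val + 1 < I.D + 1 := Nat.succ_lt_succ a.2
      rcases i with _ | i
      · have ht' : I.toAbs.lead (u / (I.D + 1)) 0 q'.val := by
          rw [hq]; exact ⟨_, _, _, rfl, rfl, rfl, ht⟩
        rcases hm with hm | ⟨hm, hw⟩
        · have hm : u % (I.D + 1) = a.val + 1 := hm
          refine ⟨q'.val * (I.D + 1) + (a.val + 1), R, hr.lead (Or.inl ?_), hR, ?_, ?_⟩
          · change u % (I.D + 1) ≠ 0 ∧ _ % (I.D + 1) = u % (I.D + 1) ∧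
              (I.toAbs.lead (u / (I.D + 1)) 0 (_ / (I.D + 1)) ∨ _)
            rw [hdiv _ _ ha, hmod _ _ ha, hm]
            exact ⟨by omega, rfl, Or.inl ht'⟩
          · rw [hdiv _ _ ha]; simp [leadState]
          · left; rw [hmod _ _ ha]
        · refine ⟨q'.val * (I.D + 1) + 0, R, hr.lead (Or.inr (Or.inr (Or.inl ⟨hm, ?_, ?_⟩))),
            hR, ?_, ?_⟩
          · exact hmod _ _ (Nat.succ_pos _)
          · left
            change I.toAbs.lead (u / (I.D + 1)) _ (_ / (I.D + 1))
            rw [hdiv _ _ (Nat.succ_pos _)]; exact ht'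
          · rw [hdiv _ _ (Nat.succ_pos _)]; simp [leadState]
          · right; exact ⟨hmod _ _ (Nat.succ_pos _), hw⟩
      · refine ⟨u, insert q'.val R, hr.cont (hR i) (l := 0) (Or.inl rfl)
          ⟨_, _, _, rfl, rfl, rfl, ht⟩, ?_, hq, ?_⟩
        · intro j
          by_cases hj : j = i
          · subst hj; left; simp [contState]
          · right; simpa [contState, hj] using hR j
        · exact hm.imp id fun h => ⟨h.1, AbsSys.writable_mono (Set.subset_insert _ _) h.2⟩

/-- Unsafe states of the leader, as numbers. -/
def numUnsafe (I : LCRInstance) (q : ℕ) : Prop := ∃ x ∈ I.unsafeStates, x.val = q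

/-- An instance is positive if and only if its abstraction reaches an unsafe state of the leader. -/
theorem holds_iff_reach (I : LCRInstance) :
    I.Holds ↔ ∃ u R, I.toAbs.Reach u R ∧ numUnsafe I (u / (I.D + 1)) := by
  constructor
  · rintro ⟨t, c, hr, hu⟩
    obtain ⟨u, R, h, -, hq, -⟩ := exists_reach_of_run hr
    exact ⟨u, R, h, _, hu, hq.symm⟩
  · rintro ⟨u, R, h, x, hx, hxu⟩
    obtain ⟨t, c, hr, hl, -, -⟩ := exists_run_of_reach h 0
    refine ⟨t, c, hr, ?_⟩
    have : leadState c = x := Fin.ext (hl.trans hxu.symm)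
    rw [← this] at hx
    exact hx

end LCRInstance

/-! ### Guided simulation -/

namespace AbsSys

variable (Y : AbsSys)

/-- The node with the same leader state as `u` and irrelevant memory. -/
def drop (u : ℕ) : ℕ := u / (Y.D + 1) * (Y.D + 1)

/-- The contributor states reachable from `R` by transitions with labels in `A`. -/
def closure (A : ℕ → Prop) (R : Set ℕ) : Set ℕ :=
  {p' | ∃ p ∈ R, ReflTransGen (fun p p' => ∃ l, A l ∧ Y.cont p l p') p p'}

/-- The memory parts of the nodes that lie on some path of the leader from `u` to `t`. -/
def Between (S : Set ℕ) (u t m : ℕ) : Prop :=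
  ∃ q < Y.L, ReflTransGen (Y.Edge S) u (q * (Y.D + 1) + m) ∧
    ReflTransGen (Y.Edge S) (q * (Y.D + 1) + m) t

/-- What contributors can reach while the leader cycles through its strongly connected component. -/
def saturate (t : ℕ) (R : Set ℕ) : Set ℕ :=
  Y.closure (Y.Enabled (Y.Between (Y.writable R) t t) (Y.writable R)) R

open Classical in
/-- The guide asks the leader to move to `drop g`, passing a node with the memory part of `g`, where
contributors act; then the component of `drop g` is exploited. Since the set of writable values can
grow at most `D` times, `D + 1` saturations suffice. Impossible requests are ignored. -/
noncomputable def guidedStep (s : ℕ × Set ℕ) (g : ℕ) : ℕ × Set ℕ :=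
  if Y.Between (Y.writable s.2) s.1 (Y.drop g) (g % (Y.D + 1)) then
    (Y.drop g, (Y.saturate (Y.drop g))^[Y.D + 1]
      (Y.closure (Y.Enabled (· = g % (Y.D + 1)) (Y.writable s.2)) s.2))
  else s

/-- The node of the initial configuration. -/
def node0 : ℕ := Y.lead0 * (Y.D + 1) + (Y.mem0 + 1)

/-- The result of the simulation of a guide. -/
noncomputable def simulate (gs : List ℕ) : ℕ × Set ℕ := gs.foldl Y.guidedStep (Y.node0, {Y.cont0})

variable {Y}

theorem mul_add_div_succ {q m : ℕ} (h : m < Y.D + 1) : (q * (Y.D + 1) + m) / (Y.D + 1) = q := by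
  rw [mul_comm, Nat.mul_add_div (by omega), Nat.div_eq_of_lt h, add_zero]

theorem mul_add_mod_succ {q m : ℕ} (h : m < Y.D + 1) : (q * (Y.D + 1) + m) % (Y.D + 1) = m := by
  rw [mul_comm, Nat.mul_add_mod, Nat.mod_eq_of_lt h]

theorem div_mul_add_mod_succ (u : ℕ) : u / (Y.D + 1) * (Y.D + 1) + u % (Y.D + 1) = u := by
  rw [mul_comm]; exact Nat.div_add_mod u _

theorem drop_div (u : ℕ) : Y.drop u / (Y.D + 1) = u / (Y.D + 1) :=
  Nat.mul_div_cancel _ (Nat.succ_pos _)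

theorem drop_mod (u : ℕ) : Y.drop u % (Y.D + 1) = 0 := Nat.mul_mod_left _ _

theorem drop_eq_self {u : ℕ} (h : u % (Y.D + 1) = 0) : Y.drop u = u := by
  have := div_mul_add_mod_succ (Y := Y) u
  rw [h] at this
  exact this

theorem edge_drop (S : Set ℕ) (u : ℕ) : Y.Edge S u (Y.drop u) :=
  Or.inr (Or.inl ⟨drop_div u, drop_mod u⟩)

theorem Edge.mono {S S' : Set ℕ} (h : S ⊆ S') {u w : ℕ} (he : Y.Edge S u w) : Y.Edge S' u w := by
  rcases he with he | he | ⟨h0, h1, he | ⟨b, hb, he⟩⟩ | he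
  · exact Or.inl he
  · exact Or.inr (Or.inl he)
  · exact Or.inr (Or.inr (Or.inl ⟨h0, h1, Or.inl he⟩))
  · exact Or.inr (Or.inr (Or.inl ⟨h0, h1, Or.inr ⟨b, h hb, he⟩⟩))
  · exact Or.inr (Or.inr (Or.inr he))

theorem Edge.lt {S : Set ℕ} {u w : ℕ} (he : Y.Edge S u w) (hu : u / (Y.D + 1) < Y.L) :
    w / (Y.D + 1) < Y.L := by
  rcases he with ⟨-, -, h | h⟩ | ⟨h, -⟩ | ⟨-, -, h | ⟨b, -, h⟩⟩ | ⟨-, -, h⟩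
  · exact Y.lead_lt h
  · exact Y.lead_lt h
  · rwa [h]
  · exact Y.lead_lt h
  · exact Y.lead_lt h
  · exact Y.lead_lt h

theorem path_mono {S S' : Set ℕ} (h : S ⊆ S') {u w : ℕ} (hp : ReflTransGen (Y.Edge S) u w) :
    ReflTransGen (Y.Edge S') u w :=
  ReflTransGen.mono (fun _ _ (he : Y.Edge S _ _) => he.mono h) _ _ hp

theorem path_lt {S : Set ℕ} {u w : ℕ} (hp : ReflTransGen (Y.Edge S) u w)
    (hu : u / (Y.D + 1) < Y.L) : w / (Y.D + 1) < Y.L := by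
  induction hp with
  | refl => exact hu
  | tail _ he ih => exact he.lt ih

theorem between_iff {S : Set ℕ} {u t w : ℕ} (hu : u / (Y.D + 1) < Y.L)
    (h1 : ReflTransGen (Y.Edge S) u w) (h2 : ReflTransGen (Y.Edge S) w t) :
    Y.Between S u t (w % (Y.D + 1)) :=
  ⟨w / (Y.D + 1), path_lt h1 hu, by rwa [div_mul_add_mod_succ], by rwa [div_mul_add_mod_succ]⟩

theorem subset_closure (A : ℕ → Prop) (R : Set ℕ) : R ⊆ Y.closure A R :=
  fun p hp => ⟨p, hp, ReflTransGen.refl⟩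

theorem closure_step {A : ℕ → Prop} {R : Set ℕ} {p l p' : ℕ} (hp : p ∈ Y.closure A R) (hl : A l)
    (h : Y.cont p l p') : p' ∈ Y.closure A R := by
  obtain ⟨r, hr, hp⟩ := hp
  exact ⟨r, hr, hp.tail ⟨l, hl, h⟩⟩

theorem closure_closure (A : ℕ → Prop) (R : Set ℕ) : Y.closure A (Y.closure A R) = Y.closure A R := by
  refine Set.Subset.antisymm ?_ (subset_closure _ _)
  rintro p ⟨r, ⟨s, hs, hr⟩, hp⟩
  exact ⟨s, hs, hr.trans hp⟩

theorem closure_lt {A : ℕ → Prop} {R : Set ℕ} (hR : ∀ p ∈ R, p < Y.C) : ∀ p ∈ Y.closure A R, p < Y.C := by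
  rintro p ⟨r, hr, hp⟩
  induction hp with
  | refl => exact hR _ hr
  | tail _ h _ =>
    obtain ⟨l, -, h⟩ := h
    exact Y.cont_lt h

/-- If every single transition with a label in `A` can be realised at the node `t`, then all of
`closure A R` can be realised there. -/
theorem exists_reach_closure {A : ℕ → Prop} {R : Set ℕ} {t : ℕ}
    (hstep : ∀ R', R ⊆ R' → Y.Reach t R' → ∀ p ∈ R', ∀ l p', A l → Y.cont p l p' →
      ∃ R'', insert p' R' ⊆ R'' ∧ Y.Reach t R'')
    (h : ∃ R', R ⊆ R' ∧ Y.Reach t R') : ∃ R', Y.closure A R ⊆ R' ∧ Y.Reach t R' := by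
  have hR : ∀ p ∈ R, p < Y.C := by
    obtain ⟨R', h1, h2⟩ := h
    exact fun p hp => (reach_bounds h2).1 p (h1 hp)
  have key : ∀ n, ∃ R', R ⊆ R' ∧ (∀ p ∈ Y.closure A R, p < n → p ∈ R') ∧ Y.Reach t R' := by
    intro n
    induction n with
    | zero =>
      obtain ⟨R', h1, h2⟩ := h
      exact ⟨R', h1, by simp, h2⟩
    | succ n ih =>
      obtain ⟨R', h1, h2, h3⟩ := ih
      by_cases hn : n ∈ Y.closure A R
      · obtain ⟨r, hr, hp⟩ := hn
        have : ∃ R'', R' ⊆ R'' ∧ n ∈ R'' ∧ Y.Reach t R'' := by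
          clear h2
          induction hp with
          | refl => exact ⟨R', subset_rfl, h1 hr, h3⟩
          | tail _ he ih =>
            obtain ⟨R'', g1, g2, g3⟩ := ih
            obtain ⟨l, hl, he⟩ := he
            obtain ⟨R3, f1, f2⟩ := hstep R'' (h1.trans g1) g3 _ g2 _ _ hl he
            exact ⟨R3, g1.trans ((Set.subset_insert _ _).trans f1), f1 (Set.mem_insert _ _), f2⟩
        obtain ⟨R'', g1, g2, g3⟩ := this
        refine ⟨R'', h1.trans g1, fun p hp hpn => ?_, g3⟩
        rcases Nat.lt_succ_iff_lt_or_eq.1 hpn with hpn | rfl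
        · exact g1 (h2 p hp hpn)
        · exact g2
      · refine ⟨R', h1, fun p hp hpn => ?_, h3⟩
        rcases Nat.lt_succ_iff_lt_or_eq.1 hpn with hpn | rfl
        · exact h2 p hp hpn
        · exact absurd hp hn
  obtain ⟨R', h1, h2, h3⟩ := key Y.C
  exact ⟨R', fun p hp => h2 p hp (closure_lt hR p hp), h3⟩

theorem Reach.path {u w : ℕ} {R S : Set ℕ} (h : Y.Reach u R) (hS : S ⊆ Y.writable R)
    (hp : ReflTransGen (Y.Edge S) u w) : Y.Reach w R := by
  induction hp with
  | refl => exact h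
  | tail _ he ih => exact ih.lead (he.mono hS)

theorem Enabled.mono {X X' : ℕ → Prop} {S S' : Set ℕ} (hX : ∀ m, X m → X' m) (hS : S ⊆ S') {l : ℕ}
    (h : Y.Enabled X S l) : Y.Enabled X' S' l := by
  rcases h with rfl | ⟨b, hb, rfl, h0⟩ | ⟨b, hb, rfl, h0 | ⟨h0, hS'⟩⟩
  · exact Or.inl rfl
  · exact Or.inr (Or.inl ⟨b, hb, rfl, hX _ h0⟩)
  · exact Or.inr (Or.inr ⟨b, hb, rfl, Or.inl (hX _ h0)⟩)
  · exact Or.inr (Or.inr ⟨b, hb, rfl, Or.inr ⟨hX _ h0, hS hS'⟩⟩)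

theorem exists_reach_closure_node {R R₀ : Set ℕ} {t : ℕ} (h0 : R₀ ⊆ R)
    (h : ∃ R', R ⊆ R' ∧ Y.Reach t R') :
    ∃ R', Y.closure (Y.Enabled (· = t % (Y.D + 1)) (Y.writable R₀)) R ⊆ R' ∧ Y.Reach t R' := by
  refine exists_reach_closure ?_ h
  intro R' hR hr p hp l p' hl ht
  exact ⟨_, subset_rfl, hr.cont hp (hl.mono (fun _ h => h) (writable_mono (h0.trans hR))) ht⟩

/-- Saturation is sound: the leader can visit any node on a cycle through `t` and come back, and the
values needed on the way are still writable when the set of contributor states has grown. -/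
theorem exists_reach_saturate {R : Set ℕ} {t : ℕ} (h : ∃ R', R ⊆ R' ∧ Y.Reach t R') :
    ∃ R', Y.saturate t R ⊆ R' ∧ Y.Reach t R' := by
  refine exists_reach_closure ?_ h
  intro R' hR hr p hp l p' hl ht
  have hS := writable_mono (Y := Y) hR
  -- a visit of a node with memory part `m` from `t` and back
  have visit : ∀ m, m < Y.D + 1 → Y.Between (Y.writable R) t t m →
      Y.Enabled (· = m) (Y.writable R) l → ∃ R'', insert p' R' ⊆ R'' ∧ Y.Reach t R'' := by
    rintro m hm ⟨q, -, h1, h2⟩ hl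
    refine ⟨_, subset_rfl, ((hr.path hS h1).cont hp (l := l) ?_ ht).path
      (hS.trans (writable_mono (Set.subset_insert _ _))) h2⟩
    rw [mul_add_mod_succ hm]
    exact hl.mono (fun _ h => h) hS
  rcases hl with rfl | ⟨b, hb, rfl, h0⟩ | ⟨b, hb, rfl, h0 | ⟨h0, hbS⟩⟩
  · exact ⟨_, subset_rfl, hr.cont hp (Or.inl rfl) ht⟩
  · exact visit 0 (Nat.succ_pos _) h0 (Or.inr (Or.inl ⟨b, hb, rfl, rfl⟩))
  · exact visit (b + 1) (Nat.succ_lt_succ hb) h0 (Or.inr (Or.inr ⟨b, hb, rfl, Or.inl rfl⟩))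
  · exact visit 0 (Nat.succ_pos _) h0 (Or.inr (Or.inr ⟨b, hb, rfl, Or.inr ⟨rfl, hbS⟩⟩))

theorem exists_reach_iterate_saturate {R : Set ℕ} {t : ℕ} (h : ∃ R', R ⊆ R' ∧ Y.Reach t R') (n : ℕ) :
    ∃ R', (Y.saturate t)^[n] R ⊆ R' ∧ Y.Reach t R' := by
  induction n with
  | zero => exact h
  | succ n ih =>
    rw [Function.iterate_succ_apply']
    exact exists_reach_saturate ih

theorem exists_reach_guidedStep {s : ℕ × Set ℕ} (g : ℕ) (h : ∃ R', s.2 ⊆ R' ∧ Y.Reach s.1 R') :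
    ∃ R', (Y.guidedStep s g).2 ⊆ R' ∧ Y.Reach (Y.guidedStep s g).1 R' := by
  unfold guidedStep
  split_ifs with hb
  · apply exists_reach_iterate_saturate
    obtain ⟨q, -, h1, h2⟩ := hb
    have hm : g % (Y.D + 1) < Y.D + 1 := Nat.mod_lt _ (Nat.succ_pos _)
    obtain ⟨R', hR, hr⟩ := h
    have := exists_reach_closure_node (R₀ := s.2) subset_rfl
      ⟨R', hR, hr.path (writable_mono hR) h1⟩
    rw [mul_add_mod_succ hm] at this
    obtain ⟨R'', hR', hr'⟩ := this
    exact ⟨R'', hR', hr'.path (writable_mono ((subset_closure _ _).trans hR')) h2⟩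
  · exact h

/-- The simulation of a guide only finds what is reachable. -/
theorem exists_reach_simulate (gs : List ℕ) :
    ∃ R', (Y.simulate gs).2 ⊆ R' ∧ Y.Reach (Y.simulate gs).1 R' := by
  induction gs using List.reverseRecOn with
  | nil => exact ⟨_, subset_rfl, Reach.init⟩
  | append_singleton gs g ih =>
    rw [simulate, List.foldl_append]
    exact exists_reach_guidedStep g ih

/-! ### Every abstract computation follows a short guide -/

theorem subset_saturate (t : ℕ) (R : Set ℕ) : R ⊆ Y.saturate t R := subset_closure _ _

/-- Saturation becomes stationary after `D + 1` rounds: a round that makes no further value writable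
is followed by stationary rounds only. -/
theorem saturate_iterate_stable (t : ℕ) (R : Set ℕ) :
    Y.saturate t ((Y.saturate t)^[Y.D + 1] R) = (Y.saturate t)^[Y.D + 1] R := by
  have hfin : ∀ R', (Y.writable R').Finite := fun R' => (Set.finite_Iio Y.D).subset fun b hb => hb.1
  have key : ∀ n, Y.saturate t ((Y.saturate t)^[n] R) = (Y.saturate t)^[n] R ∨
      n ≤ (Y.writable ((Y.saturate t)^[n] R)).ncard := by
    intro n
    induction n with
    | zero => right; exact Nat.zero_le _
    | succ n ih =>
      rw [Function.iterate_succ_apply']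
      set T := (Y.saturate t)^[n] R
      rcases ih with ih | ih
      · left; rw [ih, ih]
      · have hsub := writable_mono (Y := Y) (subset_saturate (Y := Y) t T)
        by_cases heq : Y.writable T = Y.writable (Y.saturate t T)
        · left
          conv_lhs => rw [saturate, ← heq]
          exact closure_closure _ _
        · right
          exact ih.trans_lt (Set.ncard_lt_ncard (hsub.ssubset_of_ne heq) (hfin _))
  rcases key (Y.D + 1) with h | h
  · exact h
  · have h2 := Set.ncard_le_ncard (t := Set.Iio Y.D) (s := Y.writable ((Y.saturate t)^[Y.D + 1] R))
      (fun b hb => hb.1) (Set.finite_Iio _)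
    have h3 : (Set.Iio Y.D).ncard = Y.D := by
      rw [Set.ncard_eq_toFinset_card' (Set.Iio Y.D)]; simp
    rw [h3] at h2
    exact absurd (h.trans h2) (Nat.not_succ_le_self _)

/-- The simulation of a guide has come to node `v` with contributor states `T`, having dropped the
memory at the leader states `l`, latest first. All these states lead to `v`, and they are distinct, so
the guide has at most `L` entries. -/
structure Follows (gs l : List ℕ) (v : ℕ) (T : Set ℕ) : Prop where
  sim : Y.simulate gs = (v, T)
  length : gs.length = l.length
  guide_lt : ∀ g ∈ gs, g < Y.L * (Y.D + 1)
  nodup : l.Nodup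
  lt : ∀ q ∈ l, q < Y.L
  back : ∀ q ∈ l, ReflTransGen (Y.Edge (Y.writable T)) (q * (Y.D + 1)) v
  stable : l ≠ [] → Y.saturate v T = T ∧ v % (Y.D + 1) = 0
  node_lt : v / (Y.D + 1) < Y.L

theorem subset_iterate_saturate (t : ℕ) (R : Set ℕ) (n : ℕ) : R ⊆ (Y.saturate t)^[n] R := by
  induction n with
  | zero => exact subset_rfl
  | succ n ih => rw [Function.iterate_succ_apply']; exact ih.trans (subset_saturate _ _)

/-- If the simulation cannot return from `w` to its position, then the guide can be extended by a move
to `drop w`. The state of `w` is a new one, since all states in `l` lead to the position. -/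
theorem Follows.extend {gs l : List ℕ} {v : ℕ} {T : Set ℕ} (h : Follows (Y := Y) gs l v T) {w : ℕ}
    (hw : ReflTransGen (Y.Edge (Y.writable T)) v w)
    (hback : l ≠ [] → ¬ ReflTransGen (Y.Edge (Y.writable T)) (Y.drop w) v) :
    ∃ T', Follows (Y := Y) (gs ++ [w]) (w / (Y.D + 1) :: l) (Y.drop w) T' ∧
      Y.closure (Y.Enabled (· = w % (Y.D + 1)) (Y.writable T)) T ⊆ T' := by
  have hwL := path_lt hw h.node_lt
  have hdrop : ReflTransGen (Y.Edge (Y.writable T)) w (Y.drop w) :=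
    ReflTransGen.single (edge_drop _ w)
  set T₁ := Y.closure (Y.Enabled (· = w % (Y.D + 1)) (Y.writable T)) T with hT₁
  have hsub : T₁ ⊆ (Y.saturate (Y.drop w))^[Y.D + 1] T₁ := subset_iterate_saturate _ _ _
  have hT : T ⊆ (Y.saturate (Y.drop w))^[Y.D + 1] T₁ := (subset_closure _ _).trans hsub
  refine ⟨(Y.saturate (Y.drop w))^[Y.D + 1] T₁, ⟨?_, ?_, ?_, ?_, ?_, ?_, ?_, ?_⟩, hsub⟩
  · have := h.sim
    rw [simulate] at this ⊢
    rw [List.foldl_append, this, List.foldl_cons, List.foldl_nil, guidedStep,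
      if_pos (between_iff h.node_lt hw hdrop)]
  · simp [h.length]
  · intro g hg
    rcases List.mem_append.1 hg with hg | hg
    · exact h.guide_lt g hg
    · rw [List.mem_singleton.1 hg, ← div_mul_add_mod_succ (Y := Y) w]
      have h1 : w % (Y.D + 1) < Y.D + 1 := Nat.mod_lt _ (Nat.succ_pos _)
      calc w / (Y.D + 1) * (Y.D + 1) + w % (Y.D + 1)
          < w / (Y.D + 1) * (Y.D + 1) + (Y.D + 1) := by omega
        _ = (w / (Y.D + 1) + 1) * (Y.D + 1) := by ring
        _ ≤ Y.L * (Y.D + 1) := Nat.mul_le_mul_right _ hwL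
  · refine List.nodup_cons.2 ⟨fun hmem => ?_, h.nodup⟩
    exact hback (List.ne_nil_of_mem hmem) (h.back _ hmem)
  · intro q hq
    rcases List.mem_cons.1 hq with rfl | hq
    · exact hwL
    · exact h.lt q hq
  · intro q hq
    rcases List.mem_cons.1 hq with rfl | hq
    · exact ReflTransGen.refl
    · exact path_mono (writable_mono hT) (((h.back q hq).trans hw).trans hdrop)
  · exact fun _ => ⟨saturate_iterate_stable _ _, drop_mod w⟩
  · rw [drop_div]; exact hwL

/-- Invariant of the proof that guided simulations cover all abstract computations: while the memory
is relevant, contributors have only acted at one node since the last drop; while it is not, the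
leader is in the strongly connected component of the simulation. -/
def Covered (u : ℕ) (R : Set ℕ) : Prop :=
  ∃ gs l v T, Follows (Y := Y) gs l v T ∧ ReflTransGen (Y.Edge (Y.writable T)) v u ∧
    ((u % (Y.D + 1) ≠ 0 ∧ R ⊆ Y.closure (Y.Enabled (· = u % (Y.D + 1)) (Y.writable T)) T) ∨
      (u % (Y.D + 1) = 0 ∧ R ⊆ T ∧ l ≠ [] ∧ ReflTransGen (Y.Edge (Y.writable T)) u v))

/-- In a saturated state, contributors have already reached all they can in the component. -/
theorem closure_subset_of_stable {v w : ℕ} {T : Set ℕ} (hs : Y.saturate v T = T)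
    (hv : v / (Y.D + 1) < Y.L)
    (h1 : ReflTransGen (Y.Edge (Y.writable T)) v w) (h2 : ReflTransGen (Y.Edge (Y.writable T)) w v) :
    Y.closure (Y.Enabled (· = w % (Y.D + 1)) (Y.writable T)) T ⊆ T := by
  have hb := between_iff hv h1 h2
  rintro p ⟨r, hr, hp⟩
  rw [← hs]
  refine ⟨r, hr, ReflTransGen.mono (fun a b => ?_) _ _ hp⟩
  rintro ⟨l, hl, h⟩
  exact ⟨l, hl.mono (by rintro m rfl; exact hb) subset_rfl, h⟩

/-- Moving on to a node with irrelevant memory, either inside the component or by a new move. -/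
theorem covered_drop {gs l : List ℕ} {v w : ℕ} {T R : Set ℕ} (h : Follows (Y := Y) gs l v T)
    (hw : ReflTransGen (Y.Edge (Y.writable T)) v w)
    (hR : R ⊆ Y.closure (Y.Enabled (· = w % (Y.D + 1)) (Y.writable T)) T) :
    Covered (Y := Y) (Y.drop w) R := by
  have hdrop : ReflTransGen (Y.Edge (Y.writable T)) w (Y.drop w) :=
    ReflTransGen.single (edge_drop _ w)
  by_cases hb : l ≠ [] ∧ ReflTransGen (Y.Edge (Y.writable T)) (Y.drop w) v
  · refine ⟨gs, l, v, T, h, hw.trans hdrop, Or.inr ⟨drop_mod w, ?_, hb.1, hb.2⟩⟩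
    exact hR.trans (closure_subset_of_stable (h.stable hb.1).1 h.node_lt hw (hdrop.trans hb.2))
  · obtain ⟨T', h', hT'⟩ := h.extend hw fun hl hbk => hb ⟨hl, hbk⟩
    exact ⟨_, _, _, T', h', ReflTransGen.refl,
      Or.inr ⟨drop_mod w, hR.trans hT', List.cons_ne_nil _ _, ReflTransGen.refl⟩⟩

/-- Guided simulations cover all abstract computations. -/
theorem covered_of_reach {u : ℕ} {R : Set ℕ} (h : Y.Reach u R) : Covered (Y := Y) u R := by
  induction h with
  | init =>
    have hm : Y.mem0 + 1 < Y.D + 1 := Nat.succ_lt_succ Y.mem0_lt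
    have hdiv := mul_add_div_succ (Y := Y) (q := Y.lead0) hm
    have hmod := mul_add_mod_succ (Y := Y) (q := Y.lead0) hm
    refine ⟨[], [], Y.node0, {Y.cont0}, ⟨rfl, rfl, by simp, by simp, by simp, by simp, by simp, ?_⟩,
      ReflTransGen.refl, Or.inl ⟨?_, subset_closure _ _⟩⟩
    · rw [node0, hdiv]; exact Y.lead0_lt
    · rw [hmod]; omega
  | @lead u w R hr he ih =>
    obtain ⟨gs, l, v, T, hf, hvu, ⟨hu, hR⟩ | ⟨hu, hR, hl, huv⟩⟩ := ih
    · rcases he with he | he | he | he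
      · refine ⟨gs, l, v, T, hf, hvu.tail (Or.inl he), Or.inl ⟨by rw [he.2.1]; exact hu, ?_⟩⟩
        rw [he.2.1]; exact hR
      · have : w = Y.drop u := by
          have h1 := div_mul_add_mod_succ (Y := Y) w
          rw [he.2, he.1] at h1
          exact h1.symm
        rw [this]
        exact covered_drop hf hvu hR
      · exact absurd he.1 hu
      · exact absurd he.1 hu
    · have he' := he.mono (writable_mono hR)
      have hvw := hvu.tail he'
      by_cases hw : w % (Y.D + 1) = 0
      · rw [← drop_eq_self hw]
        exact covered_drop hf hvw (hR.trans (subset_closure _ _))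
      · exact ⟨gs, l, v, T, hf, hvw, Or.inl ⟨hw, hR.trans (subset_closure _ _)⟩⟩
  | @cont u R p l' p' hr hp hl' ht ih =>
    obtain ⟨gs, l, v, T, hf, hvu, ⟨hu, hR⟩ | ⟨hu, hR, hl, huv⟩⟩ := ih
    · refine ⟨gs, l, v, T, hf, hvu, Or.inl ⟨hu, ?_⟩⟩
      rintro s (rfl | hs)
      · refine closure_step (hR hp) ?_ ht
        rcases hl' with rfl | ⟨b, hb, rfl, h0⟩ | ⟨b, hb, rfl, h0 | ⟨h0, hbS⟩⟩
        · exact Or.inl rfl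
        · exact absurd h0.symm hu
        · exact Or.inr (Or.inr ⟨b, hb, rfl, Or.inl h0⟩)
        · exact absurd h0.symm hu
      · exact hR hs
    · refine ⟨gs, l, v, T, hf, hvu, Or.inr ⟨hu, ?_, hl, huv⟩⟩
      rintro s (rfl | hs)
      · exact closure_subset_of_stable (hf.stable hl).1 hf.node_lt hvu huv
          ⟨p, hR hp, ReflTransGen.single ⟨l', hl'.mono (fun _ h => h) (writable_mono hR), ht⟩⟩
      · exact hR hs

/-- A request that names the current position changes nothing, which allows padding a guide to a fixed
length. -/
theorem guidedStep_eq_self {s : ℕ × Set ℕ} (h0 : s.1 % (Y.D + 1) = 0) (hs : Y.saturate s.1 s.2 = s.2)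
    (hL : s.1 / (Y.D + 1) < Y.L) : Y.guidedStep s s.1 = s := by
  have hd := drop_eq_self h0
  have hc : Y.closure (Y.Enabled (· = s.1 % (Y.D + 1)) (Y.writable s.2)) s.2 = s.2 :=
    Set.Subset.antisymm (closure_subset_of_stable hs hL ReflTransGen.refl ReflTransGen.refl)
      (subset_closure _ _)
  rw [guidedStep, if_pos, hd, hc, Function.iterate_fixed hs]
  rw [hd]
  exact between_iff hL ReflTransGen.refl ReflTransGen.refl

/-- Reachability of leader states is decided by the simulations of all guides of length `L + 1`. -/
theorem exists_reach_iff_exists_guide (U : ℕ → Prop) :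
    (∃ u R, Y.Reach u R ∧ U (u / (Y.D + 1))) ↔
      ∃ gs : List ℕ, gs.length = Y.L + 1 ∧ (∀ g ∈ gs, g < Y.L * (Y.D + 1)) ∧
        U ((Y.simulate gs).1 / (Y.D + 1)) := by
  constructor
  · rintro ⟨u, R, hr, hU⟩
    obtain ⟨gs, l, v, T, hf, hvu, -⟩ := covered_of_reach hr
    have huL : u / (Y.D + 1) < Y.L := path_lt hvu hf.node_lt
    -- a last move brings the simulation to `u` itself, where it stays
    have hstay : ∀ n, ∃ T', Y.simulate (gs ++ List.replicate (n + 1) (Y.drop u)) = (Y.drop u, T') ∧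
        Y.saturate (Y.drop u) T' = T' := by
      intro n
      induction n with
      | zero =>
        have hp := hvu.tail (edge_drop _ u)
        have hb := between_iff (t := Y.drop (Y.drop u)) hf.node_lt hp
          (ReflTransGen.single (edge_drop _ _))
        have := hf.sim
        rw [simulate] at this
        rw [simulate, List.foldl_append, this]
        simp only [List.replicate, List.foldl_cons, List.foldl_nil, guidedStep, if_pos hb]
        rw [drop_eq_self (drop_mod u)]
        exact ⟨_, rfl, saturate_iterate_stable _ _⟩
      | succ n ih =>
        obtain ⟨T', h1, h2⟩ := ih
        refine ⟨T', ?_, h2⟩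
        rw [List.replicate_succ', ← List.append_assoc, simulate, List.foldl_append, ← simulate, h1]
        exact guidedStep_eq_self (drop_mod u) h2 (by rwa [drop_div])
    have hlen : gs.length ≤ Y.L := by
      rw [hf.length]
      have := hf.nodup.length_le_of_subset (l₂ := List.range Y.L) fun q hq =>
        List.mem_range.2 (hf.lt q hq)
      rwa [List.length_range] at this
    obtain ⟨T', h1, -⟩ := hstay (Y.L - gs.length)
    refine ⟨_, ?_, ?_, by rw [h1, drop_div]; exact hU⟩
    · rw [List.length_append, List.length_replicate]; omega
    · intro g hg
      rcases List.mem_append.1 hg with hg | hg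
      · exact hf.guide_lt g hg
      · rw [List.eq_of_mem_replicate hg]
        exact Nat.mul_lt_mul_of_pos_right huL (Nat.succ_pos _)
  · rintro ⟨gs, -, -, hU⟩
    obtain ⟨R, -, hr⟩ := exists_reach_simulate (Y := Y) gs
    exact ⟨_, R, hr, hU⟩

end AbsSys

/-! ### A language of bounded loops -/

namespace Loop

/-- A state of a loop program: numbered variables and numbered arrays. -/
structure St where
  v : ℕ → ℕ
  a : ℕ → ℕ → ℕ

/-- Assignment to a variable. -/
def St.setV (σ : St) (x n : ℕ) : St := ⟨Function.update σ.v x n, σ.a⟩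

/-- Assignment to an entry of an array. -/
def St.setA (σ : St) (b i n : ℕ) : St :=
  ⟨σ.v, Function.update σ.a b (Function.update (σ.a b) i n)⟩

@[simp] theorem St.setV_a (σ : St) (x n : ℕ) : (σ.setV x n).a = σ.a := rfl
@[simp] theorem St.setA_v (σ : St) (b i n : ℕ) : (σ.setA b i n).v = σ.v := rfl
@[simp] theorem St.setV_self (σ : St) (x n : ℕ) : (σ.setV x n).v x = n := by simp [St.setV]
theorem St.setV_of_ne (σ : St) {x y : ℕ} (n : ℕ) (h : y ≠ x) : (σ.setV x n).v y = σ.v y := by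
  simp [St.setV, h]
theorem St.setV_v (σ : St) (x n y : ℕ) : (σ.setV x n).v y = if y = x then n else σ.v y := by
  simp [St.setV, Function.update_apply]
@[simp] theorem St.setA_self (σ : St) (b i n : ℕ) :
    (σ.setA b i n).a b = Function.update (σ.a b) i n := by simp [St.setA]
theorem St.setA_of_ne (σ : St) {b c : ℕ} (i n : ℕ) (h : c ≠ b) : (σ.setA b i n).a c = σ.a c := by
  simp [St.setA, h]

/-- Binary operations; `eq` is the characteristic function of equality. -/
inductive Op where
  | add | sub | mul | min | eq

/-- The value of an operation. -/
def Op.eval : Op → ℕ → ℕ → ℕ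
  | add, m, n => m + n
  | sub, m, n => m - n
  | mul, m, n => m * n
  | min, m, n => Min.min m n
  | eq, m, n => if m = n then 1 else 0

/-- Expressions. `any x y e` is the truth value of `e ≠ 0` for some value of the variable `x` below
that of the variable `y`. -/
inductive Exp where
  | const (n : ℕ)
  | var (x : ℕ)
  | get (a : ℕ) (e : Exp)
  | bin (o : Op) (e₁ e₂ : Exp)
  | any (x y : ℕ) (e : Exp)

open Classical in
/-- The value of an expression. -/
noncomputable def Exp.eval : Exp → St → ℕ
  | const n, _ => n
  | var x, σ => σ.v x
  | get a e, σ => σ.a a (e.eval σ)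
  | bin o e₁ e₂, σ => o.eval (e₁.eval σ) (e₂.eval σ)
  | any x y e, σ => if ∃ i < σ.v y, e.eval (σ.setV x i) ≠ 0 then 1 else 0

/-- Commands. `ite e c₁ c₂` branches on `e ≠ 0`; `loop x y c` executes `c` with `x` running through the
numbers below the initial value of `y`. -/
inductive Cmd where
  | skip
  | set (x : ℕ) (e : Exp)
  | put (a : ℕ) (e₁ e₂ : Exp)
  | seq (c₁ c₂ : Cmd)
  | ite (e : Exp) (c₁ c₂ : Cmd)
  | loop (x y : ℕ) (c : Cmd)

/-- `f (n - 1) (... (f 0 σ))` -/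
def iter {α : Type*} (f : ℕ → α → α) : ℕ → α → α
  | 0, σ => σ
  | n + 1, σ => f n (iter f n σ)

open Classical in
/-- The effect of a command on a state. -/
noncomputable def Cmd.exec : Cmd → St → St
  | skip, σ => σ
  | set x e, σ => σ.setV x (e.eval σ)
  | put a e₁ e₂, σ => σ.setA a (e₁.eval σ) (e₂.eval σ)
  | seq c₁ c₂, σ => c₂.exec (c₁.exec σ)
  | ite e c₁ c₂, σ => if e.eval σ ≠ 0 then c₁.exec σ else c₂.exec σ
  | .loop x y c, σ => iter (fun i τ => c.exec (τ.setV x i)) (σ.v y) σ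

/-- The variables that a command may change. -/
def Cmd.vars : Cmd → List ℕ
  | skip => []
  | set x _ => [x]
  | put _ _ _ => []
  | seq c₁ c₂ => c₁.vars ++ c₂.vars
  | ite _ c₁ c₂ => c₁.vars ++ c₂.vars
  | .loop x _ c => x :: c.vars

/-- The arrays that a command may change. -/
def Cmd.arrs : Cmd → List ℕ
  | skip => []
  | set _ _ => []
  | put a _ _ => [a]
  | seq c₁ c₂ => c₁.arrs ++ c₂.arrs
  | ite _ c₁ c₂ => c₁.arrs ++ c₂.arrs
  | .loop _ _ c => c.arrs

theorem iter_induction {α : Type*} {f : ℕ → α → α} {P : ℕ → α → Prop} {n : ℕ} {σ : α}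
    (h0 : P 0 σ) (hs : ∀ i < n, ∀ τ, P i τ → P (i + 1) (f i τ)) : P n (iter f n σ) := by
  have : ∀ k ≤ n, P k (iter f k σ) := by
    intro k
    induction k with
    | zero => exact fun _ => h0
    | succ k ih => exact fun hk => hs k hk _ (ih (by omega))
  exact this n le_rfl

theorem Cmd.exec_v {c : Cmd} {x : ℕ} (h : x ∉ c.vars) (σ : St) : (c.exec σ).v x = σ.v x := by
  induction c generalizing σ with
  | skip => rfl
  | set y e => exact St.setV_of_ne _ _ (by simpa [Cmd.vars] using h)
  | put a e₁ e₂ => rfl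
  | seq c₁ c₂ ih₁ ih₂ =>
    simp only [Cmd.vars, List.mem_append, not_or] at h
    rw [Cmd.exec, ih₂ h.2, ih₁ h.1]
  | ite e c₁ c₂ ih₁ ih₂ =>
    simp only [Cmd.vars, List.mem_append, not_or] at h
    rw [Cmd.exec]
    split_ifs
    · exact ih₁ h.1 σ
    · exact ih₂ h.2 σ
  | loop y z c ih =>
    simp only [Cmd.vars, List.mem_cons, not_or] at h
    rw [Cmd.exec]
    refine iter_induction (P := fun _ (τ : St) => τ.v x = σ.v x) rfl ?_
    intro i _ τ hτ
    rw [ih h.2, St.setV_of_ne _ _ h.1, hτ]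

theorem Cmd.exec_a {c : Cmd} {a : ℕ} (h : a ∉ c.arrs) (σ : St) : (c.exec σ).a a = σ.a a := by
  induction c generalizing σ with
  | skip => rfl
  | set y e => rfl
  | put b e₁ e₂ => exact St.setA_of_ne _ _ _ (by simpa [Cmd.arrs] using h)
  | seq c₁ c₂ ih₁ ih₂ =>
    simp only [Cmd.arrs, List.mem_append, not_or] at h
    rw [Cmd.exec, ih₂ h.2, ih₁ h.1]
  | ite e c₁ c₂ ih₁ ih₂ =>
    simp only [Cmd.arrs, List.mem_append, not_or] at h
    rw [Cmd.exec]
    split_ifs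
    · exact ih₁ h.1 σ
    · exact ih₂ h.2 σ
  | loop y z c ih =>
    rw [Cmd.exec]
    refine iter_induction (P := fun _ (τ : St) => τ.a a = σ.a a) rfl ?_
    intro i _ τ hτ
    rw [ih h, St.setV_a, hτ]

/-! ### Static bounds on values and time -/

/-- The number of variables of a program. -/
def numVars : ℕ := 48

/-- The number of arrays of a program. -/
def stride : ℕ := 16

/-- The measure of an expression `e` that bounds its values by `M ^ e.size` on states with numbers up to
`M ≥ 2`, and also bounds the number of registers needed to evaluate it. -/
def Exp.size : Exp → ℕ
  | const n => n + 1
  | var _ => 1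
  | get _ e => e.size + 2
  | bin _ e₁ e₂ => e₁.size + e₂.size + 4
  | any _ _ e => e.size + 5

/-- A bound on the number of registers that a command needs, and on the sizes of its expressions. -/
def Cmd.size : Cmd → ℕ
  | skip => 0
  | set _ e => e.size
  | put _ e₁ e₂ => e₁.size + e₂.size + 3
  | seq c₁ c₂ => c₁.size + c₂.size
  | ite e c₁ c₂ => e.size + c₁.size + c₂.size
  | .loop _ _ c => c.size + 3

/-- All numbers in a state are at most `M`. -/
structure Small (M : ℕ) (σ : St) : Prop where
  v : ∀ x, σ.v x ≤ M
  a : ∀ b i, σ.a b i ≤ M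

theorem Small.setV {M : ℕ} {σ : St} (h : Small M σ) {x n : ℕ} (hn : n ≤ M) : Small M (σ.setV x n) :=
  ⟨fun y => by rw [St.setV_v]; split_ifs; exacts [hn, h.v y], h.a⟩

theorem Small.setA {M : ℕ} {σ : St} (h : Small M σ) {b i n : ℕ} (hn : n ≤ M) :
    Small M (σ.setA b i n) := by
  refine ⟨h.v, fun c j => ?_⟩
  by_cases hc : c = b
  · subst hc
    rw [St.setA_self, Function.update_apply]
    split_ifs
    exacts [hn, h.a c j]
  · rw [St.setA_of_ne _ _ _ hc]; exact h.a c j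

theorem Exp.eval_le {M : ℕ} (hM : 2 ≤ M) (e : Exp) {σ : St} (h : Small M σ) :
    e.eval σ ≤ M ^ e.size := by
  have hone : ∀ n, 1 ≤ M ^ n := fun n => Nat.one_le_pow _ _ (by omega)
  have hself : ∀ n, n ≠ 0 → M ≤ M ^ n := fun n hn => Nat.le_self_pow hn M
  have hmono : ∀ {m n}, m ≤ n → M ^ m ≤ M ^ n := fun h => Nat.pow_le_pow_right (by omega) h
  induction e generalizing σ with
  | const n =>
    calc n ≤ 2 ^ n := Nat.lt_two_pow_self.le
      _ ≤ M ^ n := Nat.pow_le_pow_left hM n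
      _ ≤ M ^ (n + 1) := hmono (Nat.le_succ n)
  | var x => simpa [Exp.eval, Exp.size] using h.v x
  | get a e ih => exact (h.a _ _).trans (hself _ (by simp [Exp.size]))
  | bin o e₁ e₂ ih₁ ih₂ =>
    have h1 := ih₁ h
    have h2 := ih₂ h
    have hs1 : M ^ e₁.size ≤ M ^ (Exp.bin o e₁ e₂).size := hmono (by simp only [Exp.size]; omega)
    cases o with
    | add =>
      calc e₁.eval σ + e₂.eval σ ≤ M ^ (e₁.size + e₂.size) + M ^ (e₁.size + e₂.size) :=
            add_le_add (h1.trans (hmono (by omega))) (h2.trans (hmono (by omega)))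
        _ = 2 * M ^ (e₁.size + e₂.size) := by ring
        _ ≤ M * M ^ (e₁.size + e₂.size) := Nat.mul_le_mul_right _ hM
        _ = M ^ (e₁.size + e₂.size + 1) := by ring
        _ ≤ _ := hmono (by simp only [Exp.size]; omega)
    | sub => exact (Nat.sub_le _ _).trans (h1.trans hs1)
    | mul =>
      calc e₁.eval σ * e₂.eval σ ≤ M ^ e₁.size * M ^ e₂.size := Nat.mul_le_mul h1 h2
        _ = M ^ (e₁.size + e₂.size) := by ring
        _ ≤ _ := hmono (by simp only [Exp.size]; omega)
    | min => exact (min_le_left _ _).trans (h1.trans hs1)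
    | eq =>
      simp only [Exp.eval, Op.eval]
      split_ifs
      exacts [hone _, Nat.zero_le _]
  | any x y e ih =>
    simp only [Exp.eval]
    split_ifs
    exacts [hone _, Nat.zero_le _]

/-- A syntactic criterion for an expression to have a value below any bound `M ≥ 2` on the state. -/
def Exp.small : Exp → Bool
  | const n => n ≤ 2
  | var _ => true
  | get _ _ => true
  | bin Op.sub e₁ _ => e₁.small
  | bin Op.min _ e₂ => e₂.small
  | bin Op.eq _ _ => true
  | bin _ _ _ => false
  | any _ _ _ => true

theorem Exp.eval_le_of_small {M : ℕ} (hM : 2 ≤ M) {e : Exp} (he : e.small) {σ : St}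
    (h : Small M σ) : e.eval σ ≤ M := by
  induction e with
  | const n => simp only [Exp.small, decide_eq_true_eq] at he; simp only [Exp.eval]; omega
  | var x => exact h.v x
  | get a e => exact h.a _ _
  | bin o e₁ e₂ ih₁ ih₂ =>
    cases o with
    | add => simp [Exp.small] at he
    | mul => simp [Exp.small] at he
    | sub => exact (Nat.sub_le _ _).trans (ih₁ he)
    | min => exact (min_le_right _ _).trans (ih₂ he)
    | eq => simp only [Exp.eval, Op.eval]; split_ifs <;> omega
  | any x y e => simp only [Exp.eval]; split_ifs <;> omega

/-- Well-formedness: variables and arrays are in range; variables below `nb` bound the loops, and are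
never changed. -/
def Exp.ok (nb : ℕ) : Exp → Bool
  | const _ => true
  | var x => x < numVars
  | get a e => a < stride && e.ok nb
  | bin _ e₁ e₂ => e₁.ok nb && e₂.ok nb
  | any x y e => nb ≤ x && x < numVars && y < nb && e.ok nb

/-- Well-formedness of a command, which also ensures that all assigned values are small. -/
def Cmd.ok (nb : ℕ) : Cmd → Bool
  | skip => true
  | set x e => nb ≤ x && x < numVars && e.ok nb && e.small
  | put a e₁ e₂ => a < stride && e₁.ok nb && e₂.ok nb && e₂.small
  | seq c₁ c₂ => c₁.ok nb && c₂.ok nb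
  | ite e c₁ c₂ => e.ok nb && c₁.ok nb && c₂.ok nb
  | .loop x y c => nb ≤ x && x < numVars && y < nb && c.ok nb

/-- A bound on the time for evaluating an expression, given the values of the loop bounds. -/
def Exp.cost (ρ : ℕ → ℕ) : Exp → ℕ
  | const _ => 1
  | var _ => 2
  | get _ e => e.cost ρ + 6
  | bin _ e₁ e₂ => e₁.cost ρ + e₂.cost ρ + 5
  | any _ y e => ρ y * (e.cost ρ + 7) + 9

/-- A bound on the time for executing a command, given the values of the loop bounds, which no command
may change. -/
def Cmd.cost (ρ : ℕ → ℕ) : Cmd → ℕ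
  | skip => 0
  | set _ e => e.cost ρ + 2
  | put _ e₁ e₂ => e₁.cost ρ + e₂.cost ρ + 6
  | seq c₁ c₂ => c₁.cost ρ + c₂.cost ρ
  | ite e c₁ c₂ => e.cost ρ + c₁.cost ρ + c₂.cost ρ + 2
  | .loop _ y c => ρ y * (c.cost ρ + 6) + 5

/-! ### Translation into machine code -/

open RAM

/-- The address of a variable. Cell `0` holds the base address of the arrays. -/
def varR (x : ℕ) : ℕ := x + 1

/-- The address of a register for intermediate results. -/
def tmpR (s : ℕ) : ℕ := numVars + 1 + s

/-- Combines the registers `s` and `s + 1`. -/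
def Op.code (s : ℕ) : Op → List Instr
  | add => [Instr.add (tmpR s) (tmpR s) (tmpR (s + 1))]
  | sub => [Instr.sub (tmpR s) (tmpR s) (tmpR (s + 1))]
  | mul => [Instr.mul (tmpR s) (tmpR s) (tmpR (s + 1))]
  | min => [Instr.sub (tmpR (s + 2)) (tmpR s) (tmpR (s + 1)), Instr.sub (tmpR s) (tmpR s) (tmpR (s + 2))]
  | eq => [Instr.sub (tmpR (s + 2)) (tmpR s) (tmpR (s + 1)),
      Instr.sub (tmpR (s + 1)) (tmpR (s + 1)) (tmpR s),
      Instr.add (tmpR (s + 2)) (tmpR (s + 2)) (tmpR (s + 1)),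
      Instr.const (tmpR s) 1, Instr.sub (tmpR s) (tmpR s) (tmpR (s + 2))]

/-- Turns an index in register `s` into the address in the array `a`, using register `t`. The arrays
are interleaved: entry `i` of array `a` has the address `B + stride * i + a`. -/
def addrCode (s t a : ℕ) : List Instr :=
  [Instr.const (tmpR t) stride, Instr.mul (tmpR s) (tmpR s) (tmpR t), Instr.add (tmpR s) (tmpR s) 0,
    Instr.const (tmpR t) a, Instr.add (tmpR s) (tmpR s) (tmpR t)]

/-- The code of an expression, to be placed at position `l`; it leaves the value in register `s`, and
uses no lower register. A loop variable gets its old value back. -/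
def Exp.code : Exp → (s l : ℕ) → List Instr
  | const n, s, _ => [Instr.const (tmpR s) n]
  | var x, s, _ => [Instr.const (tmpR s) 0, Instr.add (tmpR s) (tmpR s) (varR x)]
  | get a e, s, l => e.code s l ++ (addrCode s (s + 1) a ++ [Instr.load (tmpR s) (tmpR s)])
  | bin o e₁ e₂, s, l =>
      e₁.code s l ++ (e₂.code (s + 1) (l + (e₁.code s l).length) ++ o.code s)
  | any x y e, s, l =>
      [Instr.const (tmpR (s + 1)) 0, Instr.add (tmpR (s + 1)) (tmpR (s + 1)) (varR x),
        Instr.const (tmpR s) 0, Instr.const (tmpR (s + 2)) 0,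
        Instr.add (tmpR (s + 2)) (tmpR (s + 2)) (varR y), Instr.const (tmpR (s + 3)) 1] ++
      ([Instr.jumpZero (tmpR (s + 2)) (l + 13 + (e.code (s + 4) (l + 10)).length)] ++
      ([Instr.sub (tmpR (s + 2)) (tmpR (s + 2)) (tmpR (s + 3)), Instr.const (varR x) 0,
        Instr.add (varR x) (varR x) (tmpR (s + 2))] ++
      (e.code (s + 4) (l + 10) ++
      ([Instr.jumpZero (tmpR (s + 4)) (l + 6)] ++ ([Instr.const (tmpR s) 1] ++ ([Instr.jump (l + 6)] ++
      [Instr.const (varR x) 0, Instr.add (varR x) (varR x) (tmpR (s + 1))]))))))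

/-- The code of a command, to be placed at position `l`; it uses no register below `s`. -/
def Cmd.code : Cmd → (s l : ℕ) → List Instr
  | skip, _, _ => []
  | set x e, s, l => e.code s l ++ [Instr.const (varR x) 0, Instr.add (varR x) (varR x) (tmpR s)]
  | put a e₁ e₂, s, l =>
      e₁.code s l ++ (e₂.code (s + 1) (l + (e₁.code s l).length) ++
        (addrCode s (s + 2) a ++ [Instr.store (tmpR s) (tmpR (s + 1))]))
  | seq c₁ c₂, s, l => c₁.code s l ++ c₂.code s (l + (c₁.code s l).length)
  | ite e c₁ c₂, s, l =>
      let l₁ := l + (e.code s l).length + 1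
      let l₂ := l₁ + (c₁.code s l₁).length + 1
      e.code s l ++ ([Instr.jumpZero (tmpR s) l₂] ++ (c₁.code s l₁ ++
        ([Instr.jump (l₂ + (c₂.code s l₂).length)] ++ c₂.code s l₂)))
  | .loop x y c, s, l =>
      [Instr.const (tmpR s) 0, Instr.const (tmpR (s + 1)) 0,
        Instr.add (tmpR (s + 1)) (tmpR (s + 1)) (varR y), Instr.const (tmpR (s + 2)) 1] ++
      ([Instr.jumpZero (tmpR (s + 1)) (l + 10 + (c.code (s + 3) (l + 9)).length)] ++
      ([Instr.sub (tmpR (s + 1)) (tmpR (s + 1)) (tmpR (s + 2)), Instr.const (varR x) 0,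
        Instr.add (varR x) (varR x) (tmpR s), Instr.add (tmpR s) (tmpR s) (tmpR (s + 2))] ++
      (c.code (s + 3) (l + 9) ++ [Instr.jump (l + 4)])))

/-- The program `p` contains the code `w` at position `l`. -/
def CodeAt (p : Prog) (l : ℕ) (w : List Instr) : Prop := ∀ i < w.length, p[l + i]? = w[i]?

theorem codeAt_append {p : Prog} {l : ℕ} {w d : List Instr} :
    CodeAt p l (w ++ d) ↔ CodeAt p l w ∧ CodeAt p (l + w.length) d := by
  constructor
  · intro h
    refine ⟨fun i hi => ?_, fun i hi => ?_⟩
    · rw [h i (by rw [List.length_append]; omega), List.getElem?_append_left hi]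
    · rw [add_assoc, h _ (by rw [List.length_append]; omega),
        List.getElem?_append_right (Nat.le_add_right _ _), Nat.add_sub_cancel_left]
  · rintro ⟨h1, h2⟩ i hi
    rw [List.length_append] at hi
    by_cases hc : i < w.length
    · rw [h1 i hc, List.getElem?_append_left hc]
    · rw [List.getElem?_append_right (by omega), ← h2 (i - w.length) (by omega)]
      congr 1; omega

theorem codeAt_cons {p : Prog} {l : ℕ} {i : Instr} {w : List Instr} :
    CodeAt p l (i :: w) ↔ p[l]? = some i ∧ CodeAt p (l + 1) w := by
  rw [← List.singleton_append, codeAt_append]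
  simp [CodeAt]

/-- `n` steps lead from `st` to `st'`, and all numbers on the way are at most `V`. -/
def Runs (p : Prog) (V : ℕ) (st : State) (n : ℕ) (st' : State) : Prop :=
  (step p)^[n] st = st' ∧ ∀ m ≤ n, ∀ i, ((step p)^[m] st).mem i ≤ V

theorem Runs.refl {p : Prog} {V : ℕ} {st : State} (h : ∀ i, st.mem i ≤ V) : Runs p V st 0 st :=
  ⟨rfl, fun m hm i => by obtain rfl : m = 0 := by omega
                         exact h i⟩

theorem Runs.trans {p : Prog} {V m n : ℕ} {s₁ s₂ s₃ : State} (h₁ : Runs p V s₁ m s₂)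
    (h₂ : Runs p V s₂ n s₃) : Runs p V s₁ (m + n) s₃ := by
  refine ⟨by rw [add_comm, Function.iterate_add_apply, h₁.1, h₂.1], fun k hk i => ?_⟩
  by_cases hkm : k ≤ m
  · exact h₁.2 k hkm i
  · obtain ⟨j, rfl⟩ := Nat.exists_eq_add_of_le (not_le.1 hkm).le
    rw [add_comm, Function.iterate_add_apply, h₁.1]
    exact h₂.2 j (by omega) i

theorem Runs.le {p : Prog} {V n : ℕ} {s₁ s₂ : State} (h : Runs p V s₁ n s₂) (i : ℕ) : s₂.mem i ≤ V := by
  have := h.2 n le_rfl i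
  rwa [h.1] at this

/-- The cell that an instruction changes and its new value; `none` for jumps and halts. -/
def act (mem : ℕ → ℕ) : Instr → Option (ℕ × ℕ)
  | Instr.const i n => some (i, n)
  | Instr.add i j k => some (i, mem j + mem k)
  | Instr.sub i j k => some (i, mem j - mem k)
  | Instr.mul i j k => some (i, mem j * mem k)
  | Instr.load i j => some (i, mem (mem j))
  | Instr.store i j => some (mem i, mem j)
  | _ => none

/-- The effect of code without jumps, with a bound on the assigned values. -/
def Straight (V : ℕ) : List Instr → (ℕ → ℕ) → (ℕ → ℕ) → Prop
  | [], mem, mem' => mem' = mem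
  | i :: c, mem, mem' => ∃ b, act mem i = some b ∧ b.2 ≤ V ∧
      Straight V c (Function.update mem b.1 b.2) mem'

theorem update_le {V : ℕ} {mem : ℕ → ℕ} (h : ∀ i, mem i ≤ V) {a n : ℕ} (hn : n ≤ V) (i : ℕ) :
    Function.update mem a n i ≤ V := by
  rw [Function.update_apply]
  split_ifs
  exacts [hn, h i]

theorem Straight.runs {p : Prog} {V l : ℕ} {c : List Instr} {mem mem' : ℕ → ℕ}
    (h : Straight V c mem mem') (hc : CodeAt p l c) (hV : ∀ i, mem i ≤ V) :
    Runs p V ⟨l, mem⟩ c.length ⟨l + c.length, mem'⟩ := by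
  induction c generalizing l mem with
  | nil =>
    obtain rfl : mem' = mem := h
    exact Runs.refl hV
  | cons i c ih =>
    obtain ⟨⟨a, n⟩, ha, hn, h⟩ := h
    rw [codeAt_cons] at hc
    have hs : step p ⟨l, mem⟩ = ⟨l + 1, Function.update mem a n⟩ := by
      cases i <;> simp only [act, Option.some.injEq, Prod.mk.injEq, reduceCtorEq] at ha <;>
        obtain ⟨rfl, rfl⟩ := ha <;> simp [step, hc.1]
    have hV' := fun i => update_le (a := a) hV hn i
    have h1 : Runs p V ⟨l, mem⟩ 1 ⟨l + 1, Function.update mem a n⟩ := by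
      refine ⟨hs, fun m hm i => ?_⟩
      rcases Nat.le_one_iff_eq_zero_or_eq_one.1 hm with rfl | rfl
      · exact hV i
      · rw [Function.iterate_one, hs]; exact hV' i
    have h2 := h1.trans (ih h hc.2 hV')
    rw [List.length_cons, add_comm c.length, ← add_assoc]
    exact h2

theorem runs_jumpZero {p : Prog} {V l i l' : ℕ} {mem : ℕ → ℕ} (hc : CodeAt p l [Instr.jumpZero i l'])
    (hV : ∀ i, mem i ≤ V) : Runs p V ⟨l, mem⟩ 1 ⟨if mem i = 0 then l' else l + 1, mem⟩ := by
  have hs : step p ⟨l, mem⟩ = ⟨if mem i = 0 then l' else l + 1, mem⟩ := by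
    simp [step, (codeAt_cons.1 hc).1]
  refine ⟨hs, fun m hm i => ?_⟩
  rcases Nat.le_one_iff_eq_zero_or_eq_one.1 hm with rfl | rfl
  · exact hV i
  · rw [Function.iterate_one, hs]; exact hV i

theorem runs_jump {p : Prog} {V l l' : ℕ} {mem : ℕ → ℕ} (hc : CodeAt p l [Instr.jump l'])
    (hV : ∀ i, mem i ≤ V) : Runs p V ⟨l, mem⟩ 1 ⟨l', mem⟩ := by
  have hs : step p ⟨l, mem⟩ = ⟨l', mem⟩ := by simp [step, (codeAt_cons.1 hc).1]
  refine ⟨hs, fun m hm i => ?_⟩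
  rcases Nat.le_one_iff_eq_zero_or_eq_one.1 hm with rfl | rfl
  · exact hV i
  · rw [Function.iterate_one, hs]; exact hV i

/-- The memory `mem` represents the state `σ`, with arrays based at `B`. -/
structure Rep (B : ℕ) (σ : St) (mem : ℕ → ℕ) : Prop where
  base : mem 0 = B
  v : ∀ x < numVars, mem (varR x) = σ.v x
  a : ∀ b < stride, ∀ i, mem (B + stride * i + b) = σ.a b i

theorem Rep.tmp {B : ℕ} {σ : St} {mem : ℕ → ℕ} (h : Rep B σ mem) {s : ℕ} (hs : tmpR s < B) (n : ℕ) :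
    Rep B σ (Function.update mem (tmpR s) n) := by
  refine ⟨?_, fun x hx => ?_, fun b hb i => ?_⟩
  · rw [Function.update_of_ne (by simp only [tmpR]; omega), h.base]
  · rw [Function.update_of_ne (by simp only [tmpR, varR]; omega), h.v x hx]
  · rw [Function.update_of_ne (by omega), h.a b hb]

theorem Rep.var {B : ℕ} {σ : St} {mem : ℕ → ℕ} (h : Rep B σ mem) (hB : numVars < B) {x : ℕ}
    (hx : x < numVars) (n : ℕ) : Rep B (σ.setV x n) (Function.update mem (varR x) n) := by
  refine ⟨?_, fun y hy => ?_, fun b hb i => ?_⟩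
  · rw [Function.update_of_ne (by simp only [varR]; omega), h.base]
  · rw [Function.update_apply, St.setV_v]
    simp only [varR, Nat.add_right_cancel_iff]
    rw [← h.v y hy, varR]
  · rw [Function.update_of_ne (by simp only [varR]; omega), h.a b hb]; rfl

theorem Rep.arr {B : ℕ} {σ : St} {mem : ℕ → ℕ} (h : Rep B σ mem) (hB : numVars < B) {b : ℕ}
    (hb : b < stride) (i n : ℕ) :
    Rep B (σ.setA b i n) (Function.update mem (B + stride * i + b) n) := by
  refine ⟨?_, fun y hy => ?_, fun c hc j => ?_⟩
  · rw [Function.update_of_ne (by omega), h.base]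
  · rw [Function.update_of_ne (by simp only [varR]; omega), h.v y hy]; rfl
  · by_cases hcb : c = b
    · subst hcb
      rw [St.setA_self, Function.update_apply, Function.update_apply, h.a c hc]
      have : B + stride * j + c = B + stride * i + c ↔ j = i := by
        simp only [stride]; omega
      simp only [this]
    · rw [St.setA_of_ne _ _ _ hcb, Function.update_of_ne, h.a c hc]
      simp only [stride] at hb hc ⊢
      omega

/-- The parameters of a run: the program, the bound `V` on all numbers, the base address `B` of the
arrays, the bound `M` on the numbers of the represented states, the number `T` of registers, and the
values `ρ` of the `nb` loop bounds. -/
structure Machine where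
  p : Prog
  V : ℕ
  B : ℕ
  M : ℕ
  T : ℕ
  nb : ℕ
  ρ : ℕ → ℕ
  two_le : 2 ≤ M
  le_base : numVars + 1 + T ≤ B
  le_bound : B + stride * M ^ T + stride ≤ V

namespace Machine

variable (K : Machine)

/-- The memory represents the state, whose numbers are small and whose loop bounds are as expected. -/
structure At (σ : St) (mem : ℕ → ℕ) : Prop where
  rep : Rep K.B σ mem
  small : Small K.M σ
  bnd : ∀ y < K.nb, σ.v y = K.ρ y
  le : ∀ i, mem i ≤ K.V

variable {K}

theorem le_V {n s : ℕ} (h : n ≤ K.M ^ s) (hs : s ≤ K.T) : n ≤ K.V := by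
  have h1 : K.M ^ s ≤ K.M ^ K.T := Nat.pow_le_pow_right (by have := K.two_le; omega) hs
  have := K.le_bound
  simp only [stride] at this
  omega

theorem stride_le : stride ≤ K.V := by have := K.le_bound; omega

theorem one_le : 1 ≤ K.V := by have := K.stride_le; simp only [stride] at this; omega

theorem tmpR_lt {s : ℕ} (h : s < K.T) : tmpR s < K.B := by
  have := K.le_base; simp only [tmpR]; omega

theorem numVars_lt : numVars < K.B := by have := K.le_base; omega

theorem At.tmp {σ : St} {mem : ℕ → ℕ} (h : K.At σ mem) {s n : ℕ} (hs : s < K.T) (hn : n ≤ K.V) :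
    K.At σ (Function.update mem (tmpR s) n) :=
  ⟨h.rep.tmp (tmpR_lt hs) n, h.small, h.bnd, update_le h.le hn⟩

theorem At.var {σ : St} {mem : ℕ → ℕ} (h : K.At σ mem) {x n : ℕ} (hx : x < numVars) (hx' : K.nb ≤ x)
    (hn : n ≤ K.M) (hT : 1 ≤ K.T) : K.At (σ.setV x n) (Function.update mem (varR x) n) :=
  ⟨h.rep.var numVars_lt hx n, h.small.setV hn,
    fun y hy => by rw [St.setV_of_ne _ _ (by omega), h.bnd y hy],
    update_le h.le (le_V (s := 1) (by simpa using hn) hT)⟩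

end Machine
end Loop

/-! ### Correctness of the machine code -/

namespace Loop
open RAM

@[simp] theorem tmpR_inj {s t : ℕ} : tmpR s = tmpR t ↔ s = t := by simp [tmpR]

theorem tmpR_ne_zero (s : ℕ) : tmpR s ≠ 0 := by simp [tmpR, numVars]

theorem varR_ne_tmpR {x s : ℕ} (hx : x < numVars) : varR x ≠ tmpR s := by
  simp only [varR, tmpR]; omega

theorem runs_const {p : Prog} {V l i n : ℕ} {mem : ℕ → ℕ} (hc : CodeAt p l [Instr.const i n])
    (hV : ∀ i, mem i ≤ V) (hn : n ≤ V) :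
    Runs p V ⟨l, mem⟩ 1 ⟨l + 1, Function.update mem i n⟩ :=
  Straight.runs (c := [Instr.const i n]) ⟨_, rfl, hn, rfl⟩ hc hV

theorem runs_move {p : Prog} {V l i j : ℕ} {mem : ℕ → ℕ}
    (hc : CodeAt p l [Instr.const i 0, Instr.add i i j]) (hV : ∀ i, mem i ≤ V) (hij : j ≠ i) :
    Runs p V ⟨l, mem⟩ 2 ⟨l + 2, Function.update mem i (mem j)⟩ := by
  refine Straight.runs (c := [Instr.const i 0, Instr.add i i j]) ⟨_, rfl, Nat.zero_le _, _, rfl, ?_, ?_⟩ hc hV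
  · simpa [hij] using hV j
  · simp [Straight, hij]

theorem runs_sub {p : Prog} {V l i j k : ℕ} {mem : ℕ → ℕ}
    (hc : CodeAt p l [Instr.sub i j k]) (hV : ∀ i, mem i ≤ V) :
    Runs p V ⟨l, mem⟩ 1 ⟨l + 1, Function.update mem i (mem j - mem k)⟩ :=
  Straight.runs (c := [Instr.sub i j k]) ⟨_, rfl, (Nat.sub_le _ _).trans (hV j), rfl⟩ hc hV

theorem runs_add {p : Prog} {V l i j k : ℕ} {mem : ℕ → ℕ}
    (hc : CodeAt p l [Instr.add i j k]) (hV : ∀ i, mem i ≤ V) (h : mem j + mem k ≤ V) :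
    Runs p V ⟨l, mem⟩ 1 ⟨l + 1, Function.update mem i (mem j + mem k)⟩ :=
  Straight.runs (c := [Instr.add i j k]) ⟨_, rfl, h, rfl⟩ hc hV

namespace Machine

variable {K : Machine}

/-- The address of an entry whose index is at most `M ^ m` is computed without exceeding the bound `V`. -/
theorem runs_addr {s t a l ix m : ℕ} {σ : St} {mem : ℕ → ℕ} (hc : CodeAt K.p l (addrCode s t a))
    (h : K.At σ mem) (hst : s ≠ t) (hs : s < K.T) (ht : t < K.T) (ha : a < stride)
    (hix : mem (tmpR s) = ix) (hm : ix ≤ K.M ^ m) (hmT : m ≤ K.T) :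
    ∃ mem', Runs K.p K.V ⟨l, mem⟩ 5 ⟨l + 5, mem'⟩ ∧ K.At σ mem' ∧
      mem' (tmpR s) = K.B + stride * ix + a ∧ ∀ z, z ≠ s → z ≠ t → mem' (tmpR z) = mem (tmpR z) := by
  have hM : K.M ^ m ≤ K.M ^ K.T := Nat.pow_le_pow_right (by have := K.two_le; omega) hmT
  have hb : K.B + stride * ix + a ≤ K.V := by
    have := K.le_bound
    have : stride * ix ≤ stride * K.M ^ K.T := Nat.mul_le_mul_left _ (hm.trans hM)
    omega
  have h0 : mem 0 = K.B := h.rep.base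
  have hts : tmpR s ≠ tmpR t := by simpa using hst
  have z1 := tmpR_ne_zero s
  have z2 := tmpR_ne_zero t
  refine ⟨_, Straight.runs (c := addrCode s t a) ⟨_, rfl, K.stride_le, _, rfl, ?_, _, rfl, ?_, _, rfl, ?_,
    _, rfl, ?_, rfl⟩ hc h.le, ?_, ?_, ?_⟩
  · simp [hts, hix, mul_comm ix]; omega
  · simp [hts, z1.symm, z2.symm, hix, h0, mul_comm ix]; omega
  · simp only; omega
  · simp [hts, z1.symm, z2.symm, hix, h0, mul_comm ix]; omega
  · refine ((((h.tmp ht ?_).tmp hs ?_).tmp hs ?_).tmp ht ?_).tmp hs ?_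
    · exact K.stride_le
    · simp [hts, hix, mul_comm ix]; omega
    · simp [hts, z1.symm, z2.symm, hix, h0, mul_comm ix]; omega
    · simp only; omega
    · simp [hts, z1.symm, z2.symm, hix, h0, mul_comm ix]; omega
  · simp [hts, z1.symm, z2.symm, hix, h0, mul_comm ix]; omega
  · intro z hzs hzt
    simp [hzs, hzt]

theorem runs_op {o : Op} {s l x y m : ℕ} {σ : St} {mem : ℕ → ℕ} (hc : CodeAt K.p l (o.code s))
    (h : K.At σ mem) (hs : s + 2 < K.T) (hx : mem (tmpR s) = x) (hy : mem (tmpR (s + 1)) = y)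
    (hm : o.eval x y ≤ K.M ^ m) (hmT : m ≤ K.T) :
    ∃ n ≤ 5, ∃ mem', Runs K.p K.V ⟨l, mem⟩ n ⟨l + (o.code s).length, mem'⟩ ∧ K.At σ mem' ∧
      mem' (tmpR s) = o.eval x y ∧ ∀ z < s, mem' (tmpR z) = mem (tmpR z) := by
  have hV : o.eval x y ≤ K.V := le_V hm hmT
  have hx' : x ≤ K.V := hx ▸ h.le _
  have hy' : y ≤ K.V := hy ▸ h.le _
  have hone := K.one_le
  cases o with
  | add =>
    simp only [Op.eval] at hV
    refine ⟨1, by omega, _, Straight.runs (c := Op.add.code s) ⟨_, rfl, ?_, rfl⟩ hc h.le, h.tmp (by omega) ?_, ?_, ?_⟩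
    · simpa [hx, hy] using hV
    · simpa [hx, hy] using hV
    · simp [hx, hy, Op.eval]
    · intro z hz; simp [hz.ne]
  | mul =>
    simp only [Op.eval] at hV
    refine ⟨1, by omega, _, Straight.runs (c := Op.mul.code s) ⟨_, rfl, ?_, rfl⟩ hc h.le, h.tmp (by omega) ?_, ?_, ?_⟩
    · simpa [hx, hy] using hV
    · simpa [hx, hy] using hV
    · simp [hx, hy, Op.eval]
    · intro z hz; simp [hz.ne]
  | sub =>
    simp only [Op.eval] at hV
    refine ⟨1, by omega, _, Straight.runs (c := Op.sub.code s) ⟨_, rfl, ?_, rfl⟩ hc h.le, h.tmp (by omega) ?_, ?_, ?_⟩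
    · simp only [hx, hy]; omega
    · simp only [hx, hy]; omega
    · simp [hx, hy, Op.eval]
    · intro z hz; simp [hz.ne]
  | min =>
    refine ⟨2, by omega, _, Straight.runs (c := Op.min.code s) ⟨_, rfl, ?_, _, rfl, ?_, rfl⟩ hc h.le,
      (h.tmp (by omega) ?_).tmp (by omega) ?_, ?_, ?_⟩
    · simp only [hx, hy]; omega
    · simp [hx, hy]; omega
    · simp only [hx, hy]; omega
    · simp [hx, hy]; omega
    · simp [hx, hy, Op.eval]; omega
    · intro z hz; simp [hz.ne, (show z ≠ s + 2 by omega)]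
  | eq =>
    have e1 : x - y + (y - x) ≤ K.V := by omega
    refine ⟨5, le_rfl, _, Straight.runs (c := Op.eq.code s) ⟨_, rfl, ?_, _, rfl, ?_, _, rfl, ?_, _, rfl, ?_,
      _, rfl, ?_, rfl⟩ hc h.le, ((((h.tmp (s := s + 2) (by omega) ?_).tmp (s := s + 1) (by omega) ?_).tmp
        (s := s + 2) (by omega) ?_).tmp (s := s) (by omega) ?_).tmp (s := s) (by omega) ?_, ?_, ?_⟩
    · simp only [hx, hy]; omega
    · simp [hx, hy]; omega
    · simp [hx, hy]; omega
    · exact hone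
    · simp [hx, hy]; omega
    · simp only [hx, hy]; omega
    · simp [hx, hy]; omega
    · simp [hx, hy]; omega
    · exact hone
    · simp [hx, hy]; omega
    · simp [hx, hy, Op.eval]
      split_ifs <;> omega
    · intro z hz
      simp [hz.ne, (show z ≠ s + 2 by omega), (show z ≠ s + 1 by omega)]

theorem exp_size_pos (e : Exp) : 1 ≤ e.size := by cases e <;> simp only [Exp.size] <;> omega

set_option maxHeartbeats 1000000 in
/-- The code of an expression evaluates it within the static time bound. -/
theorem exp_runs (e : Exp) {s l : ℕ} {σ : St} {mem : ℕ → ℕ} (hc : CodeAt K.p l (e.code s l))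
    (h : K.At σ mem) (hok : e.ok K.nb) (hT : s + e.size ≤ K.T) :
    ∃ n ≤ e.cost K.ρ, ∃ mem', Runs K.p K.V ⟨l, mem⟩ n ⟨l + (e.code s l).length, mem'⟩ ∧ K.At σ mem' ∧
      mem' (tmpR s) = e.eval σ ∧ ∀ z < s, mem' (tmpR z) = mem (tmpR z) := by
  induction e generalizing s l σ mem with
  | const n =>
    simp only [Exp.size] at hT
    have hn : n ≤ K.V := le_V (s := n + 1)
      ((Exp.eval_le K.two_le (Exp.const n) h.small).trans (by simp [Exp.size])) (by omega)
    exact ⟨1, le_rfl, _, runs_const hc h.le hn, h.tmp (by omega) hn, by simp [Exp.eval],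
      fun z hz => by simp [hz.ne]⟩
  | var x =>
    simp only [Exp.size] at hT
    simp only [Exp.ok, decide_eq_true_eq] at hok
    refine ⟨2, le_rfl, _, runs_move hc h.le (varR_ne_tmpR hok), h.tmp (by omega) (h.le _), ?_, ?_⟩
    · simp [Exp.eval, h.rep.v x hok]
    · intro z hz; simp [hz.ne]
  | get a e ih =>
    simp only [Exp.size] at hT
    have hp := exp_size_pos e
    simp only [Exp.ok, Bool.and_eq_true, decide_eq_true_eq] at hok
    simp only [Exp.code, codeAt_append] at hc
    obtain ⟨hc1, hc2, hc3⟩ := hc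
    obtain ⟨n, hn, mem1, r1, h1, e1, k1⟩ := ih hc1 h hok.2 (by omega)
    obtain ⟨mem2, r2, h2, e2, k2⟩ := runs_addr hc2 h1 (by omega) (by omega) (by omega) hok.1 e1 (m := e.size)
      (Exp.eval_le K.two_le e h.small) (by omega)
    have e3 : mem2 (mem2 (tmpR s)) = σ.a a (e.eval σ) := by rw [e2, h2.rep.a a hok.1]
    have r3 : Runs K.p K.V _ _ _ := Straight.runs (c := [Instr.load (tmpR s) (tmpR s)])
      ⟨_, rfl, h2.le _, rfl⟩ hc3 h2.le
    refine ⟨n + 5 + 1, by simp only [Exp.cost]; omega, _, ?_, h2.tmp (s := s) (by omega) (h2.le (mem2 (tmpR s))), ?_, ?_⟩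
    · have := (r1.trans r2).trans r3
      simpa [Exp.code, addrCode, add_assoc] using this
    · simp [Exp.eval, e3]
    · intro z hz
      rw [Function.update_of_ne (by simp [hz.ne]), k2 z (by omega) (by omega), k1 z hz]
  | bin o e₁ e₂ ih₁ ih₂ =>
    have hm := Exp.eval_le K.two_le (Exp.bin o e₁ e₂) h.small
    simp only [Exp.size] at hT hm
    have hp := exp_size_pos e₁
    have hp' := exp_size_pos e₂
    simp only [Exp.ok, Bool.and_eq_true] at hok
    simp only [Exp.code, codeAt_append] at hc
    obtain ⟨hc1, hc2, hc3⟩ := hc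
    obtain ⟨n, hn, mem1, r1, h1, e1, k1⟩ := ih₁ hc1 h hok.1 (by omega)
    obtain ⟨n', hn', mem2, r2, h2, e2, k2⟩ := ih₂ hc2 h1 hok.2 (by omega)
    obtain ⟨n3, hn3, mem3, r3, h3, e3, k3⟩ := runs_op hc3 h2 (by omega)
      ((k2 s (by omega)).trans e1) e2 hm (by omega)
    refine ⟨n + n' + n3, by simp only [Exp.cost]; omega, mem3, ?_, h3, e3, ?_⟩
    · have := (r1.trans r2).trans r3
      simpa [Exp.code, add_assoc] using this
    · intro z hz
      rw [k3 z hz, k2 z (by omega), k1 z hz]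
  | any x y e ih =>
    simp only [Exp.size] at hT
    have hp := exp_size_pos e
    simp only [Exp.ok, Bool.and_eq_true, decide_eq_true_eq] at hok
    obtain ⟨⟨⟨hbx, hx⟩, hby⟩, hoke⟩ := hok
    have hy : y < numVars := by omega
    rw [Exp.code] at hc ⊢
    set len := (e.code (s + 4) (l + 10)).length with hlen
    simp only [codeAt_append, List.length_cons, List.length_nil, zero_add, Nat.reduceAdd] at hc
    obtain ⟨hc0, hc1, hc2, hc3, hc4, hc5, hc6, hc7⟩ := hc
    have hN : σ.v y = K.ρ y := h.bnd y hby
    -- the prologue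
    obtain ⟨mem0, r0, h0, q0, q1, q2, q3, k0⟩ : ∃ mem0, Runs K.p K.V ⟨l, mem⟩ 6 ⟨l + 6, mem0⟩ ∧
        K.At σ mem0 ∧ mem0 (tmpR s) = 0 ∧ mem0 (tmpR (s + 1)) = σ.v x ∧
        mem0 (tmpR (s + 2)) = σ.v y ∧ mem0 (tmpR (s + 3)) = 1 ∧
        ∀ z < s, mem0 (tmpR z) = mem (tmpR z) := by
      have c0 := hc0
      rw [show ∀ a b c d e f : Instr, [a, b, c, d, e, f] = [a, b] ++ ([c] ++ ([d, e] ++ [f]))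
        from fun _ _ _ _ _ _ => rfl] at c0
      simp only [codeAt_append, List.length_cons, List.length_nil, zero_add, Nat.reduceAdd] at c0
      obtain ⟨c0, c1, c2, c3⟩ := c0
      have a1 := h.tmp (s := s + 1) (by omega) (h.le (varR x))
      have r1 := runs_move c0 h.le (varR_ne_tmpR hx)
      have r2 := runs_const c1 a1.le (Nat.zero_le _)
      have a2 := a1.tmp (s := s) (by omega) (Nat.zero_le _)
      have r3 := runs_move c2 a2.le (varR_ne_tmpR hy)
      have a3 := a2.tmp (s := s + 2) (by omega) (a2.le (varR y))
      have r4 := runs_const c3 a3.le K.one_le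
      have a4 := a3.tmp (s := s + 3) (by omega) K.one_le
      refine ⟨_, ((r1.trans r2).trans r3).trans r4, a4, ?_, ?_, ?_, ?_, ?_⟩
      · simp
      · simp [h.rep.v x hx]
      · simp [varR_ne_tmpR hy, h.rep.v y hy]
      · simp
      · intro z hz
        simp [hz.ne, (show z ≠ s + 1 by omega), (show z ≠ s + 2 by omega), (show z ≠ s + 3 by omega)]
    -- the loop, with `k` rounds to go
    have loop : ∀ k mem0, k ≤ σ.v y → ∀ x₀ ≤ K.M, K.At (σ.setV x x₀) mem0 →
        mem0 (tmpR (s + 1)) = σ.v x → mem0 (tmpR (s + 2)) = k → mem0 (tmpR (s + 3)) = 1 →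
        ∃ n ≤ k * (e.cost K.ρ + 7) + 1, ∃ mem', ∃ x₁ ≤ K.M, Runs K.p K.V ⟨l + 6, mem0⟩ n
          ⟨l + 13 + len, mem'⟩ ∧ K.At (σ.setV x x₁) mem' ∧ mem' (tmpR (s + 1)) = σ.v x ∧
          mem' (tmpR s) = (if ∃ i < k, e.eval (σ.setV x i) ≠ 0 then 1 else mem0 (tmpR s)) ∧
          ∀ z < s, mem' (tmpR z) = mem0 (tmpR z) := by
      intro k
      induction k with
      | zero =>
        intro mem0 _ x₀ hx₀ h0 q1 q2 q3
        have r := runs_jumpZero hc1 h0.le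
        rw [q2, if_pos rfl] at r
        exact ⟨1, by omega, mem0, x₀, hx₀, r, h0, q1, by simp, fun z _ => rfl⟩
      | succ k ihk =>
        intro mem0 hk x₀ hx₀ h0 q1 q2 q3
        have r1 := runs_jumpZero hc1 h0.le
        rw [q2, if_neg (Nat.succ_ne_zero k)] at r1
        have c2 := hc2
        rw [show ∀ a b c : Instr, [a, b, c] = [a] ++ [b, c] from fun _ _ _ => rfl] at c2
        simp only [codeAt_append, List.length_cons, List.length_nil, zero_add] at c2
        have hkM : k ≤ K.M := by have := h.small.v y; omega
        have hkV : k ≤ K.V := le_V (s := 1) (by simpa using hkM) (by omega)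
        have r2 := runs_sub c2.1 h0.le
        rw [q2, q3, Nat.add_sub_cancel] at r2
        have a2 := h0.tmp (s := s + 2) (by omega) hkV
        have r3 := runs_move c2.2 a2.le (varR_ne_tmpR hx).symm
        rw [Function.update_self] at r3
        have a3 := a2.var hx hbx hkM (by omega)
        rw [show (σ.setV x x₀).setV x k = σ.setV x k by simp [St.setV]] at a3
        obtain ⟨n4, hn4, mem4, r4, h4, e4, k4⟩ := ih (s := s + 4) hc3 a3 hoke (by omega)
        have keep : ∀ z < s + 4, z ≠ s + 2 → mem4 (tmpR z) = mem0 (tmpR z) := by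
          intro z hz hz'
          rw [k4 z hz, Function.update_of_ne (varR_ne_tmpR hx).symm,
            Function.update_of_ne (by simpa using hz')]
        have q2' : mem4 (tmpR (s + 2)) = k := by
          rw [k4 _ (by omega), Function.update_of_ne (varR_ne_tmpR hx).symm, Function.update_self]
        have r5 := runs_jumpZero hc4 h4.le
        rw [e4] at r5
        rw [← hlen] at r4
        by_cases he : e.eval (σ.setV x k) = 0
        · rw [if_pos he] at r5
          obtain ⟨n, hn, mem', x₁, hx₁, r, g1, g2, g3, g4⟩ := ihk mem4 (by omega) k hkM h4
            ((keep _ (by omega) (by omega)).trans q1) q2' ((keep _ (by omega) (by omega)).trans q3)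
          refine ⟨_, ?_, mem', x₁, hx₁, ((((r1.trans r2).trans r3).trans r4).trans r5).trans r, g1, g2,
            ?_, ?_⟩
          · have : (k + 1) * (e.cost K.ρ + 7) = k * (e.cost K.ρ + 7) + (e.cost K.ρ + 7) := by ring
            omega
          · rw [g3, keep s (by omega) (by omega)]
            have : (∃ i < k + 1, e.eval (σ.setV x i) ≠ 0) ↔ ∃ i < k, e.eval (σ.setV x i) ≠ 0 := by
              constructor
              · rintro ⟨i, hi, hi'⟩
                refine ⟨i, lt_of_le_of_ne (by omega) ?_, hi'⟩
                rintro rfl; exact hi' he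
              · rintro ⟨i, hi, hi'⟩; exact ⟨i, by omega, hi'⟩
            simp only [this]
          · intro z hz; rw [g4 z hz, keep z (by omega) (by omega)]
        · rw [if_neg he] at r5
          have r6 := runs_const hc5 h4.le K.one_le
          have a6 := h4.tmp (s := s) (by omega) K.one_le
          have r7 := runs_jump hc6 a6.le
          obtain ⟨n, hn, mem', x₁, hx₁, r, g1, g2, g3, g4⟩ := ihk _ (by omega) k hkM a6
            (by rw [Function.update_of_ne (by simp)]; exact (keep _ (by omega) (by omega)).trans q1)
            (by rw [Function.update_of_ne (by simp)]; exact q2')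
            (by rw [Function.update_of_ne (by simp)]; exact (keep _ (by omega) (by omega)).trans q3)
          have r5' : Runs K.p K.V ⟨l + 10 + len, mem4⟩ 1 ⟨l + 11 + len, mem4⟩ := by
            convert r5 using 2 ; omega
          have r6' : Runs K.p K.V ⟨l + 11 + len, mem4⟩ 1
              ⟨l + 12 + len, Function.update mem4 (tmpR s) 1⟩ := by
            convert r6 using 2 <;> omega
          have r7' : Runs K.p K.V ⟨l + 12 + len, Function.update mem4 (tmpR s) 1⟩ 1
              ⟨l + 6, Function.update mem4 (tmpR s) 1⟩ := by
            convert r7 using 2 ; omega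
          refine ⟨_, ?_, mem', x₁, hx₁, ((((((r1.trans r2).trans r3).trans r4).trans r5').trans
            r6').trans r7').trans r, g1, g2, ?_, ?_⟩
          · have : (k + 1) * (e.cost K.ρ + 7) = k * (e.cost K.ρ + 7) + (e.cost K.ρ + 7) := by ring
            omega
          · have hex : ∃ i < k + 1, e.eval (σ.setV x i) ≠ 0 := ⟨k, by omega, he⟩
            rw [g3, if_pos hex, Function.update_self]
            split_ifs <;> rfl
          · intro z hz
            rw [g4 z hz, Function.update_of_ne (by simp [hz.ne]), keep z (by omega) (by omega)]
    obtain ⟨n, hn, mem', x₁, hx₁, r, g1, g2, g3, g4⟩ := loop (σ.v y) mem0 le_rfl (σ.v x)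
      (h.small.v x) (by simpa [St.setV] using h0) q1 q2 q3
    have r8 := runs_move hc7 g1.le (varR_ne_tmpR hx).symm
    have a8 := g1.var hx hbx (h.small.v x) (by omega)
    rw [show (σ.setV x x₁).setV x (σ.v x) = σ by simp [St.setV]] at a8
    rw [g2] at r8
    have r8' : Runs K.p K.V ⟨l + 13 + len, mem'⟩ 2
        ⟨l + 15 + len, Function.update mem' (varR x) (σ.v x)⟩ := by
      convert r8 using 2 <;> omega
    refine ⟨6 + n + 2, ?_, _, ?_, a8, ?_, ?_⟩
    · simp only [Exp.cost, ← hN]; omega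
    · have := (r0.trans r).trans r8'
      convert this using 2
      simp only [List.length_append, List.length_cons, List.length_nil, ← hlen]
      omega
    · rw [Function.update_of_ne (varR_ne_tmpR hx).symm, g3, q0]; rfl
    · intro z hz
      rw [Function.update_of_ne (varR_ne_tmpR hx).symm, g4 z hz, k0 z hz]

end Machine
end Loop

namespace Loop.Machine
open RAM
variable {K : Machine}

set_option maxHeartbeats 1000000 in
/-- The code of a command executes it within the static time bound. -/
theorem cmd_runs (c : Cmd) {s l : ℕ} {σ : St} {mem : ℕ → ℕ} (hc : CodeAt K.p l (c.code s l))
    (h : K.At σ mem) (hok : c.ok K.nb) (hT : s + c.size ≤ K.T) :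
    ∃ n ≤ c.cost K.ρ, ∃ mem', Runs K.p K.V ⟨l, mem⟩ n ⟨l + (c.code s l).length, mem'⟩ ∧
      K.At (c.exec σ) mem' ∧ ∀ z < s, mem' (tmpR z) = mem (tmpR z) := by
  induction c generalizing s l σ mem with
  | skip => exact ⟨0, le_rfl, mem, Runs.refl h.le, h, fun z _ => rfl⟩
  | set x e =>
    simp only [Cmd.size] at hT
    have hp := exp_size_pos e
    simp only [Cmd.ok, Bool.and_eq_true, decide_eq_true_eq] at hok
    simp only [Cmd.code, codeAt_append] at hc
    obtain ⟨n, hn, mem1, r1, h1, e1, k1⟩ := exp_runs e hc.1 h hok.1.2 (by omega)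
    have r2 := runs_move hc.2 h1.le (varR_ne_tmpR hok.1.1.2).symm
    rw [e1] at r2
    refine ⟨n + 2, by simp only [Cmd.cost]; omega, _, ?_,
      h1.var hok.1.1.2 hok.1.1.1 (Exp.eval_le_of_small K.two_le hok.2 h.small) (by omega), ?_⟩
    · have := r1.trans r2
      simpa [Cmd.code, add_assoc] using this
    · intro z hz
      rw [Function.update_of_ne (varR_ne_tmpR hok.1.1.2).symm, k1 z hz]
  | put a e₁ e₂ =>
    simp only [Cmd.size] at hT
    have hp := exp_size_pos e₁
    have hp' := exp_size_pos e₂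
    simp only [Cmd.ok, Bool.and_eq_true, decide_eq_true_eq] at hok
    obtain ⟨⟨⟨ha, hok1⟩, hok2⟩, hsm⟩ := hok
    simp only [Cmd.code, codeAt_append] at hc
    obtain ⟨hc1, hc2, hc3, hc4⟩ := hc
    obtain ⟨n, hn, mem1, r1, h1, e1, k1⟩ := exp_runs e₁ hc1 h hok1 (by omega)
    obtain ⟨n', hn', mem2, r2, h2, e2, k2⟩ := exp_runs e₂ hc2 h1 hok2 (by omega)
    obtain ⟨mem3, r3, h3, e3, k3⟩ := runs_addr hc3 h2 (by omega) (by omega) (by omega) ha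
      ((k2 s (by omega)).trans e1) (m := e₁.size) (Exp.eval_le K.two_le e₁ h.small) (by omega)
    have hv := Exp.eval_le_of_small K.two_le hsm h.small
    have e4 : mem3 (tmpR (s + 1)) = e₂.eval σ := (k3 _ (by omega) (by omega)).trans e2
    have r4 : Runs K.p K.V _ _ _ := Straight.runs (c := [Instr.store (tmpR s) (tmpR (s + 1))])
      ⟨_, rfl, h3.le _, rfl⟩ hc4 h3.le
    rw [e3, e4] at r4
    refine ⟨n + n' + 5 + 1, by simp only [Cmd.cost]; omega, _, ?_,
      ⟨h3.rep.arr numVars_lt ha _ _, h3.small.setA hv, h3.bnd,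
        update_le h3.le (le_V (s := 1) (by simpa using hv) (by omega))⟩, ?_⟩
    · have := ((r1.trans r2).trans r3).trans r4
      simpa [Cmd.code, addrCode, add_assoc] using this
    · intro z hz
      rw [Function.update_of_ne, k3 z (by omega) (by omega), k2 z (by omega), k1 z hz]
      have := tmpR_lt (K := K) (s := z) (by omega)
      omega
  | seq c₁ c₂ ih₁ ih₂ =>
    simp only [Cmd.size] at hT
    simp only [Cmd.ok, Bool.and_eq_true] at hok
    simp only [Cmd.code, codeAt_append] at hc
    obtain ⟨n, hn, mem1, r1, h1, k1⟩ := ih₁ hc.1 h hok.1 (by omega)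
    obtain ⟨n', hn', mem2, r2, h2, k2⟩ := ih₂ hc.2 h1 hok.2 (by omega)
    refine ⟨n + n', by simp only [Cmd.cost]; omega, mem2, ?_, h2,
      fun z hz => (k2 z hz).trans (k1 z hz)⟩
    have := r1.trans r2
    simpa [Cmd.code, add_assoc] using this
  | ite e c₁ c₂ ih₁ ih₂ =>
    simp only [Cmd.size] at hT
    simp only [Cmd.ok, Bool.and_eq_true] at hok
    rw [Cmd.code] at hc ⊢
    simp only [codeAt_append, List.length_cons, List.length_nil, zero_add] at hc
    obtain ⟨hc0, hc1, hc2, hc3, hc4⟩ := hc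
    obtain ⟨n, hn, mem1, r1, h1, e1, k1⟩ := exp_runs e hc0 h hok.1.1 (by omega)
    have r2 := runs_jumpZero hc1 h1.le
    rw [e1] at r2
    simp only [List.length_append, List.length_cons, List.length_nil]
    set len := (e.code s l).length
    set l₁ := l + len + 1
    set len₁ := (c₁.code s l₁).length
    set l₂ := l₁ + len₁ + 1 with hl₂
    set len₂ := (c₂.code s l₂).length
    by_cases he : e.eval σ = 0
    · rw [if_pos he] at r2
      obtain ⟨n', hn', mem2, r3, h2, k2⟩ := ih₂ hc4 h1 hok.2 (by omega)
      refine ⟨n + 1 + n', by simp only [Cmd.cost]; omega, mem2, ?_, ?_,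
        fun z hz => (k2 z hz).trans (k1 z hz)⟩
      · convert (r1.trans r2).trans r3 using 2
        omega
      · rw [Cmd.exec, if_neg (by simpa using he)]; exact h2
    · rw [if_neg he] at r2
      obtain ⟨n', hn', mem2, r3, h2, k2⟩ := ih₁ hc2 h1 hok.1.2 (by omega)
      have r4 := runs_jump hc3 h2.le
      refine ⟨n + 1 + n' + 1, by simp only [Cmd.cost]; omega, mem2, ?_, ?_,
        fun z hz => (k2 z hz).trans (k1 z hz)⟩
      · convert ((r1.trans r2).trans r3).trans r4 using 2
        omega
      · rw [Cmd.exec, if_pos he]; exact h2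
  | loop x y c ih =>
    simp only [Cmd.size] at hT
    simp only [Cmd.ok, Bool.and_eq_true, decide_eq_true_eq] at hok
    obtain ⟨⟨⟨hbx, hx⟩, hby⟩, hokc⟩ := hok
    have hy : y < numVars := by omega
    rw [Cmd.code] at hc ⊢
    set len := (c.code (s + 3) (l + 9)).length with hlen
    simp only [codeAt_append, List.length_cons, List.length_nil, zero_add, Nat.reduceAdd] at hc
    obtain ⟨hc0, hc1, hc2, hc3, hc4⟩ := hc
    have hN : σ.v y = K.ρ y := h.bnd y hby
    obtain ⟨mem0, r0, h0, q0, q1, q2, k0⟩ : ∃ mem0, Runs K.p K.V ⟨l, mem⟩ 4 ⟨l + 4, mem0⟩ ∧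
        K.At σ mem0 ∧ mem0 (tmpR s) = 0 ∧ mem0 (tmpR (s + 1)) = σ.v y ∧
        mem0 (tmpR (s + 2)) = 1 ∧ ∀ z < s, mem0 (tmpR z) = mem (tmpR z) := by
      have c0 := hc0
      rw [show ∀ a b c d : Instr, [a, b, c, d] = [a] ++ ([b, c] ++ [d]) from fun _ _ _ _ => rfl] at c0
      simp only [codeAt_append, List.length_cons, List.length_nil, zero_add, Nat.reduceAdd] at c0
      obtain ⟨c0, c1, c2⟩ := c0
      have r1 := runs_const c0 h.le (Nat.zero_le _)
      have a1 := h.tmp (s := s) (n := 0) (by omega) (Nat.zero_le _)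
      have r2 := runs_move c1 a1.le (varR_ne_tmpR hy)
      have a2 := a1.tmp (s := s + 1) (by omega) (a1.le (varR y))
      have r3 := runs_const c2 a2.le K.one_le
      have a3 := a2.tmp (s := s + 2) (by omega) K.one_le
      refine ⟨_, (r1.trans r2).trans r3, a3, ?_, ?_, ?_, ?_⟩
      · simp
      · simp [varR_ne_tmpR hy, h.rep.v y hy]
      · simp
      · intro z hz
        simp [hz.ne, (show z ≠ s + 1 by omega), (show z ≠ s + 2 by omega)]
    have loop : ∀ k ≤ σ.v y, ∃ n ≤ k * (c.cost K.ρ + 6), ∃ mem',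
        Runs K.p K.V ⟨l + 4, mem0⟩ n ⟨l + 4, mem'⟩ ∧
          K.At (iter (fun i τ => c.exec (τ.setV x i)) k σ) mem' ∧
          mem' (tmpR s) = k ∧ mem' (tmpR (s + 1)) = σ.v y - k ∧ mem' (tmpR (s + 2)) = 1 ∧
          ∀ z < s, mem' (tmpR z) = mem0 (tmpR z) := by
      intro k
      induction k with
      | zero => exact fun _ => ⟨0, by omega, mem0, Runs.refl h0.le, h0, q0, q1, q2, fun z _ => rfl⟩
      | succ k ihk =>
        intro hk
        obtain ⟨n, hn, mem1, r1, h1, e1, e2, e3, k1⟩ := ihk (by omega)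
        have hyM := h.small.v y
        have hkV : ∀ m ≤ σ.v y, m ≤ K.V := fun m hm =>
          le_V (s := 1) (by simpa using hm.trans hyM) (by omega)
        have c2 := hc2
        rw [show ∀ a b c d : Instr, [a, b, c, d] = [a] ++ ([b, c] ++ [d]) from fun _ _ _ _ => rfl] at c2
        simp only [codeAt_append, List.length_cons, List.length_nil, zero_add, Nat.reduceAdd] at c2
        obtain ⟨c2, c3, c4⟩ := c2
        have r2 := runs_jumpZero hc1 h1.le
        rw [e2, if_neg (by omega)] at r2
        have r3 := runs_sub c2 h1.le
        rw [e2, e3] at r3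
        have a3 := h1.tmp (s := s + 1) (by omega) (hkV (σ.v y - k - 1) (by omega))
        have r4 := runs_move c3 a3.le (varR_ne_tmpR hx).symm
        have a4 := a3.var (n := k) hx hbx (by omega) (by omega)
        rw [show Function.update mem1 (tmpR (s + 1)) (σ.v y - k - 1) (tmpR s) = k by simp [e1]] at r4
        set mem4 := Function.update (Function.update mem1 (tmpR (s + 1)) (σ.v y - k - 1)) (varR x) k
          with hmem4
        have f1 : mem4 (tmpR s) = k := by
          rw [hmem4, Function.update_of_ne (varR_ne_tmpR hx).symm]; simp [e1]
        have f2 : mem4 (tmpR (s + 1)) = σ.v y - k - 1 := by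
          rw [hmem4, Function.update_of_ne (varR_ne_tmpR hx).symm]; simp
        have f3 : mem4 (tmpR (s + 2)) = 1 := by
          rw [hmem4, Function.update_of_ne (varR_ne_tmpR hx).symm]; simp [e3]
        have f4 : ∀ z < s, mem4 (tmpR z) = mem1 (tmpR z) := by
          intro z hz
          rw [hmem4, Function.update_of_ne (varR_ne_tmpR hx).symm,
            Function.update_of_ne (by simp; omega)]
        have hsum : mem4 (tmpR s) + mem4 (tmpR (s + 2)) ≤ K.V := by
          rw [f1, f3]; exact hkV _ hk
        have r5 := runs_add c4 a4.le hsum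
        rw [f1, f3] at r5
        have a5 := a4.tmp (s := s) (by omega) (hkV _ hk)
        obtain ⟨n6, hn6, mem6, r6, h6, k6⟩ := ih (s := s + 3) hc3 a5 hokc (by omega)
        have r7 := runs_jump hc4 h6.le
        refine ⟨_, ?_, mem6, (((((r1.trans r2).trans r3).trans r4).trans r5).trans r6).trans r7, h6,
          ?_, ?_, ?_, ?_⟩
        · have : (k + 1) * (c.cost K.ρ + 6) = k * (c.cost K.ρ + 6) + (c.cost K.ρ + 6) := by ring
          omega
        · rw [k6 _ (by omega), Function.update_self]
        · rw [k6 _ (by omega), Function.update_of_ne (by simp), f2]; omega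
        · rw [k6 _ (by omega), Function.update_of_ne (by simp), f3]
        · intro z hz
          rw [k6 _ (by omega), Function.update_of_ne (by simp; omega), f4 z hz, k1 z hz]
    obtain ⟨n, hn, mem1, r1, h1, e1, e2, e3, k1⟩ := loop (σ.v y) le_rfl
    have r2 := runs_jumpZero hc1 h1.le
    rw [e2, if_pos (Nat.sub_self _)] at r2
    refine ⟨4 + n + 1, ?_, mem1, ?_, h1, fun z hz => (k1 z hz).trans (k0 z hz)⟩
    · simp only [Cmd.cost, ← hN]; omega
    · have := (r0.trans r1).trans r2
      convert this using 2
      simp only [List.length_append, List.length_cons, List.length_nil, ← hlen]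
      omega

end Loop.Machine

/-! ### Making room for registers -/

namespace Loop
open RAM

/-- Code that moves the contents of cell `j + 1`, for `j ≤ i`, to the `stride * j`-th cell after the one
that cell `0` points to. It advances this pointer, and cell `1` is used for the increment. -/
def saveCode : ℕ → List Instr
  | 0 => [Instr.store 0 1, Instr.const 1 stride]
  | i + 1 => saveCode i ++ [Instr.add 0 0 1, Instr.store 0 (i + 2)]

/-- Code that makes the cells `1, ..., R` available as registers, and the input available as array `0`.
Since no cell is free at first, the length of the input in cell `0` is doubled `h` times, which yields
a base address beyond the input and beyond the registers. -/
def bootCode (h R : ℕ) : List Instr :=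
  List.replicate h (Instr.add 0 0 0) ++ (saveCode (R - 1) ++
  ([Instr.const 2 (stride * (R - 1)), Instr.sub 4 0 2, Instr.const 2 (R + 1), Instr.sub 5 4 2,
    Instr.const 6 1] ++
  ([Instr.jumpZero 5 (h + (saveCode (R - 1)).length + 12)] ++
  ([Instr.sub 5 5 6, Instr.load 3 2, Instr.add 0 0 1, Instr.store 0 3, Instr.add 2 2 6] ++
  ([Instr.jump (h + (saveCode (R - 1)).length + 5)] ++
  ([Instr.const 0 0, Instr.add 0 0 4] ++ [Instr.const 1 0, Instr.add 1 1 0]))))))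

theorem saveCode_length (i : ℕ) : (saveCode i).length = 2 * i + 2 := by
  induction i with
  | zero => rfl
  | succ i ih => rw [saveCode, List.length_append, ih]; simp; ring

theorem runs_double {p : Prog} {V l h n : ℕ} {mem : ℕ → ℕ}
    (hc : CodeAt p l (List.replicate h (Instr.add 0 0 0))) (hV : ∀ i, mem i ≤ V) (h0 : mem 0 = n)
    (hn : 2 ^ h * n ≤ V) : Runs p V ⟨l, mem⟩ h ⟨l + h, Function.update mem 0 (2 ^ h * n)⟩ := by
  induction h with
  | zero =>
    have : Function.update mem 0 (2 ^ 0 * n) = mem := by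
      rw [pow_zero, one_mul, ← h0, Function.update_eq_self]
    rw [this]; exact Runs.refl hV
  | succ h ih =>
    rw [List.replicate_succ', codeAt_append, List.length_replicate] at hc
    have hpow : 2 ^ (h + 1) * n = 2 ^ h * n + 2 ^ h * n := by ring
    have r1 := ih hc.1 (by omega)
    have r2 := runs_add hc.2 r1.le (by simp only [Function.update_self]; omega)
    have := r1.trans r2
    simpa [hpow, add_assoc] using this

/-- The state of the memory after saving the cells `1, ..., i + 1`. -/
structure Saved (A M : ℕ) (inp : ℕ → ℕ) (i : ℕ) (mem : ℕ → ℕ) : Prop where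
  ptr : mem 0 = A + stride * i
  inc : mem 1 = stride
  saved : ∀ j ≤ i, mem (A + stride * j) = inp j
  rest : ∀ j, 0 < j → j + 1 < A → mem (j + 1) = inp j
  le : ∀ j, mem j ≤ M

theorem runs_save {p : Prog} {A M l i : ℕ} {inp : ℕ → ℕ} {mem : ℕ → ℕ}
    (hc : CodeAt p l (saveCode i)) (hV : ∀ i, mem i ≤ M) (h0 : mem 0 = A)
    (hin : ∀ j, j + 1 < A → mem (j + 1) = inp j) (hiA : i + 2 ≤ A) (hM : (stride + 1) * A ≤ M) :
    ∃ mem', Runs p M ⟨l, mem⟩ (2 * i + 2) ⟨l + (2 * i + 2), mem'⟩ ∧ Saved A M inp i mem' := by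
  have hsA : (stride + 1) * A = stride * A + A := by ring
  induction i with
  | zero =>
    have hst : stride ≤ M := by
      have : stride * 1 ≤ stride * A := Nat.mul_le_mul_left _ (by omega)
      omega
    refine ⟨_, Straight.runs (c := saveCode 0) ⟨_, rfl, hV 1, _, rfl, hst, rfl⟩ hc hV, ?_⟩
    have hA0 : A ≠ 0 := by omega
    have hA1 : A ≠ 1 := by omega
    simp only [h0]
    refine ⟨?_, ?_, ?_, ?_, fun j => update_le (fun j => update_le hV (hV 1) j) hst j⟩
    · simp [hA0.symm, h0]
    · simp
    · intro j hj
      obtain rfl : j = 0 := by omega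
      simp [hA1, hin 0 (by omega)]
    · intro j hj hjA
      rw [Function.update_of_ne (by omega), Function.update_of_ne (by omega), hin j hjA]
  | succ i ih =>
    rw [saveCode, codeAt_append, saveCode_length] at hc
    obtain ⟨mem1, r1, hs⟩ := ih hc.1 (by omega)
    have hle : stride * (i + 1) ≤ stride * A := Nat.mul_le_mul_left _ (by omega)
    have hsum : mem1 0 + mem1 1 = A + stride * (i + 1) := by rw [hs.ptr, hs.inc]; ring
    have hpos : 0 < stride := by simp [stride]
    have hge : A ≤ A + stride * (i + 1) := by omega
    have r2 : Runs p M _ _ _ := Straight.runs (c := [Instr.add 0 0 1, Instr.store 0 (i + 2)])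
      (mem := mem1) ⟨(0, A + stride * (i + 1)), by simp [act, hsum], by simp only; omega,
        (A + stride * (i + 1), mem1 (i + 2)), by simp [act], hs.le _, rfl⟩ hc.2 hs.le
    simp only at r2
    refine ⟨_, by
      rw [show 2 * (i + 1) + 2 = 2 * i + 2 + 2 by omega, ← add_assoc l]
      exact r1.trans r2, ?_⟩
    refine ⟨?_, ?_, ?_, ?_, fun j => update_le (fun j => update_le hs.le (by omega) j) (hs.le _) j⟩
    · rw [Function.update_of_ne (by omega), Function.update_self]
    · rw [Function.update_of_ne (by omega), Function.update_of_ne (by omega), hs.inc]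
    · intro j hj
      by_cases hji : j = i + 1
      · subst hji
        rw [Function.update_self]; exact hs.rest (i + 1) (by omega) (by omega)
      · have : stride * j ≠ stride * (i + 1) := fun h => hji (Nat.eq_of_mul_eq_mul_left hpos h)
        rw [Function.update_of_ne (by omega), Function.update_of_ne (by omega), hs.saved j (by omega)]
    · intro j hj hjA
      rw [Function.update_of_ne (by omega), Function.update_of_ne (by omega), hs.rest j hj hjA]

/-- The boot code moves the input into array `0`, and puts the base address into variable `0`. -/
theorem runs_boot {p : Prog} {h R M : ℕ} {inp : List ℕ} (hc : CodeAt p 0 (bootCode h R))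
    (hR : 6 ≤ R) (hRh : R + 1 ≤ 2 ^ h) (hinp : inp ≠ [])
    (hle : ∀ i, inp.getD i 0 ≤ M) (hM : (stride + 1) * (2 ^ h * inp.length) ≤ M) :
    ∃ n ≤ 7 * (2 ^ h * inp.length) + h + 2 * R + 10, ∃ σ mem,
      Runs p M (initState inp) n ⟨(bootCode h R).length, mem⟩ ∧
      Rep (2 ^ h * inp.length) σ mem ∧ Small M σ ∧ (∀ i, mem i ≤ M) ∧
      σ.v 0 = 2 ^ h * inp.length ∧ ∀ i < inp.length, σ.a 0 i = inp.getD i 0 := by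
  set A := 2 ^ h * inp.length with hA
  have hsA : (stride + 1) * A = stride * A + A := by ring
  have hlen : 0 < inp.length := List.length_pos_iff.2 hinp
  have hRA : R + 1 ≤ A := hRh.trans (Nat.le_mul_of_pos_right _ hlen)
  have hnA : inp.length < A := by
    have : 7 * inp.length ≤ A := Nat.mul_le_mul_right _ (by omega)
    omega
  have hst : stride = 16 := rfl
  simp only [bootCode, codeAt_append, List.length_cons, List.length_nil, zero_add, Nat.reduceAdd,
    List.length_replicate, saveCode_length] at hc
  rw [show 2 * (R - 1) + 2 = 2 * R by omega] at hc
  obtain ⟨c1, c2, c3, c4, c5, c6, c7, c8⟩ := hc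
  -- the base address
  have hin0 : ∀ i, (initState inp).mem i ≤ M := by
    intro i
    simp only [initState]
    split_ifs
    · omega
    · exact hle _
  have r1 : Runs p M (initState inp) h ⟨0 + h, _⟩ :=
    runs_double (mem := (initState inp).mem) (n := inp.length) c1 hin0 (by simp [initState]) (by omega)
  rw [← hA, zero_add] at r1
  -- the first `R` cells
  obtain ⟨mem2, r2, s2⟩ := runs_save (A := A) (inp := fun j => inp.getD j 0) (by simpa using c2) r1.le
    (by simp) (by intro j _; simp [initState]) (show R - 1 + 2 ≤ A by omega) hM
  rw [show 2 * (R - 1) + 2 = 2 * R by omega] at r2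
  -- initialisation of the copying loop
  obtain ⟨mem3, r3, q0, q1, q2, q4, q5, q6, q7, q8⟩ : ∃ mem3, Runs p M ⟨h + 2 * R, mem2⟩ 5
      ⟨h + 2 * R + 5, mem3⟩ ∧ mem3 0 = A + stride * (R - 1) ∧ mem3 1 = stride ∧ mem3 2 = R + 1 ∧
      mem3 4 = A ∧ mem3 5 = A - (R + 1) ∧ mem3 6 = 1 ∧
      (∀ j < R, mem3 (A + stride * j) = inp.getD j 0) ∧
      (∀ j, R ≤ j → j + 1 < A → mem3 (j + 1) = inp.getD j 0) := by
    have e : stride * (R - 1) ≤ stride * A := Nat.mul_le_mul_left _ (by omega)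
    refine ⟨_, Straight.runs (c := [Instr.const 2 (stride * (R - 1)), Instr.sub 4 0 2,
      Instr.const 2 (R + 1), Instr.sub 5 4 2, Instr.const 6 1]) ⟨_, rfl, ?_, _, rfl, ?_, _, rfl, ?_, _, rfl, ?_,
        _, rfl, ?_, rfl⟩ (by simpa using c3) s2.le, ?_, ?_, ?_, ?_, ?_, ?_, ?_, ?_⟩
    · simp only; omega
    · simp [s2.ptr]; omega
    · simp only; omega
    · simp [s2.ptr]; omega
    · simp only; omega
    · simp [s2.ptr]
    · simp [s2.inc]
    · simp
    · simp [s2.ptr]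
    · simp [s2.ptr]
    · simp
    · intro j hj
      have := s2.saved j (by omega)
      rw [← this]
      simp only
      rw [Function.update_of_ne, Function.update_of_ne, Function.update_of_ne, Function.update_of_ne,
        Function.update_of_ne] <;> omega
    · intro j hj hjA
      have := s2.rest j (by omega) hjA
      rw [← this]
      simp only
      rw [Function.update_of_ne, Function.update_of_ne, Function.update_of_ne, Function.update_of_ne,
        Function.update_of_ne] <;> omega
  -- the copying loop
  have loop : ∀ k, R + k + 1 ≤ A → ∃ mem4, Runs p M ⟨h + 2 * R + 5, mem3⟩ (7 * k) ⟨h + 2 * R + 5, mem4⟩ ∧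
      mem4 0 = A + stride * (R + k - 1) ∧ mem4 1 = stride ∧ mem4 2 = R + k + 1 ∧
      mem4 4 = A ∧ mem4 5 = A - (R + k + 1) ∧ mem4 6 = 1 ∧
      (∀ j < R + k, mem4 (A + stride * j) = inp.getD j 0) ∧
      (∀ j, R ≤ j → j + 1 < A → mem4 (j + 1) = inp.getD j 0) := by
    intro k
    induction k with
    | zero => exact fun _ => ⟨mem3, Runs.refl r3.le, q0, q1, q2, q4, q5, q6, q7, q8⟩
    | succ k ih =>
      intro hk
      obtain ⟨mem4, r4, p0, p1, p2, p4, p5, p6, p7, p8⟩ := ih (by omega)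
      have ra := runs_jumpZero (mem := mem4) (by simpa using c4) r4.le
      rw [p5, if_neg (by omega)] at ra
      have hx : mem4 (R + k + 1) = inp.getD (R + k) 0 := p8 (R + k) (by omega) (by omega)
      have hptr : A + stride * (R + k - 1) + stride = A + stride * (R + k) := by
        rw [hst]; omega
      have e : stride * (R + k) ≤ stride * A := Nat.mul_le_mul_left _ (by omega)
      have rb : Runs p M _ _ _ := Straight.runs (c := [Instr.sub 5 5 6, Instr.load 3 2, Instr.add 0 0 1,
        Instr.store 0 3, Instr.add 2 2 6]) (mem := mem4) ⟨(5, A - (R + k + 1) - 1), by simp [act, p5, p6],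
          by simp only; omega, (3, inp.getD (R + k) 0), by
            simp [act, p2, (show R + k + 1 ≠ 5 by omega), hx], hle _,
          (0, A + stride * (R + k)), by simp [act, p0, p1, hptr], by simp only; omega,
          (A + stride * (R + k), inp.getD (R + k) 0), by simp [act], hle _,
          (2, R + k + 1 + 1), by
            simp [act, p2, p6, (show 2 ≠ A + stride * (R + k) by omega),
              (show 6 ≠ A + stride * (R + k) by omega)], by simp only; omega, rfl⟩
        (by simpa using c5) r4.le
      have rc := runs_jump (by simpa [saveCode_length, show 2 * (R - 1) + 2 = 2 * R by omega] using c6) rb.le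
      simp only [List.length_cons, List.length_nil, zero_add, Nat.reduceAdd] at rb rc
      refine ⟨_, by
        have := ((r4.trans ra).trans rb).trans rc
        rw [show 7 * (k + 1) = 7 * k + 1 + 5 + 1 by omega]
        exact this, ?_, ?_, ?_, ?_, ?_, ?_, ?_, ?_⟩
      · simp [(show 0 ≠ A + stride * (R + k) by omega), show R + (k + 1) - 1 = R + k by omega]
      · simp [(show 1 ≠ A + stride * (R + k) by omega), p1]
      · simp; omega
      · simp [(show 4 ≠ A + stride * (R + k) by omega), p4]
      · simp [(show 5 ≠ A + stride * (R + k) by omega)]; omega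
      · simp [(show 6 ≠ A + stride * (R + k) by omega), p6]
      · intro j hj
        by_cases hjk : j = R + k
        · subst hjk
          rw [Function.update_of_ne (by omega), Function.update_self]
        · rw [Function.update_of_ne (by omega), Function.update_of_ne (by rw [hst]; omega),
            Function.update_of_ne (by omega), Function.update_of_ne (by omega),
            Function.update_of_ne (by omega), p7 j (by omega)]
      · intro j hj hjA
        rw [Function.update_of_ne (by omega), Function.update_of_ne (by omega),
            Function.update_of_ne (by omega), Function.update_of_ne (by omega),
            Function.update_of_ne (by omega), p8 j hj hjA]
  obtain ⟨mem4, r4, p0, p1, p2, p4, p5, p6, p7, p8⟩ := loop (A - (R + 1)) (by omega)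
  have r5 := runs_jumpZero (mem := mem4) (by simpa using c4) r4.le
  rw [p5, if_pos (by omega)] at r5
  have r6 := runs_move c7 r5.le (by decide)
  have r7 := runs_move c8 r6.le (by decide)
  simp only [Function.update_self] at r7
  simp only [add_assoc, Nat.reduceAdd] at r1 r2 r3 r4 r5 r6 r7
  set mem7 := Function.update (Function.update mem4 0 (mem4 4)) 1 (mem4 4) with hmem7
  have hrun := (((((r1.trans r2).trans r3).trans r4).trans r5).trans r6).trans r7
  have hpc : (bootCode h R).length = h + (2 * R + 16) := by
    simp only [bootCode, List.length_append, List.length_cons, List.length_nil, List.length_replicate,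
      saveCode_length]
    omega
  refine ⟨_, ?_, ⟨fun x => if x < numVars then mem7 (varR x) else 0,
    fun b i => if b < stride then mem7 (A + stride * i + b) else 0⟩, mem7, by rw [hpc]; exact hrun,
      ⟨?_, ?_, ?_⟩, ⟨?_, ?_⟩, hrun.le, ?_, ?_⟩
  · omega
  · simp [hmem7, p4]
  · intro x hx; simp [hx]
  · intro b hb i; simp [hb]
  · intro x; dsimp only; split_ifs
    · exact hrun.le _
    · exact Nat.zero_le _
  · intro b i; dsimp only; split_ifs
    · exact hrun.le _
    · exact Nat.zero_le _
  · simp [hmem7, numVars, varR, p4]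
  · intro i hi
    have hpos : 0 < stride := by simp [stride]
    simp only [hpos, if_true, add_zero]
    rw [hmem7, Function.update_of_ne (by omega), Function.update_of_ne (by omega), p7 i (by omega)]

end Loop

/-! ### Building blocks of programs -/

namespace Loop

theorem Runs.mono {p : RAM.Prog} {V V' n : ℕ} {s t : RAM.State} (h : Runs p V s n t) (hV : V ≤ V') :
    Runs p V' s n t :=
  ⟨h.1, fun m hm i => (h.2 m hm i).trans hV⟩

instance : Add Exp := ⟨Exp.bin Op.add⟩
instance : Sub Exp := ⟨Exp.bin Op.sub⟩
instance : Mul Exp := ⟨Exp.bin Op.mul⟩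

/-- The characteristic function of equality. -/
def Exp.eq (e₁ e₂ : Exp) : Exp := Exp.bin Op.eq e₁ e₂

/-- The minimum of two values. -/
def Exp.min (e₁ e₂ : Exp) : Exp := Exp.bin Op.min e₁ e₂

@[simp] theorem Exp.eval_const (n : ℕ) (σ : St) : (Exp.const n).eval σ = n := rfl
@[simp] theorem Exp.eval_var (x : ℕ) (σ : St) : (Exp.var x).eval σ = σ.v x := rfl
@[simp] theorem Exp.eval_get (a : ℕ) (e : Exp) (σ : St) : (Exp.get a e).eval σ = σ.a a (e.eval σ) := rfl
@[simp] theorem Exp.eval_add (e₁ e₂ : Exp) (σ : St) : (e₁ + e₂).eval σ = e₁.eval σ + e₂.eval σ := rfl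
@[simp] theorem Exp.eval_sub (e₁ e₂ : Exp) (σ : St) : (e₁ - e₂).eval σ = e₁.eval σ - e₂.eval σ := rfl
@[simp] theorem Exp.eval_mul (e₁ e₂ : Exp) (σ : St) : (e₁ * e₂).eval σ = e₁.eval σ * e₂.eval σ := rfl
@[simp] theorem Exp.eval_eq (e₁ e₂ : Exp) (σ : St) :
    (Exp.eq e₁ e₂).eval σ = if e₁.eval σ = e₂.eval σ then 1 else 0 := rfl
@[simp] theorem Exp.eval_min (e₁ e₂ : Exp) (σ : St) :
    (Exp.min e₁ e₂).eval σ = Min.min (e₁.eval σ) (e₂.eval σ) := rfl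
theorem Exp.eval_any_ne_zero {x y : ℕ} {e : Exp} {σ : St} :
    (Exp.any x y e).eval σ ≠ 0 ↔ ∃ i < σ.v y, e.eval (σ.setV x i) ≠ 0 := by
  simp [Exp.eval]

theorem Cmd.exec_set (x : ℕ) (e : Exp) (σ : St) : (Cmd.set x e).exec σ = σ.setV x (e.eval σ) := rfl
theorem Cmd.exec_put (a : ℕ) (e₁ e₂ : Exp) (σ : St) :
    (Cmd.put a e₁ e₂).exec σ = σ.setA a (e₁.eval σ) (e₂.eval σ) := rfl
theorem Cmd.exec_seq (e₁ e₂ : Cmd) (σ : St) : (Cmd.seq e₁ e₂).exec σ = e₂.exec (e₁.exec σ) := rfl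
open Classical in
theorem Cmd.exec_ite (e : Exp) (e₁ e₂ : Cmd) (σ : St) :
    (Cmd.ite e e₁ e₂).exec σ = if e.eval σ ≠ 0 then e₁.exec σ else e₂.exec σ := by
  simp only [Cmd.exec]
@[simp] theorem Cmd.exec_skip (σ : St) : Cmd.skip.exec σ = σ := rfl

theorem Cmd.exec_loop_induction {x y : ℕ} {e : Cmd} {σ : St} (P : ℕ → St → Prop) (h0 : P 0 σ)
    (hs : ∀ i < σ.v y, ∀ τ, P i τ → P (i + 1) (e.exec (τ.setV x i))) :
    P (σ.v y) ((Cmd.loop x y e).exec σ) :=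
  iter_induction h0 hs

/-- `τ` agrees with `σ` outside the variables `xs` and the arrays `as`. -/
structure Agree (xs as : List ℕ) (σ τ : St) : Prop where
  v : ∀ x, x ∉ xs → τ.v x = σ.v x
  a : ∀ b, b ∉ as → τ.a b = σ.a b

theorem Agree.refl {xs as : List ℕ} {σ : St} : Agree xs as σ σ := ⟨fun _ _ => rfl, fun _ _ => rfl⟩

theorem Agree.trans {xs as : List ℕ} {σ τ υ : St} (h : Agree xs as σ τ) (h' : Agree xs as τ υ) :
    Agree xs as σ υ :=
  ⟨fun x hx => (h'.v x hx).trans (h.v x hx), fun b hb => (h'.a b hb).trans (h.a b hb)⟩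

theorem Agree.setV {xs as : List ℕ} {σ τ : St} (h : Agree xs as σ τ) {x : ℕ} (hx : x ∈ xs) (n : ℕ) :
    Agree xs as σ (τ.setV x n) :=
  ⟨fun y hy => by rw [St.setV_of_ne _ _ (by rintro rfl; exact hy hx), h.v y hy], h.a⟩

theorem Agree.setA {xs as : List ℕ} {σ τ : St} (h : Agree xs as σ τ) {b : ℕ} (hb : b ∈ as) (i n : ℕ) :
    Agree xs as σ (τ.setA b i n) :=
  ⟨h.v, fun d hd => by rw [St.setA_of_ne _ _ _ (by rintro rfl; exact hd hb), h.a d hd]⟩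

theorem Agree.mono {xs as xs' as' : List ℕ} {σ τ : St} (h : Agree xs as σ τ) (hx : xs ⊆ xs')
    (ha : as ⊆ as') : Agree xs' as' σ τ :=
  ⟨fun y hy => h.v y fun h' => hy (hx h'), fun y hy => h.a y fun h' => hy (ha h')⟩

theorem Cmd.exec_agree (e : Cmd) (σ : St) : Agree e.vars e.arrs σ (e.exec σ) :=
  ⟨fun _ hx => Cmd.exec_v hx σ, fun _ ha => Cmd.exec_a ha σ⟩

/-- Assigns a value to each entry of the array `a` below the variable `y`; the value may depend on the
index `x`. -/
def fill (a x y : ℕ) (e : Exp) : Cmd := Cmd.loop x y (Cmd.put a (Exp.var x) e)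

theorem exec_fill {a x y : ℕ} {e : Exp} {σ : St} {f : ℕ → ℕ}
    (h : ∀ i < σ.v y, ∀ τ, Agree [x] [a] σ τ → τ.v x = i → e.eval τ = f i) :
    ∀ i < σ.v y, ((fill a x y e).exec σ).a a i = f i := by
  have := Cmd.exec_loop_induction (x := x) (y := y) (e := Cmd.put a (Exp.var x) e) (σ := σ)
    (fun k τ => Agree [x] [a] σ τ ∧ ∀ i < k, τ.a a i = f i) ⟨Agree.refl, by simp⟩ (by
      rintro k hk τ ⟨hA, hf⟩
      have hA' := hA.setV (x := x) (by simp) k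
      refine ⟨hA'.setA (by simp) _ _, fun i hi => ?_⟩
      rw [Cmd.exec_put, St.setA_self, Exp.eval_var, St.setV_self, h k hk _ hA' (St.setV_self _ _ _),
        Function.update_apply]
      split_ifs with hik
      · rw [hik]
      · exact hf i (by omega))
  exact this.2

/-- A variant of `exec_fill` for arrays of truth values. -/
theorem exec_fill_ne_zero {a x y : ℕ} {e : Exp} {σ : St} {P : ℕ → Prop}
    (h : ∀ i < σ.v y, ∀ τ, Agree [x] [a] σ τ → τ.v x = i → (e.eval τ ≠ 0 ↔ P i)) :
    ∀ i < σ.v y, ((fill a x y e).exec σ).a a i ≠ 0 ↔ P i := by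
  have := Cmd.exec_loop_induction (x := x) (y := y) (e := Cmd.put a (Exp.var x) e) (σ := σ)
    (fun k τ => Agree [x] [a] σ τ ∧ ∀ i < k, τ.a a i ≠ 0 ↔ P i) ⟨Agree.refl, by simp⟩ (by
      rintro k hk τ ⟨hA, hf⟩
      have hA' := hA.setV (x := x) (by simp) k
      refine ⟨hA'.setA (by simp) _ _, fun i hi => ?_⟩
      rw [Cmd.exec_put, St.setA_self, Exp.eval_var, St.setV_self, Function.update_apply]
      split_ifs with hik
      · rw [hik]; exact h k hk _ hA' (St.setV_self _ _ _)
      · exact hf i (by omega))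
  exact this.2

/-! ### Transitive closure -/

/-- Puts an element of `F` that is not recorded in the array `3` into the variable `18`, or the
value of `y` if there is none. -/
def searchCmd (F y : ℕ) : Cmd :=
  Cmd.seq (Cmd.set 18 (Exp.var y))
    (Cmd.loop 26 y (Cmd.ite (Exp.get F (Exp.var 26) * (Exp.const 1 - Exp.get 3 (Exp.var 26)))
      (Cmd.set 18 (Exp.var 26)) Cmd.skip))

theorem exec_searchCmd (F : ℕ) {y : ℕ} {σ : St} (hy : y ∉ [18, 25, 26, 27]) :
    Agree [18, 26] [] σ ((searchCmd F y).exec σ) ∧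
      (((searchCmd F y).exec σ).v 18 < σ.v y ∧ σ.a F (((searchCmd F y).exec σ).v 18) ≠ 0 ∧
        σ.a 3 (((searchCmd F y).exec σ).v 18) = 0 ∨
      ((searchCmd F y).exec σ).v 18 = σ.v y ∧ ∀ i < σ.v y, σ.a F i ≠ 0 → σ.a 3 i ≠ 0) := by
  have h0 : Agree [18, 26] [] σ (σ.setV 18 (σ.v y)) := Agree.refl.setV (by simp) _
  have hy0 := h0.v y (by simp at hy; simp [hy])
  have := Cmd.exec_loop_induction (x := 26) (y := y) (e := Cmd.ite (Exp.get F (Exp.var 26) *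
        (Exp.const 1 - Exp.get 3 (Exp.var 26))) (Cmd.set 18 (Exp.var 26)) Cmd.skip)
      (σ := σ.setV 18 (σ.v y))
      (fun k τ => Agree [18, 26] [] σ τ ∧
        (τ.v 18 < σ.v y ∧ σ.a F (τ.v 18) ≠ 0 ∧ σ.a 3 (τ.v 18) = 0 ∨
          τ.v 18 = σ.v y ∧ ∀ i < k, σ.a F i ≠ 0 → σ.a 3 i ≠ 0))
      ⟨h0, Or.inr ⟨by simp, by simp⟩⟩ (by
        rintro k hk τ ⟨hA, hcase⟩
        rw [hy0] at hk
        have hA2 := hA.setV (x := 26) (by simp) k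
        have ha : ∀ b, τ.a b = σ.a b := fun b => hA.a b (by simp)
        simp only [Cmd.exec_ite, Cmd.exec_set, Exp.eval_mul, Exp.eval_get, Exp.eval_var, St.setV_self,
          St.setV_a, ha, Exp.eval_sub, Exp.eval_const, Cmd.exec_skip]
        split_ifs with hcond
        · refine ⟨hA2.setV (by simp) _, Or.inl ?_⟩
          rw [St.setV_self]
          refine ⟨hk, fun h => hcond (by simp [h]), ?_⟩
          by_contra h
          exact hcond (by rw [Nat.sub_eq_zero_of_le (by omega), mul_zero])
        · refine ⟨hA2, ?_⟩
          rw [St.setV_of_ne _ _ (by decide)]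
          refine hcase.imp id fun hcase => ⟨hcase.1, fun i hi hFi => ?_⟩
          by_cases hik : i = k
          · subst hik
            intro h
            rw [h] at hcond
            simp [hFi] at hcond
          · exact hcase.2 i (by omega) hFi)
  rw [hy0] at this
  exact this

/-- Adds to `F` the successors of the value of the variable `18`. -/
def addCmd (F y : ℕ) (e : Exp) : Cmd :=
  Cmd.loop 27 y (Cmd.ite e (Cmd.put F (Exp.var 27) (Exp.const 1)) Cmd.skip)

theorem exec_addCmd {F y : ℕ} {e : Exp} {σ : St} {P : ℕ → Prop}
    (he : ∀ j < σ.v y, ∀ τ, Agree [27] [F] σ τ → τ.v 27 = j → (e.eval τ ≠ 0 ↔ P j)) {j : ℕ} :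
    ((addCmd F y e).exec σ).a F j ≠ 0 ↔ σ.a F j ≠ 0 ∨ j < σ.v y ∧ P j := by
  have := Cmd.exec_loop_induction (x := 27) (y := y)
    (e := Cmd.ite e (Cmd.put F (Exp.var 27) (Exp.const 1)) Cmd.skip) (σ := σ)
    (fun k τ => Agree [27] [F] σ τ ∧ ∀ j, τ.a F j ≠ 0 ↔ σ.a F j ≠ 0 ∨ j < k ∧ P j)
    ⟨Agree.refl, by simp⟩ (by
      rintro k hk τ ⟨hA, h⟩
      have hA' := hA.setV (x := 27) (by simp) k
      have hP := he k hk _ hA' (St.setV_self _ _ _)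
      rw [Cmd.exec_ite]
      split_ifs with hcond
      · refine ⟨hA'.setA (by simp) _ _, fun j => ?_⟩
        rw [Cmd.exec_put, St.setA_self, Function.update_apply, Exp.eval_var, St.setV_self]
        split_ifs with hj
        · subst hj
          simp [hP.1 hcond]
        · rw [St.setV_a, h j]
          have : j < k + 1 ↔ j < k := by omega
          rw [this]
      · refine ⟨hA', fun j => ?_⟩
        rw [Cmd.exec_skip, St.setV_a, h j]
        have hnP : ¬ P k := fun hk => hcond (hP.2 hk)
        constructor
        · rintro (h | h)
          exacts [Or.inl h, Or.inr ⟨by omega, h.2⟩]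
        · rintro (h | h)
          · exact Or.inl h
          · by_cases hjk : j = k
            · exact absurd (hjk ▸ h.2) hnP
            · exact Or.inr ⟨by omega, h.2⟩)
  exact this.2 j

/-- Closes the set of the `i` with `F[i] ≠ 0` under the relation given by the expression `e`, which
refers to the source as variable `18` and to the target as variable `27`. The array `3` records
the elements whose successors have been added; each round deals with another element. -/
def closeCmd (F y : ℕ) (e : Exp) : Cmd :=
  Cmd.seq (fill 3 26 y (Exp.const 0))
  (Cmd.loop 25 y (Cmd.seq (searchCmd F y) (Cmd.ite (Exp.var y - Exp.var 18)
      (Cmd.seq (Cmd.put 3 (Exp.var 18) (Exp.const 1)) (addCmd F y e)) Cmd.skip)))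

/-- `closeCmd` computes the set of elements reachable from `F`: each of its rounds records a further
element, unless all elements of `F` have been recorded, so as many rounds as elements suffice. -/
theorem exec_closeCmd {F y : ℕ} {e : Exp} {σ : St} {r : ℕ → ℕ → Prop} (hF : F ≠ 3)
    (hy : y ∉ [18, 25, 26, 27])
    (he : ∀ i < σ.v y, ∀ j < σ.v y, ∀ τ, Agree [18, 25, 26, 27] [F, 3] σ τ → τ.v 18 = i → τ.v 27 = j →
      (e.eval τ ≠ 0 ↔ r i j)) (j : ℕ) (hj : j < σ.v y) :
    ((closeCmd F y e).exec σ).a F j ≠ 0 ↔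
      ∃ i < σ.v y, σ.a F i ≠ 0 ∧ ReflTransGen (fun i j => j < σ.v y ∧ r i j) i j := by
  classical
  generalize hn : σ.v y = n at *
  set σ₀ := (fill 3 26 y (Exp.const 0)).exec σ with hσ₀
  have h0 : Agree [18, 25, 26, 27] [F, 3] σ σ₀ :=
    (Cmd.exec_agree _ _).mono (by simp [fill, Cmd.vars]) (by simp [fill, Cmd.arrs])
  have h0F : σ₀.a F = σ.a F := Cmd.exec_a (by simpa [fill, Cmd.arrs] using hF) σ
  have h03 : ∀ i < n, σ₀.a 3 i = 0 := by
    rw [← hn]; exact exec_fill (f := fun _ => 0) (fun _ _ _ _ _ => rfl)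
  let Inv : ℕ → St → Prop := fun k τ => Agree [18, 25, 26, 27] [F, 3] σ τ ∧
    (∀ i < n, σ.a F i ≠ 0 → τ.a F i ≠ 0) ∧
    (∀ i < n, τ.a F i ≠ 0 → ∃ i' < n, σ.a F i' ≠ 0 ∧ ReflTransGen (fun i j => j < n ∧ r i j) i' i) ∧
    (∀ i < n, τ.a 3 i ≠ 0 → ∀ j < n, r i j → τ.a F j ≠ 0) ∧
    ((∀ i < n, τ.a F i ≠ 0 → τ.a 3 i ≠ 0) ∨ k ≤ ((Finset.range n).filter (τ.a 3 · ≠ 0)).card)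
  have hy0 : σ₀.v y = n := (h0.v y hy).trans hn
  have main : Inv (σ₀.v y) ((closeCmd F y e).exec σ) := by
    refine Cmd.exec_loop_induction Inv ⟨h0, ?_, ?_, ?_, Or.inr (Nat.zero_le _)⟩ ?_
    · intro i _ hi; rwa [h0F]
    · intro i hin hi; exact ⟨i, hin, by rwa [h0F] at hi, ReflTransGen.refl⟩
    · intro i hin hi; exact absurd (h03 i hin) hi
    rintro k - τ ⟨hA, h1, h2, h3, h4⟩
    rw [Cmd.exec_seq]
    have hA1 := hA.setV (x := 25) (by simp) k
    obtain ⟨hA2, search⟩ := exec_searchCmd F (σ := τ.setV 25 k) hy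
    rw [(hA1.v y hy).trans hn, St.setV_a] at search
    generalize (searchCmd F y).exec (τ.setV 25 k) = τ2 at *
    have hA3 := hA1.trans (hA2.mono (by simp) (by simp))
    have hy3 : τ2.v y = n := (hA3.v y hy).trans hn
    have ha : ∀ b, τ2.a b = τ.a b := fun b => hA2.a b (by simp)
    rw [Cmd.exec_ite, Exp.eval_sub, Exp.eval_var, Exp.eval_var, hy3]
    rcases search with ⟨hlt, hF2, h32⟩ | ⟨heq, hall⟩
    · rw [if_pos (by omega), Cmd.exec_seq, Cmd.exec_put, Exp.eval_var, Exp.eval_const]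
      generalize hi₀ : τ2.v 18 = i₀ at *
      set τ3 := τ2.setA 3 i₀ 1 with hτ3
      have hA4 : Agree [18, 25, 26, 27] [F, 3] σ τ3 := hA3.setA (by simp) _ _
      have hy4 : τ3.v y = n := hy3
      have hF3 : τ3.a F = τ.a F := by rw [hτ3, St.setA_of_ne _ _ _ hF, ha]
      have add : ∀ j, ((addCmd F y e).exec τ3).a F j ≠ 0 ↔ τ.a F j ≠ 0 ∨ j < n ∧ r i₀ j := by
        intro j
        rw [exec_addCmd (P := r i₀), hF3, hy4]
        intro j hj τ' hA' hj'
        rw [hy4] at hj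
        refine he i₀ hlt j hj τ' (hA4.trans (hA'.mono (by simp) (by simp))) ?_ hj'
        rw [hA'.v 18 (by simp)]
        exact hi₀
      have h33 : ((addCmd F y e).exec τ3).a 3 = Function.update (τ.a 3) i₀ 1 := by
        rw [Cmd.exec_a (by simpa [addCmd, Cmd.arrs] using hF.symm), hτ3, St.setA_self, ha]
      have hA5 : Agree [18, 25, 26, 27] [F, 3] σ ((addCmd F y e).exec τ3) :=
        hA4.trans ((Cmd.exec_agree _ _).mono (by simp [addCmd, Cmd.vars]) (by simp [addCmd, Cmd.arrs]))
      refine ⟨hA5, fun i hi h => (add i).2 (Or.inl (h1 i hi h)), ?_, ?_, Or.inr ?_⟩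
      · intro i hi h
        rcases (add i).1 h with h | ⟨-, h⟩
        · exact h2 i hi h
        · obtain ⟨i', hi', hF', hp⟩ := h2 i₀ hlt hF2
          exact ⟨i', hi', hF', hp.tail ⟨hi, h⟩⟩
      · intro i hi h j hj hr
        rw [h33, Function.update_apply] at h
        split_ifs at h with hii
        · exact (add j).2 (Or.inr ⟨hj, hii ▸ hr⟩)
        · exact (add j).2 (Or.inl (h3 i hi h j hj hr))
      · have hk := h4.resolve_left fun h => h i₀ hlt hF2 h32
        have : (Finset.range n).filter (((addCmd F y e).exec τ3).a 3 · ≠ 0) =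
            insert i₀ ((Finset.range n).filter (τ.a 3 · ≠ 0)) := by
          ext i
          rw [h33]
          simp only [Finset.mem_filter, Finset.mem_range, Finset.mem_insert, Function.update_apply]
          by_cases hii : i = i₀
          · subst hii; simp [hlt]
          · simp [hii]
        rw [this, Finset.card_insert_of_notMem (by simp [h32])]
        omega
    · rw [if_neg (by omega), Cmd.exec_skip]
      refine ⟨hA3, ?_⟩
      simp only [ha]
      exact ⟨h1, h2, h3, Or.inl hall⟩
  rw [hy0] at main
  obtain ⟨-, h1, h2, h3, h4⟩ := main
  generalize (closeCmd F y e).exec σ = τ at *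
  have hfin : ∀ i < n, τ.a F i ≠ 0 → τ.a 3 i ≠ 0 := by
    rcases h4 with h4 | h4
    · exact h4
    · intro i hi _
      have := Finset.filter_card_eq (s := Finset.range n) (p := (τ.a 3 · ≠ 0))
        (le_antisymm ((Finset.card_filter_le _ _)) (by simpa using h4))
      exact this i (by simpa using hi)
  refine ⟨h2 j hj, ?_⟩
  rintro ⟨i, hi, hFi, hp⟩
  have : j < n ∧ τ.a F j ≠ 0 := by
    clear hj
    induction hp with
    | refl => exact ⟨hi, h1 i hi hFi⟩
    | tail _ hs ih => exact ⟨hs.1, h3 _ ih.1 (hfin _ ih.1 ih.2) _ hs.1 hs.2⟩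
  exact this.2

end Loop

/-! ### The program in the state of a loop program -/

namespace Loop

variable {Y : AbsSys} {U : ℕ → Prop} {σ τ : St}

/-- The state holds the program `Y` and the unsafe states `U`: variables `1` to `10` hold `L`, `L + 1`,
`D`, `D + 1`, the number `2 * D + 1` of labels, `C`, the number of nodes, and the initial value and
states; array `0` holds the tables, starting at the positions given by the variables `11`, `12`, `13`.
The check of a guide changes none of these variables, which are its loop bounds. -/
structure Loaded (Y : AbsSys) (U : ℕ → Prop) (σ : St) : Prop where
  L : σ.v 1 = Y.L
  L1 : σ.v 2 = Y.L + 1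
  D : σ.v 3 = Y.D
  D1 : σ.v 4 = Y.D + 1
  W : σ.v 5 = 2 * Y.D + 1
  C : σ.v 6 = Y.C
  N : σ.v 7 = Y.L * (Y.D + 1)
  mem0 : σ.v 8 = Y.mem0
  lead0 : σ.v 9 = Y.lead0
  cont0 : σ.v 10 = Y.cont0
  lead : ∀ q < Y.L, ∀ l < 2 * Y.D + 1, ∀ q' < Y.L,
    σ.a 0 (σ.v 11 + ((q * (2 * Y.D + 1) + l) * Y.L + q')) ≠ 0 ↔ Y.lead q l q'
  cont : ∀ q < Y.C, ∀ l < 2 * Y.D + 1, ∀ q' < Y.C,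
    σ.a 0 (σ.v 12 + ((q * (2 * Y.D + 1) + l) * Y.C + q')) ≠ 0 ↔ Y.cont q l q'
  unsafe_iff : ∀ q < Y.L, σ.a 0 (σ.v 13 + q) ≠ 0 ↔ U q

/-- In addition, the arrays `9` and `10` hold the two parts of each node. -/
structure Ready (Y : AbsSys) (U : ℕ → Prop) (σ : St) : Prop extends Loaded Y U σ where
  nodeState : ∀ i < Y.L * (Y.D + 1), σ.a 9 i = i / (Y.D + 1)
  nodeMem : ∀ i < Y.L * (Y.D + 1), σ.a 10 i = i % (Y.D + 1)

theorem Loaded.congr (h : Loaded Y U σ) (hv : ∀ x < 14, τ.v x = σ.v x) (h0 : τ.a 0 = σ.a 0) :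
    Loaded Y U τ := by
  obtain ⟨l1, l2, l3, l4, l5, l6, l7, l8, l9, l10, l11, l12, l13⟩ := h
  constructor <;> (try rw [hv _ (by decide)]) <;> (try simp only [h0]) <;> assumption

theorem Loaded.of_agree (h : Loaded Y U σ) {xs as : List ℕ} (hA : Agree xs as σ τ)
    (hl : (xs.all (14 ≤ ·) && as.all (· ≠ 0)) = true) : Loaded Y U τ := by
  simp only [Bool.and_eq_true, List.all_eq_true, decide_eq_true_eq] at hl
  exact h.congr (fun x hx => hA.v x fun hm => absurd (hl.1 x hm) (by omega))
    (hA.a 0 fun hm => hl.2 0 hm rfl)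

theorem Ready.of_agree (h : Ready Y U σ) {xs as : List ℕ} (hA : Agree xs as σ τ)
    (hl : (xs.all (14 ≤ ·) && as.all (fun a => a ≠ 0 ∧ a ≠ 9 ∧ a ≠ 10)) = true) : Ready Y U τ := by
  simp only [Bool.and_eq_true, List.all_eq_true, decide_eq_true_eq] at hl
  have h9 : τ.a 9 = σ.a 9 := hA.a 9 fun hm => (hl.2 9 hm).2.1 rfl
  have h10 : τ.a 10 = σ.a 10 := hA.a 10 fun hm => (hl.2 10 hm).2.2 rfl
  exact ⟨h.toLoaded.congr (fun x hx => hA.v x fun hm => absurd (hl.1 x hm) (by omega))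
    (hA.a 0 fun hm => (hl.2 0 hm).1 rfl), by rw [h9]; exact h.nodeState, by rw [h10]; exact h.nodeMem⟩

/-- The form of `Cmd.exec_agree` whose hypothesis is checked by `decide`. -/
theorem Agree.of_exec {e : Cmd} {σ : St} {xs as : List ℕ}
    (h : (e.vars.all (fun x => decide (x ∈ xs)) && e.arrs.all (fun x => decide (x ∈ as))) = true) :
    Agree xs as σ (e.exec σ) := by
  simp only [Bool.and_eq_true, List.all_eq_true, decide_eq_true_eq] at h
  exact (Cmd.exec_agree e σ).mono h.1 h.2

/-- The bit of a transition of the leader. -/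
def leadE (q l q' : Exp) : Exp :=
  Exp.get 0 (Exp.var 11 + ((q * Exp.var 5 + l) * Exp.var 1 + q'))

/-- The bit of a transition of the contributor. -/
def contE (q l q' : Exp) : Exp :=
  Exp.get 0 (Exp.var 12 + ((q * Exp.var 5 + l) * Exp.var 6 + q'))

theorem Ready.eval_leadE (h : Ready Y U σ) {q l q' : Exp} (hq : q.eval σ < Y.L)
    (hl : l.eval σ < 2 * Y.D + 1) (hq' : q'.eval σ < Y.L) :
    (leadE q l q').eval σ ≠ 0 ↔ Y.lead (q.eval σ) (l.eval σ) (q'.eval σ) := by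
  simp only [leadE, Exp.eval_get, Exp.eval_add, Exp.eval_mul, Exp.eval_var, h.W, h.L]
  exact h.lead _ hq _ hl _ hq'

theorem Ready.eval_contE (h : Ready Y U σ) {q l q' : Exp} (hq : q.eval σ < Y.C)
    (hl : l.eval σ < 2 * Y.D + 1) (hq' : q'.eval σ < Y.C) :
    (contE q l q').eval σ ≠ 0 ↔ Y.cont (q.eval σ) (l.eval σ) (q'.eval σ) := by
  simp only [contE, Exp.eval_get, Exp.eval_add, Exp.eval_mul, Exp.eval_var, h.W, h.C]
  exact h.cont _ hq _ hl _ hq'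

/-- Whether there is an edge from the node in variable `x` to the node in variable `z`, if array `4`
holds the values that contributors can write. -/
def edgeE (x z : ℕ) : Exp :=
  let uq := Exp.get 9 (Exp.var x)
  let um := Exp.get 10 (Exp.var x)
  let wq := Exp.get 9 (Exp.var z)
  let wm := Exp.get 10 (Exp.var z)
  um * Exp.eq wm um * (leadE uq (Exp.const 0) wq + leadE uq (Exp.const 2 * um) wq) +
  (Exp.eq wq uq * Exp.eq wm (Exp.const 0) +
  (Exp.eq um (Exp.const 0) * Exp.eq wm (Exp.const 0) * (leadE uq (Exp.const 0) wq +
    Exp.any 28 3 (Exp.get 4 (Exp.var 28) *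
      leadE uq (Exp.const 2 * Exp.var 28 + Exp.const 2) wq)) +
  Exp.eq um (Exp.const 0) * wm * leadE uq (Exp.const 2 * wm - Exp.const 1) wq))

theorem Ready.setV (h : Ready Y U σ) {x n : ℕ} (hx : 14 ≤ x) : Ready Y U (σ.setV x n) :=
  h.of_agree (xs := [x]) (as := []) (Agree.refl.setV (by simp) n) (by simpa using hx)

theorem eval_add_ne_zero {e₁ e₂ : Exp} : (e₁ + e₂).eval σ ≠ 0 ↔ e₁.eval σ ≠ 0 ∨ e₂.eval σ ≠ 0 := by
  rw [Exp.eval_add]; omega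

theorem eval_mul_ne_zero {e₁ e₂ : Exp} : (e₁ * e₂).eval σ ≠ 0 ↔ e₁.eval σ ≠ 0 ∧ e₂.eval σ ≠ 0 := by
  rw [Exp.eval_mul, mul_ne_zero_iff]

theorem eval_eq_ne_zero {e₁ e₂ : Exp} : (Exp.eq e₁ e₂).eval σ ≠ 0 ↔ e₁.eval σ = e₂.eval σ := by
  simp

theorem Ready.eval_edgeE (h : Ready Y U σ) {S : Set ℕ} (hS : ∀ b < Y.D, σ.a 4 b ≠ 0 ↔ b ∈ S)
    (hSD : ∀ b ∈ S, b < Y.D) {x z : ℕ} (hx : x ≠ 28) (hz : z ≠ 28)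
    (hxN : σ.v x < Y.L * (Y.D + 1)) (hzN : σ.v z < Y.L * (Y.D + 1)) :
    (edgeE x z).eval σ ≠ 0 ↔ Y.Edge S (σ.v x) (σ.v z) := by
  have ux : σ.v x / (Y.D + 1) < Y.L := (Nat.div_lt_iff_lt_mul (Nat.succ_pos _)).2 hxN
  have uz : σ.v z / (Y.D + 1) < Y.L := (Nat.div_lt_iff_lt_mul (Nat.succ_pos _)).2 hzN
  have mx : σ.v x % (Y.D + 1) < Y.D + 1 := Nat.mod_lt _ (Nat.succ_pos _)
  have mz : σ.v z % (Y.D + 1) < Y.D + 1 := Nat.mod_lt _ (Nat.succ_pos _)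
  have hany : (Exp.any 28 3 (Exp.get 4 (Exp.var 28) * leadE (Exp.get 9 (Exp.var x))
      (Exp.const 2 * Exp.var 28 + Exp.const 2) (Exp.get 9 (Exp.var z)))).eval σ ≠ 0 ↔
      ∃ b ∈ S, Y.lead (σ.v x / (Y.D + 1)) (2 * b + 2) (σ.v z / (Y.D + 1)) := by
    rw [Exp.eval_any_ne_zero, h.D]
    constructor
    · rintro ⟨b, hb, he⟩
      rw [eval_mul_ne_zero, (h.setV (by decide)).eval_leadE] at he <;>
        simp only [Exp.eval_get, Exp.eval_var, St.setV_self, St.setV_a, St.setV_of_ne _ _ hx,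
          St.setV_of_ne _ _ hz, h.nodeState _ hxN, h.nodeState _ hzN, Exp.eval_add, Exp.eval_mul,
          Exp.eval_const] at he ⊢
      · exact ⟨b, (hS b hb).1 he.1, he.2⟩
      · exact ux
      · omega
      · exact uz
    · rintro ⟨b, hb, he⟩
      have hbD := hSD b hb
      refine ⟨b, hbD, ?_⟩
      rw [eval_mul_ne_zero, (h.setV (by decide)).eval_leadE] <;>
        simp only [Exp.eval_get, Exp.eval_var, St.setV_self, St.setV_a, St.setV_of_ne _ _ hx,
          St.setV_of_ne _ _ hz, h.nodeState _ hxN, h.nodeState _ hzN, Exp.eval_add, Exp.eval_mul,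
          Exp.eval_const]
      · exact ⟨(hS b hbD).2 hb, he⟩
      · exact ux
      · omega
      · exact uz
  have e9x : (Exp.get 9 (Exp.var x)).eval σ = σ.v x / (Y.D + 1) := h.nodeState _ hxN
  have e9z : (Exp.get 9 (Exp.var z)).eval σ = σ.v z / (Y.D + 1) := h.nodeState _ hzN
  have e10x : (Exp.get 10 (Exp.var x)).eval σ = σ.v x % (Y.D + 1) := h.nodeMem _ hxN
  have e10z : (Exp.get 10 (Exp.var z)).eval σ = σ.v z % (Y.D + 1) := h.nodeMem _ hzN
  have l1 := h.eval_leadE (q := Exp.get 9 (Exp.var x)) (l := Exp.const 0) (q' := Exp.get 9 (Exp.var z))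
    (by rw [e9x]; exact ux) (by rw [Exp.eval_const]; omega) (by rw [e9z]; exact uz)
  have l2 := h.eval_leadE (q := Exp.get 9 (Exp.var x)) (l := Exp.const 2 * Exp.get 10 (Exp.var x))
    (q' := Exp.get 9 (Exp.var z)) (by rw [e9x]; exact ux)
    (by rw [Exp.eval_mul, Exp.eval_const, e10x]; omega) (by rw [e9z]; exact uz)
  have l3 := h.eval_leadE (q := Exp.get 9 (Exp.var x))
    (l := Exp.const 2 * Exp.get 10 (Exp.var z) - Exp.const 1) (q' := Exp.get 9 (Exp.var z))
    (by rw [e9x]; exact ux)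
    (by rw [Exp.eval_sub, Exp.eval_mul, Exp.eval_const, Exp.eval_const, e10z]; omega)
    (by rw [e9z]; exact uz)
  rw [e9x, e9z] at l1 l2 l3
  rw [Exp.eval_const] at l1
  rw [Exp.eval_mul, Exp.eval_const, e10x] at l2
  rw [Exp.eval_sub, Exp.eval_mul, Exp.eval_const, Exp.eval_const, e10z] at l3
  rw [edgeE]
  simp only [eval_mul_ne_zero, eval_add_ne_zero, eval_eq_ne_zero] at hany ⊢
  rw [hany, l1, l2, l3, e9x, e9z, e10x, e10z, Exp.eval_const, AbsSys.Edge, and_assoc, and_assoc, and_assoc]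

/-- Computes the values that contributors can write into array `4`. -/
def writableCmd : Cmd :=
  fill 4 28 3 (Exp.any 26 6 (Exp.get 2 (Exp.var 26) *
    Exp.any 27 6 (contE (Exp.var 26) (Exp.const 2 * Exp.var 28 + Exp.const 1) (Exp.var 27))))

/-- The contributor states recorded in array `2`. -/
def contSet (Y : AbsSys) (σ : St) : Set ℕ := {p | p < Y.C ∧ σ.a 2 p ≠ 0}

theorem Ready.exec_writableCmd (h : Ready Y U σ) :
    ∀ b < Y.D, (writableCmd.exec σ).a 4 b ≠ 0 ↔ b ∈ Y.writable (contSet Y σ) := by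
  rw [← h.D]
  refine exec_fill_ne_zero ?_
  intro b hb τ hA hτ
  rw [h.D] at hb
  have hr := h.of_agree hA (by decide)
  rw [Exp.eval_any_ne_zero, hr.C]
  have key : ∀ p < Y.C, (Exp.get 2 (Exp.var 26) * Exp.any 27 6 (contE (Exp.var 26)
      (Exp.const 2 * Exp.var 28 + Exp.const 1) (Exp.var 27))).eval (τ.setV 26 p) ≠ 0 ↔
      σ.a 2 p ≠ 0 ∧ ∃ p', Y.cont p (2 * b + 1) p' := by
    intro p hp
    have hr' : Ready Y U (τ.setV 26 p) := hr.setV (by decide)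
    rw [eval_mul_ne_zero, Exp.eval_any_ne_zero, hr'.C]
    have e2 : (Exp.get 2 (Exp.var 26)).eval (τ.setV 26 p) = σ.a 2 p := by
      simp [hA.a 2 (by decide)]
    rw [e2]
    have hc : ∀ p' < Y.C, (contE (Exp.var 26) (Exp.const 2 * Exp.var 28 + Exp.const 1)
        (Exp.var 27)).eval ((τ.setV 26 p).setV 27 p') ≠ 0 ↔ Y.cont p (2 * b + 1) p' := by
      intro p' hp'
      have hr'' : Ready Y U ((τ.setV 26 p).setV 27 p') := hr'.setV (by decide)
      rw [hr''.eval_contE] <;> simp [St.setV_v, hτ, hp, hp', hb]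
    refine and_congr_right fun _ => ⟨?_, ?_⟩
    · rintro ⟨p', hp', h'⟩; exact ⟨p', (hc p' hp').1 h'⟩
    · rintro ⟨p', h'⟩; exact ⟨p', Y.cont_lt h', (hc p' (Y.cont_lt h')).2 h'⟩
  constructor
  · rintro ⟨p, hp, h'⟩
    exact ⟨hb, p, ⟨hp, ((key p hp).1 h').1⟩, ((key p hp).1 h').2⟩
  · rintro ⟨-, p, ⟨hp, hp2⟩, h'⟩
    exact ⟨p, hp, (key p hp).2 ⟨hp2, h'⟩⟩

end Loop

/-! ### Searching the graph of the leader -/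

namespace Loop

variable {Y : AbsSys} {U : ℕ → Prop} {σ τ : St}

theorem lt_nodes_iff {u : ℕ} : u < Y.L * (Y.D + 1) ↔ u / (Y.D + 1) < Y.L :=
  (Nat.div_lt_iff_lt_mul (Nat.succ_pos _)).symm

theorem mul_add_lt_nodes {q m : ℕ} (hq : q < Y.L) (hm : m < Y.D + 1) :
    q * (Y.D + 1) + m < Y.L * (Y.D + 1) := by
  rw [lt_nodes_iff, AbsSys.mul_add_div_succ hm]; exact hq

/-- Paths of the leader do not leave the set of nodes. -/
theorem path_restrict {S : Set ℕ} {u w : ℕ} (hu : u < Y.L * (Y.D + 1)) :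
    ReflTransGen (fun i j => j < Y.L * (Y.D + 1) ∧ Y.Edge S i j) u w ↔ ReflTransGen (Y.Edge S) u w := by
  constructor
  · exact ReflTransGen.mono (fun _ _ h => h.2) _ _
  · intro h
    induction h with
    | refl => exact ReflTransGen.refl
    | tail hp he ih =>
      exact ih.tail ⟨lt_nodes_iff.2 (he.lt (AbsSys.path_lt hp (lt_nodes_iff.1 hu))), he⟩

theorem path_restrict_swap {S : Set ℕ} {t w : ℕ} (hw : w < Y.L * (Y.D + 1)) :
    ReflTransGen (fun i j => j < Y.L * (Y.D + 1) ∧ Y.Edge S j i) t w ↔ ReflTransGen (Y.Edge S) w t := by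
  constructor
  · intro h
    have : ReflTransGen (fun i j => Y.Edge S j i) t w := ReflTransGen.mono (fun _ _ h => h.2) _ _ h
    exact reflTransGen_swap.1 this
  · intro h
    induction h using ReflTransGen.head_induction_on with
    | refl => exact ReflTransGen.refl
    | head he hp ih =>
      have := lt_nodes_iff.2 (he.lt (lt_nodes_iff.1 hw))
      exact (ih this).tail ⟨hw, he⟩

/-- The state holds the leader node (in variables `14` and `15`) and the set of contributor states. -/
structure Holds (Y : AbsSys) (σ : St) (s : ℕ × Set ℕ) : Prop where
  node : σ.v 14 * (Y.D + 1) + σ.v 15 = s.1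
  state_lt : σ.v 14 < Y.L
  mem_lt : σ.v 15 < Y.D + 1
  conts : contSet Y σ = s.2

theorem Holds.of_agree {s : ℕ × Set ℕ} (h : Holds Y σ s) {xs as : List ℕ} (hA : Agree xs as σ τ)
    (hl : (xs.all (fun x => x ≠ 14 ∧ x ≠ 15) && as.all (· ≠ 2)) = true) : Holds Y τ s := by
  simp only [Bool.and_eq_true, List.all_eq_true, decide_eq_true_eq] at hl
  have h14 := hA.v 14 fun hm => (hl.1 _ hm).1 rfl
  have h15 := hA.v 15 fun hm => (hl.1 _ hm).2 rfl
  have h2 := hA.a 2 fun hm => hl.2 _ hm rfl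
  exact ⟨by rw [h14, h15]; exact h.node, by rw [h14]; exact h.state_lt,
    by rw [h15]; exact h.mem_lt, by rw [contSet, h2]; exact h.conts⟩

/-- Array `4` holds the values that contributors can write, array `5` the nodes reachable from `u`, and
array `6` the nodes from which `t` is reachable. -/
structure Analyzed (Y : AbsSys) (S : Set ℕ) (u t : ℕ) (σ : St) : Prop where
  values : ∀ b < Y.D, σ.a 4 b ≠ 0 ↔ b ∈ S
  fwd : ∀ w < Y.L * (Y.D + 1), σ.a 5 w ≠ 0 ↔ ReflTransGen (Y.Edge S) u w
  bwd : ∀ w < Y.L * (Y.D + 1), σ.a 6 w ≠ 0 ↔ ReflTransGen (Y.Edge S) w t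

theorem Analyzed.of_agree {S : Set ℕ} {u t : ℕ} (h : Analyzed Y S u t σ) {xs as : List ℕ}
    (hA : Agree xs as σ τ) (hl : as.all (fun a => a ≠ 4 ∧ a ≠ 5 ∧ a ≠ 6) = true) :
    Analyzed Y S u t τ := by
  simp only [List.all_eq_true, decide_eq_true_eq] at hl
  have h4 := hA.a 4 fun hm => (hl _ hm).1 rfl
  have h5 := hA.a 5 fun hm => (hl _ hm).2.1 rfl
  have h6 := hA.a 6 fun hm => (hl _ hm).2.2 rfl
  exact ⟨by rw [h4]; exact h.values, by rw [h5]; exact h.fwd, by rw [h6]; exact h.bwd⟩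

/-- Analyzes the graph of the leader, for the current node and the target state in variable `16`. -/
def analyzeCmd : Cmd :=
  Cmd.seq writableCmd
  (Cmd.seq (fill 5 26 7 (Exp.eq (Exp.var 26) (Exp.var 14 * Exp.var 4 + Exp.var 15)))
  (Cmd.seq (fill 6 26 7 (Exp.eq (Exp.var 26) (Exp.var 16 * Exp.var 4)))
  (Cmd.seq (closeCmd 5 7 (edgeE 18 27)) (closeCmd 6 7 (edgeE 27 18)))))

theorem agree_analyzeCmd : Agree [18, 25, 26, 27, 28] [3, 4, 5, 6] σ (analyzeCmd.exec σ) :=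
  Agree.of_exec (by decide)

theorem exec_analyzeCmd (h : Ready Y U σ) {s : ℕ × Set ℕ} (hs : Holds Y σ s) (ht : σ.v 16 < Y.L) :
    Analyzed Y (Y.writable s.2) s.1 (σ.v 16 * (Y.D + 1)) (analyzeCmd.exec σ) := by
  have hSD : ∀ b ∈ Y.writable s.2, b < Y.D := fun b hb => hb.1
  have hu : s.1 < Y.L * (Y.D + 1) := by rw [← hs.node]; exact mul_add_lt_nodes hs.state_lt hs.mem_lt
  have htN : σ.v 16 * (Y.D + 1) < Y.L * (Y.D + 1) := mul_add_lt_nodes (m := 0) ht (Nat.succ_pos _)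
  rw [analyzeCmd, Cmd.exec_seq, Cmd.exec_seq, Cmd.exec_seq, Cmd.exec_seq]
  -- the values that contributors can write
  have w4 := h.exec_writableCmd
  rw [hs.conts] at w4
  have a1 : Agree [28] [4] σ (writableCmd.exec σ) := Agree.of_exec (by decide)
  generalize writableCmd.exec σ = σ1 at *
  have h1 := h.of_agree a1 (by decide)
  have s1 := hs.of_agree a1 (by decide)
  have t1 := a1.v 16 (by decide)
  -- the start of the forward search
  have f5 := exec_fill_ne_zero (a := 5) (x := 26) (y := 7)
    (e := Exp.eq (Exp.var 26) (Exp.var 14 * Exp.var 4 + Exp.var 15)) (σ := σ1) (P := (· = s.1)) (by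
      intro i _ τ hA hτ
      rw [eval_eq_ne_zero]
      simp only [Exp.eval_var, Exp.eval_add, Exp.eval_mul, hτ, (h1.of_agree hA (by decide)).D1,
        (s1.of_agree hA (by decide)).node])
  have a2 : Agree [26] [5] σ1 ((fill 5 26 7 (Exp.eq (Exp.var 26)
    (Exp.var 14 * Exp.var 4 + Exp.var 15))).exec σ1) := Agree.of_exec (by decide)
  generalize (fill 5 26 7 _).exec σ1 = σ2 at *
  rw [h1.N] at f5
  have h2 := h1.of_agree a2 (by decide)
  have t2 := (a2.v 16 (by decide)).trans t1
  -- the start of the backward search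
  have f6 := exec_fill_ne_zero (a := 6) (x := 26) (y := 7)
    (e := Exp.eq (Exp.var 26) (Exp.var 16 * Exp.var 4)) (σ := σ2) (P := (· = σ.v 16 * (Y.D + 1))) (by
      intro i _ τ hA hτ
      rw [eval_eq_ne_zero]
      simp only [Exp.eval_var, Exp.eval_mul, hτ, (h2.of_agree hA (by decide)).D1,
        (hA.v 16 (by decide)).trans t2])
  have a3 : Agree [26] [6] σ2 ((fill 6 26 7 (Exp.eq (Exp.var 26)
    (Exp.var 16 * Exp.var 4))).exec σ2) := Agree.of_exec (by decide)
  generalize (fill 6 26 7 _).exec σ2 = σ3 at *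
  rw [h2.N] at f6
  have h3 := h2.of_agree a3 (by decide)
  have e35 := a3.a 5 (by decide)
  have e34 := (a3.a 4 (by decide)).trans (a2.a 4 (by decide))
  -- the forward search
  have c5 := exec_closeCmd (F := 5) (y := 7) (e := edgeE 18 27) (σ := σ3)
    (r := Y.Edge (Y.writable s.2)) (by decide) (by decide) (by
      intro i hi j hj τ hA h18 h27
      rw [h3.N] at hi hj
      rw [(h3.of_agree hA (by decide)).eval_edgeE (S := Y.writable s.2) ?_ hSD (by decide) (by decide)
        (by rw [h18]; exact hi) (by rw [h27]; exact hj), h18, h27]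
      intro b hb
      rw [hA.a 4 (by decide), e34]
      exact w4 b hb)
  have a4 : Agree [18, 25, 26, 27] [3, 5] σ3 ((closeCmd 5 7 (edgeE 18 27)).exec σ3) :=
    Agree.of_exec (by decide)
  generalize (closeCmd 5 7 (edgeE 18 27)).exec σ3 = σ4 at *
  have h4 := h3.of_agree a4 (by decide)
  have e46 := a4.a 6 (by decide)
  have e44 := (a4.a 4 (by decide)).trans e34
  -- the backward search
  have c6 := exec_closeCmd (F := 6) (y := 7) (e := edgeE 27 18) (σ := σ4)
    (r := fun i j => Y.Edge (Y.writable s.2) j i) (by decide) (by decide) (by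
      intro i hi j hj τ hA h18 h27
      rw [h4.N] at hi hj
      rw [(h4.of_agree hA (by decide)).eval_edgeE (S := Y.writable s.2) ?_ hSD (by decide) (by decide)
        (by rw [h27]; exact hj) (by rw [h18]; exact hi), h18, h27]
      intro b hb
      rw [hA.a 4 (by decide), e44]
      exact w4 b hb)
  have a5 : Agree [18, 25, 26, 27] [3, 6] σ4 ((closeCmd 6 7 (edgeE 27 18)).exec σ4) :=
    Agree.of_exec (by decide)
  generalize (closeCmd 6 7 (edgeE 27 18)).exec σ4 = σ5 at *
  rw [h3.N] at c5
  rw [h4.N] at c6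
  refine ⟨?_, ?_, ?_⟩
  · rw [a5.a 4 (by decide), e44]; exact w4
  · intro w hw
    rw [a5.a 5 (by decide), c5 w hw, ← path_restrict hu]
    constructor
    · rintro ⟨i, hi, hF, hp⟩
      rw [e35, f5 i hi] at hF
      rwa [hF] at hp
    · intro hp
      exact ⟨_, hu, by rw [e35]; exact (f5 _ hu).2 rfl, hp⟩
  · intro w hw
    rw [c6 w hw, ← path_restrict_swap hw]
    constructor
    · rintro ⟨i, hi, hF, hp⟩
      rw [e46, f6 i hi] at hF
      rwa [hF] at hp
    · intro hp
      exact ⟨_, htN, by rw [e46]; exact (f6 _ htN).2 rfl, hp⟩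

/-- Whether some node with memory part `m` is on a path from the current node to the target. -/
def betweenE (m : Exp) : Exp :=
  Exp.any 29 1 (Exp.get 5 (Exp.var 29 * Exp.var 4 + m) * Exp.get 6 (Exp.var 29 * Exp.var 4 + m))

theorem eval_betweenE (h : Ready Y U σ) {S : Set ℕ} {u t x : ℕ} (ha : Analyzed Y S u t σ)
    (hx : x ≠ 29) (hm : σ.v x < Y.D + 1) :
    (betweenE (Exp.var x)).eval σ ≠ 0 ↔ Y.Between S u t (σ.v x) := by
  rw [betweenE, Exp.eval_any_ne_zero, h.L, AbsSys.Between]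
  refine exists_congr fun q => and_congr_right fun hq => ?_
  have hw := mul_add_lt_nodes hq hm
  rw [eval_mul_ne_zero]
  simp only [Exp.eval_get, Exp.eval_add, Exp.eval_mul, Exp.eval_var, St.setV_self,
    (h.setV (show 14 ≤ 29 by decide) (n := q)).D1, St.setV_of_ne _ _ hx, St.setV_a]
  exact and_congr (ha.fwd _ hw) (ha.bwd _ hw)

/-- Lets contributors move, where the array `7` holds the possible memory parts of the node, and the
array `4` the values that contributors can write. Array `8` is used for the enabled labels. -/
def spreadCmd : Cmd :=
  Cmd.seq (fill 8 28 5 (Exp.min (Exp.eq (Exp.var 28) (Exp.const 0) + Exp.any 29 3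
    (Exp.eq (Exp.var 28) (Exp.const 2 * Exp.var 29 + Exp.const 1) * Exp.get 7 (Exp.const 0) +
      Exp.eq (Exp.var 28) (Exp.const 2 * Exp.var 29 + Exp.const 2) *
        (Exp.get 7 (Exp.var 29 + Exp.const 1) + Exp.get 7 (Exp.const 0) * Exp.get 4 (Exp.var 29))))
    (Exp.const 1)))
  (closeCmd 2 6 (Exp.any 28 5 (Exp.get 8 (Exp.var 28) * contE (Exp.var 18) (Exp.var 28) (Exp.var 27))))

theorem agree_spreadCmd : Agree [18, 25, 26, 27, 28] [2, 3, 8] σ (spreadCmd.exec σ) :=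
  Agree.of_exec (by decide)

theorem exec_spreadCmd (h : Ready Y U σ) {X : ℕ → Prop} {S : Set ℕ}
    (hX : ∀ m < Y.D + 1, σ.a 7 m ≠ 0 ↔ X m) (hS : ∀ b < Y.D, σ.a 4 b ≠ 0 ↔ b ∈ S) :
    contSet Y (spreadCmd.exec σ) = Y.closure (Y.Enabled X S) (contSet Y σ) := by
  have f8 := exec_fill_ne_zero (a := 8) (x := 28) (y := 5) (e := Exp.min (Exp.eq (Exp.var 28) (Exp.const 0) +
    Exp.any 29 3
    (Exp.eq (Exp.var 28) (Exp.const 2 * Exp.var 29 + Exp.const 1) * Exp.get 7 (Exp.const 0) +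
      Exp.eq (Exp.var 28) (Exp.const 2 * Exp.var 29 + Exp.const 2) *
        (Exp.get 7 (Exp.var 29 + Exp.const 1) + Exp.get 7 (Exp.const 0) * Exp.get 4 (Exp.var 29))))
    (Exp.const 1)) (σ := σ) (P := Y.Enabled X S) (by
      intro l _ τ hA hτ
      have hmin : ∀ e : Exp, (Exp.min e (Exp.const 1)).eval τ ≠ 0 ↔ e.eval τ ≠ 0 := by
        intro e; rw [Exp.eval_min, Exp.eval_const]; omega
      rw [hmin, eval_add_ne_zero, eval_eq_ne_zero, Exp.eval_any_ne_zero, AbsSys.Enabled, Exp.eval_var, hτ,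
        Exp.eval_const, (h.of_agree hA (by decide)).D, ← exists_or]
      refine or_congr_right (exists_congr fun b => ?_)
      rw [← and_or_left]
      refine and_congr_right fun hb => ?_
      rw [eval_add_ne_zero, eval_mul_ne_zero, eval_mul_ne_zero, eval_add_ne_zero, eval_mul_ne_zero,
        eval_eq_ne_zero, eval_eq_ne_zero]
      simp only [Exp.eval_get, Exp.eval_add, Exp.eval_mul, Exp.eval_var, Exp.eval_const, St.setV_self,
        St.setV_a, St.setV_of_ne _ _ (show 28 ≠ 29 by decide), hτ, hA.a 7 (by decide), hA.a 4 (by decide),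
        hX 0 (Nat.succ_pos _), hX (b + 1) (by omega), hS b hb])
  have a1 := Agree.of_exec (e := fill 8 28 5 (Exp.min (Exp.eq (Exp.var 28) (Exp.const 0) +
    Exp.any 29 3
    (Exp.eq (Exp.var 28) (Exp.const 2 * Exp.var 29 + Exp.const 1) * Exp.get 7 (Exp.const 0) +
      Exp.eq (Exp.var 28) (Exp.const 2 * Exp.var 29 + Exp.const 2) *
        (Exp.get 7 (Exp.var 29 + Exp.const 1) + Exp.get 7 (Exp.const 0) * Exp.get 4 (Exp.var 29))))
    (Exp.const 1))) (σ := σ) (xs := [28]) (as := [8]) (by decide)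
  rw [spreadCmd, Cmd.exec_seq]
  generalize (fill 8 28 5 _).exec σ = σ1 at *
  have h1 := h.of_agree a1 (by decide)
  rw [h.W] at f8
  have c2 := exec_closeCmd (F := 2) (y := 6) (e := Exp.any 28 5 (Exp.get 8 (Exp.var 28) *
      contE (Exp.var 18) (Exp.var 28) (Exp.var 27))) (σ := σ1)
    (r := fun p p' => ∃ l, Y.Enabled X S l ∧ Y.cont p l p') (by decide) (by decide) (by
      intro i hi j hj τ hA h18 h27
      have hτ := h1.of_agree hA (by decide)
      rw [h1.C] at hi hj
      have key : ∀ l < 2 * Y.D + 1, (Exp.get 8 (Exp.var 28) *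
          contE (Exp.var 18) (Exp.var 28) (Exp.var 27)).eval (τ.setV 28 l) ≠ 0 ↔
          Y.Enabled X S l ∧ Y.cont i l j := by
        intro l hl
        have e18 : (τ.setV 28 l).v 18 = i := (St.setV_of_ne _ _ (by decide)).trans h18
        have e27 : (τ.setV 28 l).v 27 = j := (St.setV_of_ne _ _ (by decide)).trans h27
        rw [eval_mul_ne_zero, (hτ.setV (show 14 ≤ 28 by decide)).eval_contE] <;>
          simp only [Exp.eval_get, Exp.eval_var, St.setV_self, e18, e27, St.setV_a, hi, hj, hl,
            hA.a 8 (by decide), f8 l hl]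
      rw [Exp.eval_any_ne_zero, hτ.W]
      constructor
      · rintro ⟨l, hl, he⟩; exact ⟨l, (key l hl).1 he⟩
      · rintro ⟨l, he, hc⟩
        have hl : l < 2 * Y.D + 1 := by
          rcases he with rfl | ⟨b, hb, rfl, -⟩ | ⟨b, hb, rfl, -⟩ <;> omega
        exact ⟨l, hl, (key l hl).2 ⟨he, hc⟩⟩)
  rw [h1.C] at c2
  ext p
  constructor
  · rintro ⟨hp, hp2⟩
    obtain ⟨i, hi, hF, hpath⟩ := (c2 p hp).1 hp2
    exact ⟨i, ⟨hi, by rwa [← a1.a 2 (by decide)]⟩, ReflTransGen.mono (fun _ _ h => h.2) _ _ hpath⟩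
  · intro hp
    have hpC := AbsSys.closure_lt (fun p hp => hp.1) p hp
    obtain ⟨i, ⟨hi, hF⟩, hpath⟩ := hp
    refine ⟨hpC, (c2 p hpC).2 ⟨i, hi, by rwa [a1.a 2 (by decide)], ?_⟩⟩
    exact ReflTransGen.mono (fun _ _ ⟨l, hl, hc⟩ => ⟨Y.cont_lt hc, l, hl, hc⟩) _ _ hpath

end Loop

/-! ### Simulating a guide -/

namespace Loop

variable {Y : AbsSys} {U : ℕ → Prop} {σ τ : St}

/-- One saturation at the current node, which must be the target, with irrelevant memory. -/
def saturateCmd : Cmd :=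
  Cmd.seq analyzeCmd (Cmd.seq (fill 7 30 4 (betweenE (Exp.var 30))) spreadCmd)

theorem agree_saturateCmd :
    Agree [18, 25, 26, 27, 28, 30] [2, 3, 4, 5, 6, 7, 8] σ (saturateCmd.exec σ) :=
  Agree.of_exec (by decide)

theorem exec_saturateCmd (h : Ready Y U σ) {t : ℕ} {R : Set ℕ} (hs : Holds Y σ (t, R))
    (h15 : σ.v 15 = 0) (h16 : σ.v 16 = σ.v 14) :
    Holds Y (saturateCmd.exec σ) (t, Y.saturate t R) := by
  have a0 := agree_saturateCmd (σ := σ)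
  suffices hc : contSet Y (saturateCmd.exec σ) = Y.saturate t R by
    refine ⟨?_, ?_, ?_, hc⟩
    · rw [a0.v 14 (by decide), a0.v 15 (by decide)]; exact hs.node
    · rw [a0.v 14 (by decide)]; exact hs.state_lt
    · rw [a0.v 15 (by decide)]; exact hs.mem_lt
  have ht : σ.v 16 * (Y.D + 1) = t := by
    have := hs.node
    rwa [h15, ← h16, add_zero] at this
  have an := exec_analyzeCmd h hs (by rw [h16]; exact hs.state_lt)
  rw [ht] at an
  have a1 := agree_analyzeCmd (σ := σ)
  rw [saturateCmd, Cmd.exec_seq, Cmd.exec_seq]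
  generalize analyzeCmd.exec σ = σ1 at *
  have h1 := h.of_agree a1 (by decide)
  have s1 := hs.of_agree a1 (by decide)
  have f7 := exec_fill_ne_zero (a := 7) (x := 30) (y := 4) (e := betweenE (Exp.var 30)) (σ := σ1)
    (P := Y.Between (Y.writable R) t t) (by
      intro m hm τ hA hτ
      rw [h1.D1] at hm
      rw [eval_betweenE (h1.of_agree hA (by decide)) (an.of_agree hA (by decide)) (by decide)
        (by rw [hτ]; exact hm), hτ])
  have a2 : Agree [30] [7] σ1 ((fill 7 30 4 (betweenE (Exp.var 30))).exec σ1) :=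
    Agree.of_exec (by decide)
  generalize (fill 7 30 4 _).exec σ1 = σ2 at *
  rw [h1.D1] at f7
  have h2 := h1.of_agree a2 (by decide)
  rw [exec_spreadCmd h2 f7 (an.of_agree a2 (by decide)).values, (s1.of_agree a2 (by decide)).conts,
    AbsSys.saturate]

/-- Executes the request in the entry of the guide (array `1`) given by the variable `23`. Its two parts
are looked up in the tables, as there is no division. -/
def requestCmd : Cmd :=
  Cmd.seq (Cmd.set 16 (Exp.get 9 (Exp.get 1 (Exp.var 23))))
  (Cmd.seq (Cmd.set 17 (Exp.get 10 (Exp.get 1 (Exp.var 23))))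
  (Cmd.seq analyzeCmd
  (Cmd.ite (betweenE (Exp.var 17))
    (Cmd.seq (fill 7 30 4 (Exp.eq (Exp.var 30) (Exp.var 17)))
    (Cmd.seq spreadCmd
    (Cmd.seq (Cmd.set 14 (Exp.var 16))
    (Cmd.seq (Cmd.set 15 (Exp.const 0))
    (Cmd.loop 24 4 saturateCmd)))))
    Cmd.skip)))

theorem agree_requestCmd :
    Agree [14, 15, 16, 17, 18, 24, 25, 26, 27, 28, 30] [2, 3, 4, 5, 6, 7, 8] σ (requestCmd.exec σ) :=
  Agree.of_exec (by decide)

theorem Holds.setV {s : ℕ × Set ℕ} (h : Holds Y σ s) {x n : ℕ} (hx : x ≠ 14) (hx' : x ≠ 15) :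
    Holds Y (σ.setV x n) s :=
  h.of_agree (xs := [x]) (as := []) (Agree.refl.setV (by simp) n) (by simp [hx, hx'])

theorem exec_requestCmd (h : Ready Y U σ) {s : ℕ × Set ℕ} (hs : Holds Y σ s)
    (hg : σ.a 1 (σ.v 23) < Y.L * (Y.D + 1)) :
    Holds Y (requestCmd.exec σ) (Y.guidedStep s (σ.a 1 (σ.v 23))) := by
  classical
  generalize hgg : σ.a 1 (σ.v 23) = g at *
  have hmod : g % (Y.D + 1) < Y.D + 1 := Nat.mod_lt _ (Nat.succ_pos _)
  set σ1 := (σ.setV 16 (g / (Y.D + 1))).setV 17 (g % (Y.D + 1)) with hσ1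
  have h1 : Ready Y U σ1 := (h.setV (by decide)).setV (by decide)
  have s1 : Holds Y σ1 s := (hs.setV (by decide) (by decide)).setV (by decide) (by decide)
  have e16 : σ1.v 16 = g / (Y.D + 1) := by simp [hσ1, St.setV_v]
  have e17 : σ1.v 17 = g % (Y.D + 1) := by simp [hσ1]
  have hexec : requestCmd.exec σ = (Cmd.seq analyzeCmd
      (Cmd.ite (betweenE (Exp.var 17))
        (Cmd.seq (fill 7 30 4 (Exp.eq (Exp.var 30) (Exp.var 17)))
        (Cmd.seq spreadCmd
        (Cmd.seq (Cmd.set 14 (Exp.var 16))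
        (Cmd.seq (Cmd.set 15 (Exp.const 0))
        (Cmd.loop 24 4 saturateCmd)))))
        Cmd.skip)).exec σ1 := by
    rw [requestCmd, Cmd.exec_seq, Cmd.exec_seq, Cmd.exec_set, Cmd.exec_set]
    simp only [Exp.eval_get, Exp.eval_var, St.setV_a, St.setV_of_ne _ _ (show 23 ≠ 16 by decide), hgg,
      h.nodeState g hg, h.nodeMem g hg]
    rfl
  rw [hexec, Cmd.exec_seq]
  clear_value σ1
  have an := exec_analyzeCmd h1 s1 (by rw [e16]; exact lt_nodes_iff.1 hg)
  rw [e16] at an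
  have a1 := agree_analyzeCmd (σ := σ1)
  generalize analyzeCmd.exec σ1 = σ2 at *
  have h2 := h1.of_agree a1 (by decide)
  have s2 := s1.of_agree a1 (by decide)
  have e16 := (a1.v 16 (by decide)).trans e16
  have e17 := (a1.v 17 (by decide)).trans e17
  have hb := eval_betweenE h2 an (x := 17) (by decide) (by rw [e17]; exact hmod)
  rw [e17] at hb
  rw [Cmd.exec_ite, AbsSys.guidedStep]
  change _ ↔ Y.Between (Y.writable s.2) s.1 (Y.drop g) (g % (Y.D + 1)) at hb
  by_cases hB : Y.Between (Y.writable s.2) s.1 (Y.drop g) (g % (Y.D + 1))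
  · rw [if_pos (hb.2 hB), if_pos hB]
    rw [Cmd.exec_seq, Cmd.exec_seq, Cmd.exec_seq, Cmd.exec_seq]
    have f7 := exec_fill_ne_zero (a := 7) (x := 30) (y := 4) (e := Exp.eq (Exp.var 30) (Exp.var 17))
      (σ := σ2) (P := (· = g % (Y.D + 1))) (by
        intro m _ τ hA hτ
        rw [eval_eq_ne_zero, Exp.eval_var, Exp.eval_var, hτ, hA.v 17 (by decide), e17])
    have a2 : Agree [30] [7] σ2 ((fill 7 30 4 (Exp.eq (Exp.var 30) (Exp.var 17))).exec σ2) :=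
      Agree.of_exec (by decide)
    generalize (fill 7 30 4 _).exec σ2 = σ3 at *
    rw [h2.D1] at f7
    have h3 := h2.of_agree a2 (by decide)
    have c3 := exec_spreadCmd h3 f7 (an.of_agree a2 (by decide)).values
    rw [(s2.of_agree a2 (by decide)).conts] at c3
    have a3 := agree_spreadCmd (σ := σ3)
    generalize spreadCmd.exec σ3 = σ4 at *
    have h4 := h3.of_agree a3 (by decide)
    have e16 := ((a3.v 16 (by decide)).trans (a2.v 16 (by decide))).trans e16
    rw [Cmd.exec_set, Cmd.exec_set, Exp.eval_var, e16, Exp.eval_const]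
    have h5 : Ready Y U ((σ4.setV 14 (g / (Y.D + 1))).setV 15 0) :=
      (h4.setV (by decide)).setV (by decide)
    set σ5 := (σ4.setV 14 (g / (Y.D + 1))).setV 15 0 with hσ5
    have e5 : σ5.v 14 = g / (Y.D + 1) ∧ σ5.v 15 = 0 ∧ σ5.v 16 = g / (Y.D + 1) := by
      simp [hσ5, St.setV_v, e16]
    have s5 : Holds Y σ5 (Y.drop g, Y.closure (Y.Enabled (· = g % (Y.D + 1)) (Y.writable s.2)) s.2) := by
      refine ⟨?_, ?_, ?_, ?_⟩
      · rw [e5.1, e5.2.1]; rfl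
      · rw [e5.1]; exact lt_nodes_iff.1 hg
      · rw [e5.2.1]; exact Nat.succ_pos _
      · exact c3
    have := Cmd.exec_loop_induction (x := 24) (y := 4) (e := saturateCmd) (σ := σ5)
      (fun k τ => Ready Y U τ ∧ τ.v 15 = 0 ∧ τ.v 16 = τ.v 14 ∧ Holds Y τ (Y.drop g,
        (Y.saturate (Y.drop g))^[k] (Y.closure (Y.Enabled (· = g % (Y.D + 1)) (Y.writable s.2)) s.2)))
      ⟨h5, e5.2.1, by rw [e5.1, e5.2.2], s5⟩ (by
        rintro k - τ ⟨hr, h15, h16, hh⟩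
        have hr' : Ready Y U (τ.setV 24 k) := hr.setV (by decide)
        have h15' : (τ.setV 24 k).v 15 = 0 := h15
        have h16' : (τ.setV 24 k).v 16 = (τ.setV 24 k).v 14 := h16
        have a := agree_saturateCmd (σ := τ.setV 24 k)
        refine ⟨hr'.of_agree a (by decide), ?_, ?_, ?_⟩
        · rw [a.v 15 (by decide), h15']
        · rw [a.v 14 (by decide), a.v 16 (by decide), h16']
        · rw [Function.iterate_succ_apply']
          exact exec_saturateCmd hr' (hh.setV (by decide) (by decide)) h15' h16')
    rw [h5.D1] at this
    exact this.2.2.2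
  · rw [if_neg (fun h => hB (hb.1 h)), if_neg hB]
    exact s2

/-- Simulates the guide in array `1`. The minimum with `D + 1` does not change the value; it makes the
assignment one whose value is visibly small. -/
def guideCmd : Cmd :=
  Cmd.seq (fill 2 26 6 (Exp.eq (Exp.var 26) (Exp.var 10)))
  (Cmd.seq (Cmd.set 14 (Exp.var 9))
  (Cmd.seq (Cmd.set 15 (Exp.min (Exp.var 8 + Exp.const 1) (Exp.var 4)))
  (Cmd.loop 23 2 requestCmd)))

theorem agree_guideCmd : Agree [14, 15, 16, 17, 18, 23, 24, 25, 26, 27, 28, 30] [2, 3, 4, 5, 6, 7, 8] σ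
    (guideCmd.exec σ) :=
  Agree.of_exec (by decide)

theorem exec_guideCmd (h : Ready Y U σ) (hg : ∀ i < Y.L + 1, σ.a 1 i < Y.L * (Y.D + 1)) :
    Holds Y (guideCmd.exec σ) (Y.simulate ((List.range (Y.L + 1)).map (σ.a 1))) := by
  rw [guideCmd, Cmd.exec_seq, Cmd.exec_seq, Cmd.exec_seq]
  have f2 := exec_fill_ne_zero (a := 2) (x := 26) (y := 6) (e := Exp.eq (Exp.var 26) (Exp.var 10))
    (σ := σ) (P := (· = Y.cont0)) (by
      intro p _ τ hA hτ
      rw [eval_eq_ne_zero, Exp.eval_var, Exp.eval_var, hτ, (h.of_agree hA (by decide)).cont0])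
  have a1 : Agree [26] [2] σ ((fill 2 26 6 (Exp.eq (Exp.var 26) (Exp.var 10))).exec σ) :=
    Agree.of_exec (by decide)
  generalize (fill 2 26 6 _).exec σ = σ1 at *
  rw [h.C] at f2
  have h1 := h.of_agree a1 (by decide)
  have hc : contSet Y σ1 = {Y.cont0} := by
    ext p
    constructor
    · rintro ⟨hp, hp2⟩; exact (f2 p hp).1 hp2
    · rintro rfl; exact ⟨Y.cont0_lt, (f2 _ Y.cont0_lt).2 rfl⟩
  have h2 : Ready Y U (σ1.setV 14 Y.lead0) := h1.setV (by decide)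
  have h3 : Ready Y U ((σ1.setV 14 Y.lead0).setV 15 (Y.mem0 + 1)) := h2.setV (by decide)
  have hmin : Min.min (Y.mem0 + 1) (Y.D + 1) = Y.mem0 + 1 := by have := Y.mem0_lt; omega
  rw [Cmd.exec_set, Cmd.exec_set, Exp.eval_var 9, h1.lead0, Exp.eval_min, Exp.eval_add, Exp.eval_const,
    Exp.eval_var, Exp.eval_var, h2.mem0, h2.D1, hmin]
  have s3 : Holds Y ((σ1.setV 14 Y.lead0).setV 15 (Y.mem0 + 1)) (Y.node0, {Y.cont0}) := by
    refine ⟨?_, ?_, ?_, hc⟩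
    · simp [St.setV_v, AbsSys.node0]
    · simpa [St.setV_v] using Y.lead0_lt
    · simpa [St.setV_v] using Y.mem0_lt
  have e1 : ((σ1.setV 14 Y.lead0).setV 15 (Y.mem0 + 1)).a 1 = σ.a 1 := a1.a 1 (by decide)
  generalize (σ1.setV 14 Y.lead0).setV 15 (Y.mem0 + 1) = σ3 at *
  have := Cmd.exec_loop_induction (x := 23) (y := 2) (e := requestCmd) (σ := σ3)
    (fun k τ => Ready Y U τ ∧ τ.a 1 = σ.a 1 ∧ Holds Y τ (Y.simulate ((List.range k).map (σ.a 1))))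
    ⟨h3, e1, s3⟩ (by
      rintro k hk τ ⟨hr, h1, hh⟩
      rw [h3.L1] at hk
      have a := agree_requestCmd (σ := τ.setV 23 k)
      have hr' : Ready Y U (τ.setV 23 k) := hr.setV (by decide)
      have e1 : (τ.setV 23 k).a 1 = σ.a 1 := h1
      refine ⟨hr'.of_agree a (by decide), (a.a 1 (by decide)).trans h1, ?_⟩
      have := exec_requestCmd hr' (hh.setV (by decide) (by decide)) (by
        rw [e1, St.setV_self]; exact hg k hk)
      rw [e1, St.setV_self] at this
      rwa [List.range_succ, List.map_append, AbsSys.simulate, List.foldl_append, List.map_singleton,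
        List.foldl_cons, List.foldl_nil, ← AbsSys.simulate])
  rw [h3.L1] at this
  exact this.2.2

end Loop

/-! ### Enumerating the guides -/

namespace Loop

variable {Y : AbsSys} {U : ℕ → Prop} {σ τ : St}

/-- Computes the tables of the two parts of each node. -/
def tableCmd : Cmd :=
  Cmd.loop 28 1 (Cmd.loop 27 4 (Cmd.seq
    (Cmd.put 9 (Exp.var 28 * Exp.var 4 + Exp.var 27) (Exp.var 28))
    (Cmd.put 10 (Exp.var 28 * Exp.var 4 + Exp.var 27) (Exp.var 27))))

theorem agree_tableCmd : Agree [27, 28] [9, 10] σ (tableCmd.exec σ) := Agree.of_exec (by decide)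

theorem exec_tableCmd (h : Loaded Y U σ) : Ready Y U (tableCmd.exec σ) := by
  suffices ht : ∀ q < Y.L, ∀ m < Y.D + 1, (tableCmd.exec σ).a 9 (q * (Y.D + 1) + m) = q ∧
      (tableCmd.exec σ).a 10 (q * (Y.D + 1) + m) = m by
    have hm : ∀ i, i % (Y.D + 1) < Y.D + 1 := fun i => Nat.mod_lt _ (Nat.succ_pos _)
    refine ⟨h.of_agree agree_tableCmd (by decide), fun i hi => ?_, fun i hi => ?_⟩
    · have := (ht _ (lt_nodes_iff.1 hi) _ (hm i)).1
      rwa [AbsSys.div_mul_add_mod_succ] at this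
    · have := (ht _ (lt_nodes_iff.1 hi) _ (hm i)).2
      rwa [AbsSys.div_mul_add_mod_succ] at this
  have outer := Cmd.exec_loop_induction (x := 28) (y := 1) (e := Cmd.loop 27 4 (Cmd.seq
    (Cmd.put 9 (Exp.var 28 * Exp.var 4 + Exp.var 27) (Exp.var 28))
    (Cmd.put 10 (Exp.var 28 * Exp.var 4 + Exp.var 27) (Exp.var 27)))) (σ := σ)
    (fun k τ => Loaded Y U τ ∧ ∀ q < k, ∀ m < Y.D + 1, τ.a 9 (q * (Y.D + 1) + m) = q ∧
      τ.a 10 (q * (Y.D + 1) + m) = m) ⟨h, by simp⟩ (by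
    rintro k - τ ⟨hl, ht⟩
    have hl1 : Loaded Y U (τ.setV 28 k) := hl.of_agree (Agree.refl.setV (xs := [28]) (as := [])
      (by simp) k) (by decide)
    have inner := Cmd.exec_loop_induction (x := 27) (y := 4) (e := Cmd.seq
      (Cmd.put 9 (Exp.var 28 * Exp.var 4 + Exp.var 27) (Exp.var 28))
      (Cmd.put 10 (Exp.var 28 * Exp.var 4 + Exp.var 27) (Exp.var 27))) (σ := τ.setV 28 k)
      (fun j τ' => Loaded Y U τ' ∧ τ'.v 28 = k ∧ ∀ q m, m < Y.D + 1 → (q < k ∨ q = k ∧ m < j) →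
        τ'.a 9 (q * (Y.D + 1) + m) = q ∧ τ'.a 10 (q * (Y.D + 1) + m) = m)
      ⟨hl1, by simp, fun q m hm hq => ht q (by omega) m hm⟩ (by
      rintro j hj τ' ⟨hl', h28, ht'⟩
      rw [hl1.D1] at hj
      have h28' : (τ'.setV 27 j).v 28 = k := (St.setV_of_ne _ _ (by decide)).trans h28
      have h4' : (τ'.setV 27 j).v 4 = Y.D + 1 := (St.setV_of_ne _ _ (by decide)).trans hl'.D1
      simp only [Cmd.exec_seq, Cmd.exec_put, Exp.eval_var, Exp.eval_add, Exp.eval_mul, St.setA_v,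
        h28', h4', St.setV_self]
      refine ⟨hl'.of_agree (xs := [27]) (as := [9, 10]) (((Agree.refl.setV (by simp) _).setA
        (by simp) _ _).setA (by simp) _ _) (by decide), trivial, fun q m hm hq => ?_⟩
      rw [St.setA_of_ne _ _ _ (show 9 ≠ 10 by decide), St.setA_self, St.setA_self, St.setV_a,
        St.setA_of_ne _ _ _ (show 10 ≠ 9 by decide), St.setV_a, Function.update_apply,
        Function.update_apply]
      split_ifs with heq
      · have hq' := congrArg (· / (Y.D + 1)) heq
        have hm' := congrArg (· % (Y.D + 1)) heq
        simp only [AbsSys.mul_add_div_succ hm, AbsSys.mul_add_div_succ hj] at hq'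
        simp only [AbsSys.mul_add_mod_succ hm, AbsSys.mul_add_mod_succ hj] at hm'
        exact ⟨hq'.symm, hm'.symm⟩
      · refine ht' q m hm (hq.imp id fun h => ⟨h.1, ?_⟩)
        have : m ≠ j := by rintro rfl; exact heq (by rw [h.1])
        omega)
    rw [hl1.D1] at inner
    exact ⟨inner.1, fun q hq m hm => inner.2.2 q m hm (by omega)⟩)
  rw [h.L] at outer
  exact outer.2

/-- Increments the number with the digits in array `1`, to the base in variable `7`, the lowest digit
first. Variable `21` holds the carry, which is left if the number was the last one with `L + 1` digits. -/
def nextCmd : Cmd :=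
  Cmd.seq (Cmd.set 21 (Exp.const 1)) (Cmd.loop 22 2 (Cmd.ite (Exp.var 21)
    (Cmd.ite (Exp.eq (Exp.get 1 (Exp.var 22) + Exp.const 1) (Exp.var 7))
      (Cmd.put 1 (Exp.var 22) (Exp.const 0))
      (Cmd.seq (Cmd.put 1 (Exp.var 22) (Exp.min (Exp.get 1 (Exp.var 22) + Exp.const 1) (Exp.var 7)))
        (Cmd.set 21 (Exp.const 0))))
    Cmd.skip))

theorem exec_nextCmd {n k N : ℕ} (hn : σ.v 2 = n) (hN : σ.v 7 = N) (hN0 : 0 < N)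
    (hk : ∀ i < n, σ.a 1 i = k / N ^ i % N) :
    (∀ i < n, (nextCmd.exec σ).a 1 i = (k + 1) / N ^ i % N) ∧
      ((nextCmd.exec σ).v 21 ≠ 0 ↔ N ^ n ∣ k + 1) := by
  have := Cmd.exec_loop_induction (x := 22) (y := 2) (e := (Cmd.ite (Exp.var 21)
    (Cmd.ite (Exp.eq (Exp.get 1 (Exp.var 22) + Exp.const 1) (Exp.var 7))
      (Cmd.put 1 (Exp.var 22) (Exp.const 0))
      (Cmd.seq (Cmd.put 1 (Exp.var 22) (Exp.min (Exp.get 1 (Exp.var 22) + Exp.const 1) (Exp.var 7)))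
        (Cmd.set 21 (Exp.const 0))))
    Cmd.skip)) (σ := σ.setV 21 1)
    (fun j τ => τ.v 7 = N ∧ (τ.v 21 ≠ 0 ↔ N ^ j ∣ k + 1) ∧ (∀ i < j, τ.a 1 i = (k + 1) / N ^ i % N) ∧
      ∀ i, j ≤ i → i < n → τ.a 1 i = k / N ^ i % N)
    ⟨hN, by simp, by simp, fun i _ hi => hk i hi⟩ (by
      rintro j hj τ ⟨h7, h21, hlo, hhi⟩
      have hj : j < n := by rwa [← hn]
      have hpos : 0 < N ^ j := Nat.pow_pos hN0
      have hd := Nat.succ_div (a := k) (b := N ^ j)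
      have hgj := hhi j le_rfl hj
      have hlt : k / N ^ j % N < N := Nat.mod_lt _ hN0
      have hsd : N ^ (j + 1) ∣ k + 1 ↔ N ^ j ∣ k + 1 ∧ N ∣ (k + 1) / N ^ j := by
        rw [pow_succ]
        constructor
        · intro h
          have h1 : N ^ j ∣ k + 1 := (Dvd.intro _ rfl).trans h
          exact ⟨h1, (Nat.dvd_div_iff_mul_dvd h1).2 h⟩
        · rintro ⟨h1, h2⟩
          exact (Nat.dvd_div_iff_mul_dvd h1).1 h2
      have hmod : (k / N ^ j + 1) % N = if k / N ^ j % N + 1 = N then 0 else k / N ^ j % N + 1 := by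
        rw [Nat.add_mod]
        split_ifs with h
        · by_cases h1 : N = 1
          · subst h1; simp [Nat.mod_one]
          · rw [Nat.mod_eq_of_lt (show 1 < N by omega), h, Nat.mod_self]
        · by_cases h1 : N = 1
          · subst h1; simp [Nat.mod_one] at h
          · rw [Nat.mod_eq_of_lt (show 1 < N by omega), Nat.mod_eq_of_lt (by omega)]
      simp only [Cmd.exec_ite, Cmd.exec_put, Cmd.exec_seq, Cmd.exec_set, Cmd.exec_skip, Exp.eval_var,
        Exp.eval_add, Exp.eval_const, Exp.eval_get, St.setV_self, St.setV_a, hgj, Exp.eval_min,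
        St.setV_of_ne _ _ (show 21 ≠ 22 by decide), St.setV_of_ne _ _ (show 7 ≠ 22 by decide), h7,
        eval_eq_ne_zero]
      by_cases hc : τ.v 21 ≠ 0
      · have hdiv := h21.1 hc
        rw [if_pos hdiv] at hd
        rw [if_pos hc]
        have hdd : N ^ (j + 1) ∣ k + 1 ↔ k / N ^ j % N + 1 = N := by
          rw [hsd, Nat.dvd_iff_mod_eq_zero (n := (k + 1) / N ^ j), hd, hmod]
          split_ifs with h <;> simp [h, hdiv]
        rw [← hd] at hmod
        split_ifs with h
        · refine ⟨by simp [St.setV_v, h7], ?_, ?_, ?_⟩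
          · simp [St.setV_v, hc, hdd, h]
          · intro i hi
            simp only [St.setA_self, Function.update_apply, St.setV_a]
            split_ifs with hij
            · rw [hij, hmod, if_pos h]
            · exact hlo i (by omega)
          · intro i hi hin
            simp only [St.setA_self, Function.update_apply, St.setV_a]
            rw [if_neg (by omega)]
            exact hhi i (by omega) hin
        · refine ⟨by simp [St.setV_v, h7], ?_, ?_, ?_⟩
          · simp [hdd, h]
          · intro i hi
            simp only [St.setA_self, Function.update_apply, St.setV_a]
            split_ifs with hij
            · rw [hij, hmod, if_neg h]; omega
            · exact hlo i (by omega)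
          · intro i hi hin
            simp only [St.setA_self, Function.update_apply, St.setV_a]
            rw [if_neg (by omega)]
            exact hhi i (by omega) hin
      · have hdiv : ¬ N ^ j ∣ k + 1 := fun h => hc (h21.2 h)
        rw [if_neg hdiv, add_zero] at hd
        rw [if_neg hc]
        refine ⟨by simp [St.setV_v, h7], ?_, ?_, ?_⟩
        · rw [St.setV_of_ne _ _ (by decide), hsd]; simp [hc, hdiv]
        · intro i hi
          by_cases hij : i = j
          · rw [hij, hd]; exact hgj
          · exact hlo i (by omega)
        · intro i hi hin; exact hhi i (by omega) hin)
  rw [show (σ.setV 21 1).v 2 = n from hn] at this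
  exact ⟨this.2.2.1, this.2.1⟩

/-- One round of the main loop: checks a guide, and passes to the next one. Variable `20` records
whether a guide has been accepted, and variable `19` whether there are further guides. The tables are
computed anew in each round, which is cheap in comparison. -/
def roundCmd : Cmd :=
  Cmd.seq tableCmd (Cmd.seq guideCmd
    (Cmd.seq (Cmd.ite (Exp.get 0 (Exp.var 13 + Exp.var 14)) (Cmd.set 20 (Exp.const 1)) Cmd.skip)
    (Cmd.seq nextCmd (Cmd.ite (Exp.var 21) (Cmd.set 19 (Exp.const 0)) Cmd.skip))))

/-- The guide with number `k`. -/
def guide (Y : AbsSys) (k : ℕ) : List ℕ :=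
  (List.range (Y.L + 1)).map fun i => k / (Y.L * (Y.D + 1)) ^ i % (Y.L * (Y.D + 1))

theorem agree_nextCmd : Agree [21, 22] [1] σ (nextCmd.exec σ) := Agree.of_exec (by decide)

theorem agree_roundCmd : Agree [14, 15, 16, 17, 18, 19, 20, 21, 22, 23, 24, 25, 26, 27, 28, 30]
    [1, 2, 3, 4, 5, 6, 7, 8, 9, 10] σ (roundCmd.exec σ) := Agree.of_exec (by decide)

theorem exec_roundCmd (h : Loaded Y U σ) {k : ℕ} (hk : k < (Y.L * (Y.D + 1)) ^ (Y.L + 1))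
    (hg : ∀ i < Y.L + 1, σ.a 1 i = k / (Y.L * (Y.D + 1)) ^ i % (Y.L * (Y.D + 1)))
    (h19 : σ.v 19 ≠ 0) :
    (∀ i < Y.L + 1, (roundCmd.exec σ).a 1 i =
      (k + 1) / (Y.L * (Y.D + 1)) ^ i % (Y.L * (Y.D + 1))) ∧
    ((roundCmd.exec σ).v 20 ≠ 0 ↔ σ.v 20 ≠ 0 ∨ U ((Y.simulate (guide Y k)).1 / (Y.D + 1))) ∧
    ((roundCmd.exec σ).v 19 ≠ 0 ↔ k + 1 < (Y.L * (Y.D + 1)) ^ (Y.L + 1)) := by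
  have hN : 0 < Y.L * (Y.D + 1) := Nat.mul_pos (by have := Y.lead0_lt; omega) (Nat.succ_pos _)
  rw [roundCmd, Cmd.exec_seq, Cmd.exec_seq, Cmd.exec_seq, Cmd.exec_seq]
  have a1 := agree_tableCmd (σ := σ)
  have h1 := exec_tableCmd h
  generalize tableCmd.exec σ = σ1 at *
  have e1 := a1.a 1 (by decide)
  have gd := exec_guideCmd h1 (by
    intro i hi
    rw [e1, hg i hi]
    exact Nat.mod_lt _ hN)
  have hgd : (List.range (Y.L + 1)).map (σ1.a 1) = guide Y k := by
    refine List.map_congr_left fun i hi => ?_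
    rw [e1, hg i (List.mem_range.1 hi)]
  rw [hgd] at gd
  have a2 := agree_guideCmd (σ := σ1)
  generalize guideCmd.exec σ1 = σ2 at *
  have h2 := h1.of_agree a2 (by decide)
  have e20 : σ2.v 20 = σ.v 20 := (a2.v 20 (by decide)).trans (a1.v 20 (by decide))
  have e19 : σ2.v 19 = σ.v 19 := (a2.v 19 (by decide)).trans (a1.v 19 (by decide))
  have e1 : σ2.a 1 = σ.a 1 := (a2.a 1 (by decide)).trans e1
  -- the test for acceptance
  have acc : ((Cmd.ite (Exp.get 0 (Exp.var 13 + Exp.var 14)) (Cmd.set 20 (Exp.const 1)) Cmd.skip).exec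
      σ2).v 20 ≠ 0 ↔ σ.v 20 ≠ 0 ∨ U ((Y.simulate (guide Y k)).1 / (Y.D + 1)) := by
    have hu := h2.unsafe_iff _ gd.state_lt
    have hdiv : (Y.simulate (guide Y k)).1 / (Y.D + 1) = σ2.v 14 := by
      rw [← gd.node, AbsSys.mul_add_div_succ gd.mem_lt]
    rw [hdiv, ← hu, Cmd.exec_ite, Exp.eval_get, Exp.eval_add, Exp.eval_var, Exp.eval_var]
    split_ifs with hc
    · simp [Cmd.exec_set, hc]
    · simp only [ne_eq, not_not] at hc
      simp [e20, hc]
  have a3 : Agree [20] [] σ2 ((Cmd.ite (Exp.get 0 (Exp.var 13 + Exp.var 14)) (Cmd.set 20 (Exp.const 1))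
    Cmd.skip).exec σ2) := Agree.of_exec (by decide)
  generalize (Cmd.ite (Exp.get 0 (Exp.var 13 + Exp.var 14)) _ _).exec σ2 = σ3 at *
  have h3 := h2.of_agree a3 (by decide)
  have e19 : σ3.v 19 = σ.v 19 := (a3.v 19 (by decide)).trans e19
  obtain ⟨n1, n2⟩ := exec_nextCmd (k := k) h3.L1 h3.N hN (by
    intro i hi; rw [a3.a 1 (by decide), e1]; exact hg i hi)
  have a4 := agree_nextCmd (σ := σ3)
  generalize nextCmd.exec σ3 = σ4 at *
  have e19 : σ4.v 19 = σ.v 19 := (a4.v 19 (by decide)).trans e19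
  have a5 : Agree [19] [] σ4 ((Cmd.ite (Exp.var 21) (Cmd.set 19 (Exp.const 0)) Cmd.skip).exec σ4) :=
    Agree.of_exec (by decide)
  refine ⟨fun i hi => by rw [a5.a 1 (by decide)]; exact n1 i hi,
    by rw [a5.v 20 (by decide), a4.v 20 (by decide)]; exact acc, ?_⟩
  have hdvd : (Y.L * (Y.D + 1)) ^ (Y.L + 1) ∣ k + 1 ↔ ¬ k + 1 < (Y.L * (Y.D + 1)) ^ (Y.L + 1) := by
    constructor
    · exact fun hd => not_lt.2 (Nat.le_of_dvd (Nat.succ_pos _) hd)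
    · intro hn
      rw [show k + 1 = (Y.L * (Y.D + 1)) ^ (Y.L + 1) by omega]
  rw [Cmd.exec_ite, Exp.eval_var, ← not_iff_not, ← hdvd, ← n2]
  split_ifs with hc
  · simp [Cmd.exec_set, hc]
  · simp only [ne_eq, not_not] at hc
    simp [e19, h19, hc]

/-- Every sequence of digits occurs among the numbers below the power of the base. -/
theorem exists_digits {N : ℕ} (gs : List ℕ) (hg : ∀ g ∈ gs, g < N) :
    ∃ k < N ^ gs.length, ∀ i (hi : i < gs.length), k / N ^ i % N = gs[i] := by
  induction gs with
  | nil => exact ⟨0, by simp, by simp⟩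
  | cons g gs ih =>
    obtain ⟨k, hk, hd⟩ := ih fun g hg' => hg g (List.mem_cons_of_mem _ hg')
    have hgN := hg g List.mem_cons_self
    refine ⟨N * k + g, ?_, ?_⟩
    · have : N * (k + 1) ≤ N * N ^ gs.length := Nat.mul_le_mul_left _ hk
      rw [List.length_cons, pow_succ, mul_comm (N ^ _)]
      rw [mul_add] at this
      omega
    · rintro (_ | i) hi
      · simp [Nat.mod_eq_of_lt hgN]
      · rw [pow_succ', ← Nat.div_div_eq_div_mul, Nat.mul_add_div (by omega), Nat.div_eq_of_lt hgN,
          add_zero, List.getElem_cons_succ]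
        exact hd i (by simpa using hi)

/-- The guides are exactly the digit expansions of the numbers that the main loop runs through. -/
theorem exists_guide_iff {P : List ℕ → Prop} :
    (∃ gs : List ℕ, gs.length = Y.L + 1 ∧ (∀ g ∈ gs, g < Y.L * (Y.D + 1)) ∧ P gs) ↔
      ∃ k < (Y.L * (Y.D + 1)) ^ (Y.L + 1), P (guide Y k) := by
  have hN : 0 < Y.L * (Y.D + 1) := Nat.mul_pos (by have := Y.lead0_lt; omega) (Nat.succ_pos _)
  constructor
  · rintro ⟨gs, hl, hg, hP⟩
    obtain ⟨k, hk, hd⟩ := exists_digits gs hg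
    refine ⟨k, hl ▸ hk, ?_⟩
    have : guide Y k = gs := by
      refine List.ext_getElem (by simp [guide, hl]) fun i h1 h2 => ?_
      rw [← hd i h2]
      simp [guide]
    rwa [this]
  · rintro ⟨k, -, hP⟩
    refine ⟨guide Y k, by simp [guide], ?_, hP⟩
    intro g hg
    obtain ⟨i, -, rfl⟩ := List.mem_map.1 hg
    exact Nat.mod_lt _ hN

end Loop

/-! ### The encoding of instances -/

theorem List.length_flatMap_of_length {α β : Type*} {f : α → List β} {m : ℕ} {l : List α}
    (h : ∀ a ∈ l, (f a).length = m) : (l.flatMap f).length = l.length * m := by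
  induction l with
  | nil => simp
  | cons a l ih =>
    rw [List.flatMap_cons, List.length_append, h a List.mem_cons_self,
      ih fun a ha => h a (List.mem_cons_of_mem _ ha), List.length_cons]
    ring

theorem List.getElem?_flatMap_of_length {α β : Type*} {f : α → List β} {m : ℕ} {l : List α}
    (h : ∀ a ∈ l, (f a).length = m) {i j : ℕ} {a : α} (hi : l[i]? = some a) (hj : j < m) :
    (l.flatMap f)[i * m + j]? = (f a)[j]? := by
  induction l generalizing i with
  | nil => simp at hi
  | cons b l ih =>
    have hb := h b List.mem_cons_self
    rw [List.flatMap_cons]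
    cases i with
    | zero =>
      obtain rfl : b = a := by simpa using hi
      rw [zero_mul, zero_add, List.getElem?_append_left (by omega)]
    | succ i =>
      rw [List.getElem?_append_right (by rw [hb]; nlinarith), hb,
        show (i + 1) * m + j - m = i * m + j by rw [add_mul]; omega]
      exact ih (fun a ha => h a (List.mem_cons_of_mem _ ha)) (by simpa using hi)

namespace LCRInstance

theorem length_labels (d : ℕ) : (labels d).length = 2 * d + 1 := by
  rw [labels, List.length_cons, List.length_flatMap_of_length (m := 2) (by simp), List.length_finRange]
  ring

theorem getElem?_labels {d : ℕ} (lab : Option (MemOp (Fin d))) :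
    (labels d)[labelIdx lab]? = some lab := by
  have key : ∀ (a : Fin d) (j : ℕ), j < 2 → (labels d)[2 * a.val + j + 1]? =
      [some (MemOp.write a), some (MemOp.read a)][j]? := by
    intro a j hj
    rw [labels, List.getElem?_cons_succ, mul_comm]
    exact List.getElem?_flatMap_of_length (m := 2) (by simp) (by simp) hj
  rcases lab with _ | a | a
  · rfl
  · exact key a 0 (by decide)
  · exact key a 1 (by decide)

theorem exists_labelIdx {d l : ℕ} (hl : l < 2 * d + 1) : ∃ lab : Option (MemOp (Fin d)), labelIdx lab = l := by
  rcases Nat.eq_zero_or_pos l with rfl | hpos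
  · exact ⟨none, rfl⟩
  · rcases Nat.even_or_odd' l with ⟨b, rfl | rfl⟩
    · exact ⟨some (MemOp.read ⟨b - 1, by omega⟩), by simp only [labelIdx]; omega⟩
    · exact ⟨some (MemOp.write ⟨b, by omega⟩), rfl⟩

theorem labelIdx_injective {d : ℕ} {lab lab' : Option (MemOp (Fin d))} (h : labelIdx lab = labelIdx lab') :
    lab = lab' := by
  have := getElem?_labels lab
  rw [h, getElem?_labels] at this
  exact (Option.some.inj this).symm

theorem numTrans_iff {d n : ℕ} (T : Thread (Fin d) (Fin n)) (q : Fin n) (lab : Option (MemOp (Fin d)))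
    (q' : Fin n) : numTrans T q (labelIdx lab) q' ↔ T.trans q lab q' := by
  constructor
  · rintro ⟨x, lab', y, hx, hl, hy, h⟩
    rwa [Fin.ext hx, labelIdx_injective hl, Fin.ext hy] at h
  · exact fun h => ⟨q, lab, q', rfl, rfl, rfl, h⟩

theorem length_transBits {d n : ℕ} (T : Thread (Fin d) (Fin n)) :
    (transBits T).length = n * ((2 * d + 1) * n) := by
  rw [transBits, List.length_flatMap_of_length (m := (2 * d + 1) * n), List.length_finRange]
  intro q _
  rw [List.length_flatMap_of_length (m := n) (by simp), length_labels]

open Classical in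
theorem getElem?_transBits {d n : ℕ} (T : Thread (Fin d) (Fin n)) {q l q' : ℕ} (hq : q < n)
    (hl : l < 2 * d + 1) (hq' : q' < n) :
    (transBits T)[(q * (2 * d + 1) + l) * n + q']? = some (decide (numTrans T q l q')) := by
  obtain ⟨lab, rfl⟩ := exists_labelIdx hl
  have h1 : ∀ q ∈ List.finRange n, ((labels d).flatMap fun l =>
      (List.finRange n).map fun q' => decide (T.trans q l q')).length = (2 * d + 1) * n := by
    intro q _
    rw [List.length_flatMap_of_length (m := n) (by simp), length_labels]
  have hlt : labelIdx lab * n + q' < (2 * d + 1) * n := by nlinarith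
  rw [transBits, show (q * (2 * d + 1) + labelIdx lab) * n + q' =
      q * ((2 * d + 1) * n) + (labelIdx lab * n + q') by ring,
    List.getElem?_flatMap_of_length h1 (a := ⟨q, hq⟩) (by simp [hq]) hlt,
    List.getElem?_flatMap_of_length (m := n) (by simp) (getElem?_labels lab) hq']
  have := numTrans_iff T ⟨q, hq⟩ lab ⟨q', hq'⟩
  simp only at this
  simp [hq', this]

/-- Every table of the right length is the table of a thread. -/
theorem exists_transBits {d n : ℕ} (q₀ : Fin n) {ys : List Bool}
    (hy : ys.length = n * ((2 * d + 1) * n)) :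
    ∃ T : Thread (Fin d) (Fin n), T.init = q₀ ∧ transBits T = ys := by
  classical
  refine ⟨⟨q₀, fun q lab q' => ys[(q * (2 * d + 1) + labelIdx lab) * n + q']? = some true⟩, rfl, ?_⟩
  set T : Thread (Fin d) (Fin n) :=
    ⟨q₀, fun q lab q' => ys[(q * (2 * d + 1) + labelIdx lab) * n + q']? = some true⟩ with hT
  refine List.ext_getElem? fun i => ?_
  by_cases hi : i < n * ((2 * d + 1) * n)
  · have hn : 0 < n := q₀.pos
    have hq' : i % n < n := Nat.mod_lt _ hn
    have hl : i / n % (2 * d + 1) < 2 * d + 1 := Nat.mod_lt _ (Nat.succ_pos _)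
    have hq : i / n / (2 * d + 1) < n := by
      rw [Nat.div_div_eq_div_mul, Nat.div_lt_iff_lt_mul (by positivity), mul_comm n (2 * d + 1)]
      exact hi
    have hdec : (i / n / (2 * d + 1) * (2 * d + 1) + i / n % (2 * d + 1)) * n + i % n = i := by
      rw [mul_comm (i / n / (2 * d + 1)), Nat.div_add_mod, mul_comm, Nat.div_add_mod]
    obtain ⟨lab, hlab⟩ := exists_labelIdx hl
    have h1 := getElem?_transBits T hq hl hq'
    rw [hdec] at h1
    rw [h1, List.getElem?_eq_getElem (by omega)]
    have h2 := numTrans_iff T ⟨_, hq⟩ lab ⟨_, hq'⟩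
    rw [hlab] at h2
    simp only [hT] at h2
    rw [hlab, hdec, List.getElem?_eq_getElem (by omega), Option.some.injEq] at h2
    congr 1
    rw [Bool.eq_iff_iff, decide_eq_true_iff]
    exact h2
  · rw [List.getElem?_eq_none (by rw [length_transBits]; omega), List.getElem?_eq_none (by omega)]

theorem length_unary (n : ℕ) : (unary n).length = n + 1 := by simp [unary]

theorem length_encode (I : LCRInstance) : I.encode.length =
    I.L + 1 + (I.D + 1) + (I.C + 1) + (I.init + 1) + (I.leader.init + 1) + (I.contributor.init + 1) +
      I.L * ((2 * I.D + 1) * I.L) + I.C * ((2 * I.D + 1) * I.C) + I.L := by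
  simp only [encode, List.length_append, length_unary, length_transBits, List.length_map,
    List.length_finRange]

/-- Every word of the right length, after six unary numbers with the right inequalities, completes an
encoding. -/
theorem exists_encode {L D C i q p : ℕ} (hi : i < D) (hq : q < L) (hp : p < C) {ys : List Bool}
    (hy : ys.length = L * ((2 * D + 1) * L) + C * ((2 * D + 1) * C) + L) :
    ∃ I : LCRInstance, I.L = L ∧ I.D = D ∧ I.C = C ∧ I.encode =
      unary L ++ (unary D ++ (unary C ++ (unary i ++ (unary q ++ (unary p ++ ys))))) := by
  obtain ⟨T₁, h1, e1⟩ := exists_transBits (d := D) (⟨q, hq⟩ : Fin L) (ys := ys.take (L * ((2 * D + 1) * L)))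
    (by rw [List.length_take]; omega)
  obtain ⟨T₂, h2, e2⟩ := exists_transBits (d := D) (⟨p, hp⟩ : Fin C)
    (ys := (ys.drop (L * ((2 * D + 1) * L))).take (C * ((2 * D + 1) * C)))
    (by rw [List.length_take, List.length_drop]; omega)
  refine ⟨⟨L, D, C, ⟨i, hi⟩, T₁, T₂,
    {s | ys[L * ((2 * D + 1) * L) + C * ((2 * D + 1) * C) + s.val]? = some true}⟩, rfl, rfl, rfl, ?_⟩
  simp only [encode, h1, h2, e1, e2, List.append_assoc]
  congr 6
  conv_rhs => rw [← List.take_append_drop (L * ((2 * D + 1) * L)) ys,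
    ← List.take_append_drop (C * ((2 * D + 1) * C)) (ys.drop (L * ((2 * D + 1) * L)))]
  congr 2
  refine List.ext_getElem (by simp; omega) fun s hs hs' => ?_
  rw [List.getElem_map, List.getElem_finRange, List.getElem_drop, List.getElem_drop]
  rw [Bool.eq_iff_iff]
  refine (@decide_eq_true_iff _ (_)).trans ?_
  change ys[L * ((2 * D + 1) * L) + C * ((2 * D + 1) * C) + s]? = some true ↔ _
  rw [List.getElem?_eq_getElem (by simp at hs; omega), Option.some.injEq]
  simp only [add_assoc]

end LCRInstance

/-! ### Reading the input -/

namespace Loop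
open LCRInstance

variable {σ τ : St}

/-- Reads a unary number, starting at the position in variable `24`, into variable `x`, and advances this
position. Variable `18` is given the position of the first zero; if there is none, it keeps the value of
variable `0`, which lies beyond the input, and the input will be found invalid. -/
def parseCmd (x : ℕ) : Cmd :=
  Cmd.seq (Cmd.set 18 (Exp.var 0))
  (Cmd.seq (Cmd.loop 22 0 (Cmd.ite (Exp.eq (Exp.var 18) (Exp.var 0) *
      (Exp.var 22 + Exp.const 1 - Exp.var 24) * Exp.eq (Exp.get 0 (Exp.var 22)) (Exp.const 0))
    (Cmd.set 18 (Exp.var 22)) Cmd.skip))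
  (Cmd.seq (Cmd.set x (Exp.var 18 - Exp.var 24))
    (Cmd.set 24 (Exp.min (Exp.var 18 + Exp.const 1) (Exp.var 0)))))

theorem agree_parseCmd (x : ℕ) : Agree [x, 18, 22, 24] [] σ ((parseCmd x).exec σ) := by
  refine (Cmd.exec_agree _ _).mono ?_ ?_ <;> simp [parseCmd, Cmd.vars, Cmd.arrs]

/-- The position `e` is that of the first zero from the start on, or the value of variable `0` if there is
none below it. -/
theorem exec_parseCmd {x : ℕ} (hx : x ∉ [0, 18, 24]) (h24 : σ.v 24 ≤ σ.v 0) :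
    ∃ e, σ.v 24 ≤ e ∧ e ≤ σ.v 0 ∧ (∀ i, σ.v 24 ≤ i → i < e → σ.a 0 i ≠ 0) ∧
      (e < σ.v 0 → σ.a 0 e = 0) ∧ ((parseCmd x).exec σ).v x = e - σ.v 24 ∧
      ((parseCmd x).exec σ).v 24 = min (e + 1) (σ.v 0) := by
  set A := σ.v 0 with hA
  set o := σ.v 24 with ho
  rw [parseCmd, Cmd.exec_seq, Cmd.exec_seq, Cmd.exec_seq, Cmd.exec_set 24, Cmd.exec_set x,
    Cmd.exec_set 18, Exp.eval_var 0 σ]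
  simp only [List.mem_cons, List.not_mem_nil, or_false, not_or] at hx
  have search := Cmd.exec_loop_induction (x := 22) (y := 0)
    (e := Cmd.ite (Exp.eq (Exp.var 18) (Exp.var 0) *
      (Exp.var 22 + Exp.const 1 - Exp.var 24) * Exp.eq (Exp.get 0 (Exp.var 22)) (Exp.const 0))
      (Cmd.set 18 (Exp.var 22)) Cmd.skip) (σ := σ.setV 18 A)
    (fun k τ => τ.v 0 = A ∧ τ.v 24 = o ∧ τ.a 0 = σ.a 0 ∧
      (τ.v 18 = A ∧ (∀ i, o ≤ i → i < k → σ.a 0 i ≠ 0) ∨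
        o ≤ τ.v 18 ∧ τ.v 18 < A ∧ (∀ i, o ≤ i → i < τ.v 18 → σ.a 0 i ≠ 0) ∧ σ.a 0 (τ.v 18) = 0))
    ⟨by simp [St.setV_v, hA], by simp [St.setV_v, ho], rfl, Or.inl ⟨by simp, by simp⟩⟩ (by
      rintro k hk τ ⟨h0, h24', ha, hcase⟩
      have hk : k < A := by simpa [St.setV_v] using hk
      rw [Cmd.exec_ite]
      simp only [eval_mul_ne_zero, eval_eq_ne_zero, Exp.eval_sub, Exp.eval_add, Exp.eval_var,
        Exp.eval_const, Exp.eval_get, St.setV_a, St.setV_self, ha,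
        St.setV_of_ne _ _ (show 18 ≠ 22 by decide), St.setV_of_ne _ _ (show 0 ≠ 22 by decide),
        St.setV_of_ne _ _ (show 24 ≠ 22 by decide), h0, h24', Cmd.exec_set, Cmd.exec_skip]
      split_ifs with hcond
      · obtain ⟨⟨hc1, hc2⟩, hc3⟩ := hcond
        rcases hcase with ⟨-, hno⟩ | ⟨-, hlt, -⟩
        · refine ⟨by simp [St.setV_v, h0], by simp [St.setV_v, h24'], ha, Or.inr ?_⟩
          rw [St.setV_self]
          exact ⟨by omega, hk, hno, hc3⟩
        · omega
      · refine ⟨by simp [St.setV_v, h0], by simp [St.setV_v, h24'], ha, ?_⟩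
        rw [St.setV_of_ne _ _ (by decide)]
        rcases hcase with ⟨hc, hno⟩ | hc
        · refine Or.inl ⟨hc, fun i hoi hi h0i => ?_⟩
          by_cases hik : i = k
          · subst hik
            exact hcond ⟨⟨hc, by omega⟩, h0i⟩
          · exact hno i hoi (by omega) h0i
        · exact Or.inr hc)
  rw [show (σ.setV 18 A).v 0 = A by simp [St.setV_v, hA]] at search
  generalize (Cmd.loop 22 0 _).exec (σ.setV 18 A) = τ at *
  obtain ⟨h0, h24', -, hcase⟩ := search
  refine ⟨τ.v 18, ?_, ?_, ?_, ?_, ?_, ?_⟩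
  · rcases hcase with h | h <;> omega
  · rcases hcase with h | h <;> omega
  · rcases hcase with h | h
    · rw [h.1]; exact h.2
    · exact h.2.2.1
  · intro hlt
    rcases hcase with h | h
    · omega
    · exact h.2.2.2
  · rw [St.setV_of_ne _ _ hx.2.2, St.setV_self, Exp.eval_sub, Exp.eval_var, Exp.eval_var, h24']
  · rw [St.setV_self, Exp.eval_min, Exp.eval_add, Exp.eval_var, Exp.eval_var, Exp.eval_const,
      St.setV_of_ne _ _ (Ne.symm hx.2.1), St.setV_of_ne _ _ (Ne.symm hx.1), h0]

/-- Array `0` holds the word `x` from position `b` on, and variable `0` is larger than the end. -/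
structure Source (b : ℕ) (x : List Bool) (σ : St) : Prop where
  lt : b + x.length < σ.v 0
  bit : ∀ i (h : i < x.length), σ.a 0 (b + i) = x[i].toNat

theorem Source.of_agree {b : ℕ} {x : List Bool} (h : Source b x σ) {xs as : List ℕ}
    (hA : Agree xs as σ τ) (hl : (xs.all (· ≠ 0) && as.all (· ≠ 0)) = true) : Source b x τ := by
  simp only [Bool.and_eq_true, List.all_eq_true, decide_eq_true_eq] at hl
  exact ⟨by rw [hA.v 0 fun hm => hl.1 _ hm rfl]; exact h.lt,
    by rw [hA.a 0 fun hm => hl.2 _ hm rfl]; exact h.bit⟩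

theorem Source.parse {b o a v : ℕ} {x ys : List Bool} (h : Source b x σ) (hv : v ∉ [0, 18, 24])
    (ho : σ.v 24 = b + o) (hd : x.drop o = unary a ++ ys) :
    ((parseCmd v).exec σ).v v = a ∧ ((parseCmd v).exec σ).v 24 = b + (o + a + 1) ∧
      x.drop (o + a + 1) = ys := by
  have hlen : o + a + 1 ≤ x.length := by
    have := congrArg List.length hd
    rw [List.length_drop, List.length_append, length_unary] at this
    omega
  have hget : ∀ i, x[o + i]? = (unary a ++ ys)[i]? := fun i => by rw [← hd, List.getElem?_drop]
  have hlt := h.lt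
  obtain ⟨e, h1, h2, h3, h4, h5, h6⟩ := exec_parseCmd hv (σ := σ) (by omega)
  have ht : ∀ i < a, σ.a 0 (b + (o + i)) ≠ 0 := by
    intro i hi
    have := hget i
    rw [List.getElem?_append_left (by rw [length_unary]; omega), unary, List.getElem?_append_left (by simpa),
      List.getElem?_replicate_of_lt hi, List.getElem?_eq_getElem (by omega), Option.some.injEq] at this
    rw [h.bit _ (by omega), this]
    decide
  have hf : σ.a 0 (b + (o + a)) = 0 := by
    have := hget a
    rw [List.getElem?_append_left (by rw [length_unary]; omega), unary,
      List.getElem?_append_right (by simp), List.getElem?_eq_getElem (by omega)] at this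
    simp only [List.length_replicate, Nat.sub_self, List.getElem?_cons_zero, Option.some.injEq] at this
    rw [h.bit _ (by omega), this]
    rfl
  have he : e = b + (o + a) := by
    rcases lt_trichotomy e (b + (o + a)) with hlt' | heq | hgt
    · refine absurd (h4 (by omega)) ?_
      have := ht (e - (b + o)) (by omega)
      rwa [show b + (o + (e - (b + o))) = e by omega] at this
    · exact heq
    · exact absurd hf (h3 _ (by omega) hgt)
  refine ⟨by rw [h5, he, ho]; omega, by rw [h6, he]; omega, ?_⟩
  rw [show o + a + 1 = o + (a + 1) by ring, ← List.drop_drop, hd]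
  exact List.drop_left' (length_unary a)

/-- If the position after reading a number is still within the word, then there was a number to be read. -/
theorem Source.exists_unary {b o v : ℕ} {x : List Bool} (h : Source b x σ) (hv : v ∉ [0, 18, 24])
    (ho : σ.v 24 = b + o) (hox : o ≤ x.length) (hle : ((parseCmd v).exec σ).v 24 ≤ b + x.length) :
    ∃ a ys, x.drop o = unary a ++ ys := by
  have hlt := h.lt
  obtain ⟨e, h1, h2, h3, h4, h5, h6⟩ := exec_parseCmd hv (σ := σ) (by omega)
  have he : e + 1 ≤ b + x.length := by omega
  obtain ⟨a, rfl⟩ := Nat.exists_eq_add_of_le (show b + o ≤ e by omega)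
  refine ⟨a, x.drop (o + a + 1), List.ext_getElem? fun i => ?_⟩
  rw [List.getElem?_drop]
  rcases lt_trichotomy i a with hi | rfl | hi
  · rw [List.getElem?_append_left (by rw [length_unary]; omega), unary, List.getElem?_append_left (by simpa),
      List.getElem?_replicate_of_lt hi, List.getElem?_eq_getElem (by omega), Option.some.injEq]
    have := h3 (b + (o + i)) (by omega) (by omega)
    rw [h.bit _ (by omega)] at this
    simpa using this
  · rw [List.getElem?_append_left (by rw [length_unary]; omega), unary,
      List.getElem?_append_right (by simp), List.getElem?_eq_getElem (by omega)]
    have := h4 (by omega)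
    rw [add_assoc, h.bit _ (by omega)] at this
    simpa using this
  · rw [List.getElem?_append_right (by rw [length_unary]; omega), length_unary, List.getElem?_drop]
    congr 1; omega

theorem parseCmd_mono {v : ℕ} (hv : v ∉ [0, 18, 24]) (h24 : σ.v 24 ≤ σ.v 0) :
    σ.v 24 ≤ ((parseCmd v).exec σ).v 24 ∧
      ((parseCmd v).exec σ).v 24 ≤ ((parseCmd v).exec σ).v 0 := by
  obtain ⟨e, h1, h2, h3, h4, h5, h6⟩ := exec_parseCmd hv h24
  have h0 := (agree_parseCmd (σ := σ) v).v 0 (by simp at hv ⊢; omega)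
  rw [h0, h6]
  omega

end Loop

/-! ### Validation of the input -/

namespace Loop
open LCRInstance

variable {σ τ : St}

/-- Reads several unary numbers into the given variables. -/
def parseAll : List ℕ → Cmd
  | [] => Cmd.skip
  | v :: vs => Cmd.seq (parseCmd v) (parseAll vs)

theorem agree_parseAll (vs : List ℕ) : Agree (vs ++ [18, 22, 24]) [] σ ((parseAll vs).exec σ) := by
  induction vs generalizing σ with
  | nil => exact Agree.refl
  | cons v vs ih =>
    rw [parseAll, Cmd.exec_seq]
    exact ((agree_parseCmd v).mono (by intro; simp; tauto) (by simp)).trans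
      (ih.mono (by intro; simp; tauto) (by simp))

theorem Source.parseAll {b o : ℕ} {x ys : List Bool} {vs as : List ℕ} (h : Source b x σ)
    (hvs : ∀ v ∈ vs, v ∉ [0, 18, 22, 24]) (hnd : vs.Nodup) (hlen : as.length = vs.length)
    (ho : σ.v 24 = b + o) (hd : x.drop o = (as.map unary).flatten ++ ys) :
    vs.map ((Loop.parseAll vs).exec σ).v = as ∧
      ((Loop.parseAll vs).exec σ).v 24 = b + (o + ((as.map unary).flatten).length) := by
  induction vs generalizing σ as o with
  | nil =>
    obtain rfl : as = [] := List.length_eq_zero_iff.1 hlen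
    simpa [Loop.parseAll] using ho
  | cons v vs ih =>
    obtain _ | ⟨a, as⟩ := as
    · simp at hlen
    rw [List.map_cons, List.flatten_cons, List.append_assoc] at hd
    have hv := hvs v List.mem_cons_self
    have hv' : v ∉ [0, 18, 24] := by simp at hv ⊢; tauto
    obtain ⟨h1, h2, h3⟩ := h.parse hv' ho hd
    rw [Loop.parseAll, Cmd.exec_seq]
    have hA := agree_parseCmd (σ := σ) v
    obtain ⟨i1, i2⟩ := ih (h.of_agree hA (by simp at hv ⊢; tauto)) (fun v hv => hvs v (List.mem_cons_of_mem _ hv))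
      (List.nodup_cons.1 hnd).2 (by simpa using hlen) h2 h3
    refine ⟨?_, ?_⟩
    · rw [List.map_cons, i1, (agree_parseAll vs).v v ?_, h1]
      have := (List.nodup_cons.1 hnd).1
      simp at hv ⊢
      tauto
    · rw [i2, List.map_cons, List.flatten_cons, List.length_append, length_unary]
      ring

theorem parseAll_mono {vs : List ℕ} (hvs : ∀ v ∈ vs, v ∉ [0, 18, 22, 24]) (h24 : σ.v 24 ≤ σ.v 0) :
    σ.v 24 ≤ ((parseAll vs).exec σ).v 24 := by
  induction vs generalizing σ with
  | nil => exact le_rfl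
  | cons v vs ih =>
    have hv := hvs v List.mem_cons_self
    have hm := parseCmd_mono (v := v) (by simp at hv ⊢; tauto) h24
    exact hm.1.trans (ih (fun v hv => hvs v (List.mem_cons_of_mem _ hv)) hm.2)

theorem Source.exists_unaries {b o : ℕ} {x : List Bool} {vs : List ℕ} (h : Source b x σ)
    (hvs : ∀ v ∈ vs, v ∉ [0, 18, 22, 24]) (ho : σ.v 24 = b + o) (hox : o ≤ x.length)
    (hle : ((Loop.parseAll vs).exec σ).v 24 ≤ b + x.length) :
    ∃ (as : List ℕ) (ys : List Bool), as.length = vs.length ∧ x.drop o = (as.map unary).flatten ++ ys := by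
  induction vs generalizing σ o with
  | nil => exact ⟨[], x.drop o, rfl, rfl⟩
  | cons v vs ih =>
    have hv := hvs v List.mem_cons_self
    have hv' : v ∉ [0, 18, 24] := by simp at hv ⊢; tauto
    have hA := agree_parseCmd (σ := σ) v
    rw [Loop.parseAll, Cmd.exec_seq] at hle
    have hvs' := fun v hv => hvs v (List.mem_cons_of_mem _ hv)
    have hlt := h.lt
    have hm := parseCmd_mono hv' (show σ.v 24 ≤ σ.v 0 by omega)
    obtain ⟨a, ys, hd⟩ := h.exists_unary hv' ho hox ((parseAll_mono hvs' hm.2).trans hle)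
    obtain ⟨h1, h2, h3⟩ := h.parse hv' ho hd
    have hlen : o + a + 1 ≤ x.length := by
      have := congrArg List.length hd
      rw [List.length_drop, List.length_append, length_unary] at this
      omega
    obtain ⟨as, zs, hl, hz⟩ := ih (h.of_agree hA (by simp at hv ⊢; tauto)) hvs' h2 hlen hle
    refine ⟨a :: as, zs, by simp [hl], ?_⟩
    rw [hd, List.map_cons, List.flatten_cons, List.append_assoc, ← hz, h3]

/-- The expression for `2 ^ h * e`. -/
def dbl (h : ℕ) (e : Exp) : Exp := (Exp.const 2 * ·)^[h] e

theorem eval_dbl (h : ℕ) (e : Exp) : (dbl h e).eval σ = 2 ^ h * e.eval σ := by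
  induction h with
  | zero => simp [dbl]
  | succ h ih =>
    rw [dbl, Function.iterate_succ_apply', ← dbl, Exp.eval_mul, ih, Exp.eval_const]
    ring

/-- The expression for the size of the table of a thread whose number of states is in variable `n`. -/
def tableE (n : ℕ) : Exp := Exp.var n * ((Exp.const 2 * Exp.var 3 + Exp.const 1) * Exp.var n)

/-- Validates the input, computes the parameters, and initializes the main loop, which is skipped if
variable `19` is zero. Variable `0` holds `2 ^ h` times the length of the input, so a comparison with
`2 ^ h` times the length of the expected encoding tells whether the length is right. If `b = 1`, then
the first cell of the input must hold `D + L`. All values are cut off at the bound in variable `0`, which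
does not change them if the input is valid. -/
def setupCmd (b h : ℕ) : Cmd :=
  Cmd.seq (Cmd.set 19 (Exp.min ((Exp.var 3 - Exp.var 8) * (Exp.var 1 - Exp.var 9) *
      (Exp.var 6 - Exp.var 10) *
      (Exp.const (1 - b) + Exp.eq (Exp.var 3 + Exp.var 1) (Exp.get 0 (Exp.const 0))) *
      Exp.eq (dbl h (Exp.var 24 + tableE 1 + tableE 6 + Exp.var 1)) (Exp.var 0)) (Exp.const 1)))
  (Cmd.seq (Cmd.set 20 (Exp.const 0))
  (Cmd.seq (Cmd.set 2 (Exp.min (Exp.var 1 + Exp.const 1) (Exp.var 0)))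
  (Cmd.seq (Cmd.set 4 (Exp.min (Exp.var 3 + Exp.const 1) (Exp.var 0)))
  (Cmd.seq (Cmd.set 5 (Exp.min (Exp.const 2 * Exp.var 3 + Exp.const 1) (Exp.var 0)))
  (Cmd.seq (Cmd.set 7 (Exp.min (Exp.var 1 * (Exp.var 3 + Exp.const 1)) (Exp.var 0)))
  (Cmd.seq (Cmd.set 11 (Exp.var 24))
  (Cmd.seq (Cmd.set 12 (Exp.min (Exp.var 24 + tableE 1) (Exp.var 0)))
  (Cmd.seq (Cmd.set 13 (Exp.min (Exp.var 24 + tableE 1 + tableE 6) (Exp.var 0)))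
    (fill 1 22 0 (Exp.const 0))))))))))

/-- The table size of a thread with `n` states. -/
def tableSize (D n : ℕ) : ℕ := n * ((2 * D + 1) * n)

/-- The effect of `setupCmd`. -/
structure SetUp (b h : ℕ) (σ τ : St) : Prop where
  valid : τ.v 19 ≠ 0 ↔ (σ.v 8 < σ.v 3 ∧ σ.v 9 < σ.v 1 ∧ σ.v 10 < σ.v 6) ∧
    (b = 0 ∨ σ.v 3 + σ.v 1 = σ.a 0 0) ∧
    2 ^ h * (σ.v 24 + tableSize (σ.v 3) (σ.v 1) + tableSize (σ.v 3) (σ.v 6) + σ.v 1) = σ.v 0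
  res : τ.v 20 = 0
  a : τ.a 0 = σ.a 0
  guide : ∀ i < σ.v 0, τ.a 1 i = 0
  v0 : τ.v 0 = σ.v 0
  v1 : τ.v 1 = σ.v 1
  v2 : τ.v 2 = min (σ.v 1 + 1) (σ.v 0)
  v3 : τ.v 3 = σ.v 3
  v4 : τ.v 4 = min (σ.v 3 + 1) (σ.v 0)
  v5 : τ.v 5 = min (2 * σ.v 3 + 1) (σ.v 0)
  v6 : τ.v 6 = σ.v 6
  v7 : τ.v 7 = min (σ.v 1 * (σ.v 3 + 1)) (σ.v 0)
  v8 : τ.v 8 = σ.v 8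
  v9 : τ.v 9 = σ.v 9
  v10 : τ.v 10 = σ.v 10
  v11 : τ.v 11 = σ.v 24
  v12 : τ.v 12 = min (σ.v 24 + tableSize (σ.v 3) (σ.v 1)) (σ.v 0)
  v13 : τ.v 13 = min (σ.v 24 + tableSize (σ.v 3) (σ.v 1) + tableSize (σ.v 3) (σ.v 6)) (σ.v 0)

theorem exec_setupCmd {b h : ℕ} (hb : b ≤ 1) : SetUp b h σ ((setupCmd b h).exec σ) := by
  have hA : ∀ ρ : St, Agree [22] [1] ρ ((fill 1 22 0 (Exp.const 0)).exec ρ) :=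
    fun ρ => Agree.of_exec (by decide)
  have hv : ∀ (ρ : St) (x : ℕ), x ≠ 22 → ((fill 1 22 0 (Exp.const 0)).exec ρ).v x = ρ.v x :=
    fun ρ x hx => (hA ρ).v x (by simpa using hx)
  simp only [setupCmd, Cmd.exec_seq]
  constructor
  case guide =>
    intro i hi
    refine exec_fill (a := 1) (x := 22) (y := 0) (f := fun _ => 0) (fun _ _ _ _ _ => rfl) i ?_
    simpa [Cmd.exec_set, St.setV_v] using hi
  case a => rw [(hA _).a 0 (by decide)]; rfl
  case valid =>
    rw [hv _ _ (by decide)]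
    simp only [Cmd.exec_set]
    repeat rw [St.setV_of_ne _ _ (by decide)]
    have hmin : ∀ e : Exp, (Exp.min e (Exp.const 1)).eval σ ≠ 0 ↔ e.eval σ ≠ 0 := by
      intro e; rw [Exp.eval_min, Exp.eval_const]; omega
    rw [St.setV_self, hmin]
    simp only [eval_mul_ne_zero, eval_add_ne_zero, eval_eq_ne_zero, eval_dbl]
    simp only [Exp.eval_sub, Exp.eval_add, Exp.eval_mul, Exp.eval_var, Exp.eval_const, Exp.eval_get, tableE,
      tableSize, ne_eq, Nat.sub_eq_zero_iff_le, not_le, and_assoc]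
    have : 1 ≤ b ∨ b = 0 := by omega
    have h0 : b < 1 ↔ b = 0 := by omega
    rw [h0]
  all_goals
    rw [hv _ _ (by decide)]
    simp [Cmd.exec_set, St.setV_v, tableE, tableSize]

/-- Reads and validates an input that starts at position `b`. -/
def preCmd (b h : ℕ) : Cmd :=
  Cmd.seq (Cmd.set 24 (Exp.const b)) (Cmd.seq (parseAll [1, 3, 6, 8, 9, 10]) (setupCmd b h))

/-- The entries of a table `ys` that starts at position `o` of the input. -/
theorem Source.getElem?_rest {b o : ℕ} {x ys zs : List Bool} (h : Source b x σ) (hx : x = zs ++ ys)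
    (ho : o = b + zs.length) {i : ℕ} {t : Bool} (hi : ys[i]? = some t) : σ.a 0 (o + i) ≠ 0 ↔ t = true := by
  have hlt : i < ys.length := by
    by_contra hn
    rw [List.getElem?_eq_none (by omega)] at hi
    simp at hi
  have hlen : x.length = zs.length + ys.length := by rw [hx, List.length_append]
  have : x[zs.length + i]? = some t := by
    rw [hx, List.getElem?_append_right (by omega), Nat.add_sub_cancel_left, hi]
  rw [List.getElem?_eq_getElem (by omega), Option.some.injEq] at this
  rw [ho, add_assoc, h.bit _ (by omega), this]
  cases t <;> simp

/-- On the encoding of an instance, the instance is loaded and the main loop is initialized. -/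
theorem exec_preCmd {b h : ℕ} {x : List Bool} (hb : b ≤ 1) (hs : Source b x σ)
    (h0 : σ.v 0 = 2 ^ h * (b + x.length)) {I : LCRInstance} (hx : x = I.encode)
    (hk : b = 0 ∨ I.D + I.L = σ.a 0 0) :
    Loaded I.toAbs I.numUnsafe ((preCmd b h).exec σ) ∧ ((preCmd b h).exec σ).v 19 ≠ 0 ∧
      ((preCmd b h).exec σ).v 20 = 0 ∧ ∀ i < I.L + 1, ((preCmd b h).exec σ).a 1 i = 0 := by
  classical
  set us := ([I.L, I.D, I.C, I.init.val, I.leader.init.val, I.contributor.init.val].map unary).flatten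
    with hus
  set ys := transBits I.leader ++ (transBits I.contributor ++
    (List.finRange I.L).map fun q => decide (q ∈ I.unsafeStates)) with hys
  have hsplit : x = us ++ ys := by
    rw [hx, hus, hys, encode]
    simp only [List.map_cons, List.map_nil, List.flatten_cons, List.flatten_nil, List.append_nil,
      List.append_assoc]
  have hylen : ys.length = tableSize I.D I.L + tableSize I.D I.C + I.L := by
    rw [hys, List.length_append, List.length_append, length_transBits, length_transBits, List.length_map,
      List.length_finRange, tableSize, tableSize]
    ring
  have hxlen : x.length = us.length + ys.length := by rw [hsplit, List.length_append]
  have hulen : I.L + I.D < us.length := by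
    simp only [hus, List.map_cons, List.map_nil, List.flatten_cons, List.flatten_nil, List.append_nil,
      List.length_append, length_unary]
    omega
  have hL : 0 < I.L := I.leader.init.pos
  have hlt := hs.lt
  set σ1 := σ.setV 24 b with hσ1
  have s1 : Source b x σ1 := hs.of_agree (xs := [24]) (as := []) (Agree.refl.setV (by simp) b) (by decide)
  obtain ⟨p1, p2⟩ := s1.parseAll (o := 0) (vs := [1, 3, 6, 8, 9, 10])
    (as := [I.L, I.D, I.C, I.init.val, I.leader.init.val, I.contributor.init.val]) (ys := ys)
    (by decide) (by decide) rfl (by simp [hσ1]) hsplit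
  rw [← hus, zero_add] at p2
  have hA := agree_parseAll (σ := σ1) [1, 3, 6, 8, 9, 10]
  have hpre : (preCmd b h).exec σ = (setupCmd b h).exec ((parseAll [1, 3, 6, 8, 9, 10]).exec σ1) := rfl
  rw [hpre]
  generalize (Loop.parseAll [1, 3, 6, 8, 9, 10]).exec σ1 = σ2 at *
  have s2 := s1.of_agree hA (by decide)
  simp only [List.map_cons, List.map_nil, List.cons.injEq, and_true] at p1
  obtain ⟨e1, e3, e6, e8, e9, e10⟩ := p1
  have e0 : σ2.v 0 = σ.v 0 := (hA.v 0 (by decide)).trans (St.setV_of_ne _ _ (by decide))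
  have ea : σ2.a 0 = σ.a 0 := hA.a 0 (by decide)
  have su := exec_setupCmd (b := b) (h := h) (σ := σ2) hb
  generalize (setupCmd b h).exec σ2 = τ at *
  obtain ⟨valid, res, a, guide, v0, v1, v2, v3, v4, v5, v6, v7, v8, v9, v10, v11, v12, v13⟩ := su
  rw [e0] at *
  have hW : 2 * I.D + 1 ≤ tableSize I.D I.L :=
    (Nat.le_mul_of_pos_right _ hL).trans (Nat.le_mul_of_pos_left _ hL)
  have hN : I.L * (I.D + 1) ≤ tableSize I.D I.L :=
    Nat.mul_le_mul_left _ ((show I.D + 1 ≤ 2 * I.D + 1 by omega).trans (Nat.le_mul_of_pos_right _ hL))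
  simp only [e1, e3, e6, e8, e9, e10, p2, ea] at *
  have st : Source b x τ := ⟨by rw [v0]; exact hlt, by rw [a]; exact hs.bit⟩
  refine ⟨⟨v1, ?_, v3, ?_, ?_, v6, ?_, v8, v9, v10, ?_, ?_, ?_⟩, ?_, res, ?_⟩
  · change _ = I.L + 1; omega
  · change _ = I.D + 1; omega
  · change _ = 2 * I.D + 1; omega
  · change _ = I.L * (I.D + 1); omega
  · intro q hq l hl q' hq'
    rw [st.getElem?_rest hsplit v11 (t := decide (numTrans I.leader q l q')), decide_eq_true_iff]
    · rfl
    · rw [hys, List.getElem?_append_left]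
      · exact getElem?_transBits _ hq hl hq'
      · exact (List.getElem?_eq_some_iff.1 (getElem?_transBits I.leader hq hl hq')).1
  · intro q hq l hl q' hq'
    rw [st.getElem?_rest (zs := us ++ transBits I.leader) (ys := transBits I.contributor ++
      (List.finRange I.L).map fun q => decide (q ∈ I.unsafeStates)) (by rw [hsplit, List.append_assoc])
      (t := decide (numTrans I.contributor q l q')) ?_ ?_, decide_eq_true_iff]
    · rfl
    · rw [v12, List.length_append, length_transBits, ← tableSize]; omega
    · rw [List.getElem?_append_left]
      · exact getElem?_transBits _ hq hl hq'
      · exact (List.getElem?_eq_some_iff.1 (getElem?_transBits I.contributor hq hl hq')).1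
  · intro q (hq : q < I.L)
    rw [st.getElem?_rest (zs := us ++ (transBits I.leader ++ transBits I.contributor)) (ys :=
      (List.finRange I.L).map fun q => decide (q ∈ I.unsafeStates))
      (by rw [hsplit, List.append_assoc, List.append_assoc])
      (t := decide ((⟨q, hq⟩ : Fin I.L) ∈ I.unsafeStates)) ?_ ?_, decide_eq_true_iff]
    · constructor
      · exact fun h => ⟨_, h, rfl⟩
      · rintro ⟨y, hy, rfl⟩; exact hy
    · rw [v13, List.length_append, List.length_append, length_transBits, length_transBits, ← tableSize,
        ← tableSize]
      omega
    · rw [List.getElem?_map, List.getElem?_eq_getElem (by simpa using hq)]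
      simp
  · rw [valid]
    refine ⟨⟨I.init.2, I.leader.init.2, I.contributor.init.2⟩, hk, ?_⟩
    rw [h0, hxlen, hylen]; ring
  · intro i hi
    exact guide i (by omega)

/-- Only encodings of instances are found valid. -/
theorem exists_encode_of_valid {b h : ℕ} {x : List Bool} (hb : b ≤ 1) (hs : Source b x σ)
    (h0 : σ.v 0 = 2 ^ h * (b + x.length)) (h19 : ((preCmd b h).exec σ).v 19 ≠ 0) :
    ∃ I : LCRInstance, x = I.encode ∧ (b = 0 ∨ I.D + I.L = σ.a 0 0) := by
  have hlt := hs.lt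
  set σ1 := σ.setV 24 b with hσ1
  have s1 : Source b x σ1 := hs.of_agree (xs := [24]) (as := []) (Agree.refl.setV (by simp) b) (by decide)
  have hpre : (preCmd b h).exec σ = (setupCmd b h).exec ((parseAll [1, 3, 6, 8, 9, 10]).exec σ1) := rfl
  rw [hpre, (exec_setupCmd hb).valid] at h19
  have hA := agree_parseAll (σ := σ1) [1, 3, 6, 8, 9, 10]
  have e0 := (hA.v 0 (by decide)).trans (St.setV_of_ne σ b (show 0 ≠ 24 by decide))
  have ea : ((parseAll [1, 3, 6, 8, 9, 10]).exec σ1).a 0 = σ.a 0 := hA.a 0 (by decide)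
  obtain ⟨⟨hi, hq, hp⟩, hk, hlen⟩ := h19
  rw [e0, h0] at hlen
  have hlen := Nat.eq_of_mul_eq_mul_left (Nat.pow_pos (by decide)) hlen
  obtain ⟨as, ys, hl, hd⟩ := s1.exists_unaries (o := 0) (vs := [1, 3, 6, 8, 9, 10]) (by decide)
    (by simp [hσ1]) (Nat.zero_le _) (by omega)
  obtain ⟨p1, p2⟩ := s1.parseAll (o := 0) (vs := [1, 3, 6, 8, 9, 10]) (by decide) (by decide) hl
    (by simp [hσ1]) hd
  generalize (Loop.parseAll [1, 3, 6, 8, 9, 10]).exec σ1 = σ2 at *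
  simp only [List.map_cons, List.map_nil] at p1
  have hxlen : x.length = ((as.map unary).flatten).length + ys.length := by
    rw [← List.length_append, ← hd, List.drop_zero]
  obtain ⟨I, hL, hD, hC, hI⟩ := exists_encode hi hq hp (ys := ys) (by
    rw [← tableSize, ← tableSize]; omega)
  refine ⟨I, ?_, by rw [hL, hD, ← ea]; exact hk⟩
  rw [hI, ← List.drop_zero (l := x), hd, ← p1]
  simp only [List.map_cons, List.map_nil, List.flatten_cons, List.flatten_nil, List.append_nil,
      List.append_assoc]

end Loop

/-! ### The decision procedure -/

namespace Loop
open LCRInstance RAM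

variable {Y : AbsSys} {U : ℕ → Prop} {σ : St}

/-- The number of registers for intermediate results; any number above the sizes of the two commands of
the program will do. -/
def regs : ℕ := 4000

/-- The number of doublings that yield the base address of the arrays, chosen such that there is room for
all variables and registers below that address. -/
def doublings : ℕ := 13

/-- The machine code up to the main loop, for an input whose word starts at position `b`. -/
def startCode (b : ℕ) : List Instr :=
  bootCode doublings 6 ++ (preCmd b doublings).code 0 (bootCode doublings 6).length

/-- The code of a round of the main loop. -/
def loopCode (b : ℕ) : List Instr := roundCmd.code 0 ((startCode b).length + 1)

/-- The machine program: rounds of the main loop are executed while variable `19` is not zero; then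
variable `20` holds the answer. -/
def program (b : ℕ) : Prog :=
  startCode b ++ ([Instr.jumpZero (varR 19) ((startCode b).length + 2 + (loopCode b).length)] ++
    (loopCode b ++ ([Instr.jump (startCode b).length] ++
      ([Instr.jumpZero (varR 20) ((startCode b).length + 4 + (loopCode b).length)] ++
        ([Instr.halt true] ++ [Instr.halt false])))))

theorem codeAt_program (b : ℕ) : CodeAt (program b) 0 (startCode b) ∧
    CodeAt (program b) (startCode b).length
      [Instr.jumpZero (varR 19) ((startCode b).length + 2 + (loopCode b).length)] ∧
    CodeAt (program b) ((startCode b).length + 1) (loopCode b) ∧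
    CodeAt (program b) ((startCode b).length + 1 + (loopCode b).length)
      [Instr.jump (startCode b).length] ∧
    CodeAt (program b) ((startCode b).length + 2 + (loopCode b).length)
      [Instr.jumpZero (varR 20) ((startCode b).length + 4 + (loopCode b).length)] ∧
    CodeAt (program b) ((startCode b).length + 3 + (loopCode b).length) [Instr.halt true] ∧
    CodeAt (program b) ((startCode b).length + 4 + (loopCode b).length) [Instr.halt false] := by
  have h : CodeAt (program b) 0 (program b) := fun i _ => by rw [zero_add]
  conv at h => arg 3; rw [program]
  simp only [codeAt_append, List.length_singleton, zero_add] at h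
  obtain ⟨h1, h2, h3, h4, h5, h6, h7⟩ := h
  refine ⟨h1, h2, h3, h4, ?_, ?_, ?_⟩
  · convert h5 using 1; omega
  · convert h6 using 1; omega
  · convert h7 using 1; omega

theorem decidesWithin_of_runs {p : Prog} {V T n l : ℕ} {inp : List ℕ} {mem : ℕ → ℕ} {ans : Prop} {b : Bool}
    (h : Runs p V (initState inp) n ⟨l, mem⟩) (hn : n ≤ T) (hl : CodeAt p l [Instr.halt b])
    (hb : b = true ↔ ans) : DecidesWithin p inp ans T V := by
  refine ⟨n, hn, b, ?_, hb, h.2⟩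
  rw [run, h.1]
  exact (codeAt_cons.1 hl).1

/-- The end of a run, once the main loop is finished. -/
theorem decidesWithin_of_exit {b n T : ℕ} {K : Machine} {inp : List ℕ}
    {mem : ℕ → ℕ} {ans : Prop}
    (h : Runs (program b) K.V (initState inp) n ⟨(startCode b).length, mem⟩) (hn : n + 2 ≤ T)
    (hA : K.At σ mem) (h19 : σ.v 19 = 0) (h20 : σ.v 20 ≠ 0 ↔ ans) :
    DecidesWithin (program b) inp ans T K.V := by
  obtain ⟨-, c2, -, -, c5, c6, c7⟩ := codeAt_program b
  have r1 := runs_jumpZero c2 hA.le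
  rw [hA.rep.v 19 (by decide), if_pos h19] at r1
  have r2 := runs_jumpZero c5 hA.le
  rw [hA.rep.v 20 (by decide)] at r2
  have r := (h.trans r1).trans r2
  by_cases hz : σ.v 20 = 0
  · rw [if_pos hz] at r
    exact decidesWithin_of_runs r (by omega) c7 (by simp [← h20, hz])
  · rw [if_neg hz, show (startCode b).length + 2 + (loopCode b).length + 1 =
      (startCode b).length + 3 + (loopCode b).length by ring] at r
    exact decidesWithin_of_runs r (by omega) c6 (by simp [← h20, hz])

/-- The main loop, started at the guide with number `k` when `j` guides are left. -/
theorem runs_loop {b : ℕ} {K : Machine} (hp : K.p = program b) (hnb : K.nb = 14) (hT : K.T = regs)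
    (j k : ℕ) (hk : k + j = (Y.L * (Y.D + 1)) ^ (Y.L + 1)) {mem : ℕ → ℕ} (hA : K.At σ mem)
    (hl : Loaded Y U σ)
    (hg : ∀ i < Y.L + 1, σ.a 1 i = k / (Y.L * (Y.D + 1)) ^ i % (Y.L * (Y.D + 1)))
    (h19 : σ.v 19 ≠ 0 ↔ k < (Y.L * (Y.D + 1)) ^ (Y.L + 1))
    (h20 : σ.v 20 ≠ 0 ↔ ∃ k' < k, U ((Y.simulate (guide Y k')).1 / (Y.D + 1))) :
    ∃ n ≤ j * (roundCmd.cost K.ρ + 2), ∃ σ' mem', Runs (program b) K.V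
      ⟨(startCode b).length, mem⟩ n ⟨(startCode b).length, mem'⟩ ∧ K.At σ' mem' ∧ σ'.v 19 = 0 ∧
      (σ'.v 20 ≠ 0 ↔ ∃ k' < (Y.L * (Y.D + 1)) ^ (Y.L + 1),
        U ((Y.simulate (guide Y k')).1 / (Y.D + 1))) := by
  induction j generalizing k σ mem with
  | zero =>
    obtain rfl : k = _ := hk
    refine ⟨0, Nat.zero_le _, σ, mem, Runs.refl hA.le, hA, ?_, h20⟩
    simpa using h19
  | succ j ih =>
    obtain ⟨-, c2, c3, c4, -, -, -⟩ := codeAt_program b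
    have hlt : k < (Y.L * (Y.D + 1)) ^ (Y.L + 1) := by omega
    have h19' := h19.2 hlt
    have r1 := runs_jumpZero c2 hA.le
    rw [hA.rep.v 19 (by decide), if_neg h19'] at r1
    obtain ⟨n, hn, mem2, r2, hA2, -⟩ := Machine.cmd_runs roundCmd (K := K) (s := 0)
      (l := (startCode b).length + 1) (by rw [hp]; exact c3) hA (by rw [hnb]; decide)
      (by rw [hT]; decide)
    rw [hp] at r2
    have r3 := runs_jump c4 hA2.le
    obtain ⟨g1, g2, g3⟩ := exec_roundCmd hl hlt hg h19'
    obtain ⟨n', hn', σ', mem', r4, hA', e19, e20⟩ := ih (k + 1) (by omega) hA2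
      (hl.of_agree agree_roundCmd (by decide)) g1 g3 (by
        rw [g2, h20]
        constructor
        · rintro (⟨k', hk', hu⟩ | hu)
          exacts [⟨k', by omega, hu⟩, ⟨k, by omega, hu⟩]
        · rintro ⟨k', hk', hu⟩
          rcases Nat.lt_succ_iff_lt_or_eq.1 hk' with h | rfl
          exacts [Or.inl ⟨k', h, hu⟩, Or.inr hu])
    refine ⟨1 + n + 1 + n', ?_, σ', mem', ((r1.trans r2).trans r3).trans r4, hA', e19, e20⟩
    rw [add_mul, one_mul]
    omega

/-- The machine for an input of length `n` with numbers up to `M`. -/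
def machine (b n M nb : ℕ) (ρ : ℕ → ℕ) (hn : 0 < n) (hM : 2 ≤ M) : Machine where
  p := program b
  V := 2 ^ doublings * n + stride * M ^ regs + stride
  B := 2 ^ doublings * n
  M := M
  T := regs
  nb := nb
  ρ := ρ
  two_le := hM
  le_base := (show numVars + 1 + regs ≤ 2 ^ doublings by decide).trans (Nat.le_mul_of_pos_right _ hn)
  le_bound := le_rfl

/-- The run up to the main loop. -/
theorem runs_start {b n M : ℕ} {inp : List ℕ} (hb : b ≤ 1) (hn : inp.length = n) (hpos : 0 < n) (hM2 : 2 ≤ M)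
    (hle : ∀ i, inp.getD i 0 ≤ M) (hM : (stride + 1) * (2 ^ doublings * n) ≤ M) :
    ∃ m ≤ 7 * (2 ^ doublings * n) + 40 + (preCmd b doublings).cost (fun _ => 2 ^ doublings * n),
      ∃ σ mem, Runs (program b) (machine b n M 1 (fun _ => 2 ^ doublings * n) hpos hM2).V
        (initState inp) m ⟨(startCode b).length, mem⟩ ∧ σ.v 0 = 2 ^ doublings * n ∧
        (∀ i < n, σ.a 0 i = inp.getD i 0) ∧
        (machine b n M 1 (fun _ => 2 ^ doublings * n) hpos hM2).At ((preCmd b doublings).exec σ) mem := by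
  set K := machine b n M 1 (fun _ => 2 ^ doublings * n) hpos hM2 with hK
  obtain ⟨c1, -⟩ := codeAt_program b
  rw [startCode, codeAt_append, zero_add] at c1
  have hMV : M ≤ K.V := Machine.le_V (s := 1) (by rw [pow_one]; exact le_rfl)
    (show 1 ≤ regs by decide)
  obtain ⟨m, hm, σ, mem, r1, hrep, hsmall, hlem, h0, ha⟩ := runs_boot (R := 6) c1.1 (by decide) (by decide)
    (List.length_pos_iff.1 (hn ▸ hpos)) hle (by rw [hn]; exact hM)
  rw [hn] at *
  have hA : K.At σ mem := ⟨hrep, hsmall, fun y hy => by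
    obtain rfl : y = 0 := by
      have : K.nb = 1 := rfl
      omega
    exact h0, fun i => (hlem i).trans hMV⟩
  have hok : (preCmd b doublings).ok 1 = true ∧ (preCmd b doublings).size ≤ regs := by
    rcases Nat.le_one_iff_eq_zero_or_eq_one.1 hb with rfl | rfl <;> constructor <;> decide
  obtain ⟨m', hm', mem', r2, hA', -⟩ := Machine.cmd_runs (preCmd b doublings) (K := K) (s := 0) c1.2 hA hok.1
    (by rw [zero_add]; exact hok.2)
  refine ⟨m + m', ?_, σ, mem', ?_, h0, ha, hA'⟩
  · have : doublings = 13 := rfl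
    have : K.ρ = fun _ => 2 ^ doublings * n := rfl
    rw [this] at hm'
    omega
  · have r := (r1.mono hMV).trans r2
    rw [startCode, List.length_append]
    exact r

end Loop

/-! ### Running time -/

namespace Loop
open LCRInstance RAM

variable {Y : AbsSys} {U : ℕ → Prop} {σ : St}

/-- The exponent of a quantity in the running time, if the bound `y` of a loop is proportional to the
`f y`-th power of that quantity: the maximum over all nests of loops. -/
def Exp.weight (f : ℕ → ℕ) : Exp → ℕ
  | const _ => 0
  | var _ => 0
  | get _ e => e.weight f
  | bin _ e₁ e₂ => max (e₁.weight f) (e₂.weight f)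
  | any _ y e => f y + e.weight f

/-- The exponent of a quantity in the running time of a command, as for expressions. -/
def Cmd.weight (f : ℕ → ℕ) : Cmd → ℕ
  | skip => 0
  | set _ e => e.weight f
  | put _ e₁ e₂ => max (e₁.weight f) (e₂.weight f)
  | seq c₁ c₂ => max (c₁.weight f) (c₂.weight f)
  | ite e c₁ c₂ => max (e.weight f) (max (c₁.weight f) (c₂.weight f))
  | .loop _ y c => f y + c.weight f

/-- The monomial with the given exponents. -/
def mono {ι : Type*} [Fintype ι] (Z : ι → ℕ) (w : ι → ℕ) : ℕ := ∏ i, Z i ^ w i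

theorem mono_le {ι : Type*} [Fintype ι] {Z : ι → ℕ} (hZ : ∀ i, 1 ≤ Z i)
    {v w : ι → ℕ} (h : ∀ i, v i ≤ w i) : mono Z v ≤ mono Z w :=
  Finset.prod_le_prod' fun i _ => Nat.pow_le_pow_right (hZ i) (h i)

theorem one_le_mono {ι : Type*} [Fintype ι] {Z : ι → ℕ} (hZ : ∀ i, 1 ≤ Z i)
    (w : ι → ℕ) : 1 ≤ mono Z w := by
  have := mono_le hZ (v := fun _ => 0) (w := w) (fun _ => Nat.zero_le _)
  simpa [mono] using this

theorem Exp.cost_le {ι : Type*} [Fintype ι] {Z : ι → ℕ} (hZ : ∀ i, 1 ≤ Z i)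
    {f : ι → ℕ → ℕ} {κ : ℕ} {ρ : ℕ → ℕ} (hρ : ∀ y, ρ y ≤ κ * mono Z (f · y)) (e : Exp) :
    e.cost ρ ≤ e.cost (fun _ => κ) * mono Z (fun i => e.weight (f i)) := by
  induction e with
  | const n => simpa [Exp.cost] using one_le_mono hZ _
  | var x =>
    have := one_le_mono hZ (fun i => (Exp.var x).weight (f i))
    simp only [Exp.cost]; omega
  | get a e ih =>
    have := one_le_mono hZ (fun i => e.weight (f i))
    simp only [Exp.cost, Exp.weight]
    nlinarith
  | bin o e₁ e₂ ih₁ ih₂ =>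
    have h0 := one_le_mono hZ (fun i => (Exp.bin o e₁ e₂).weight (f i))
    have h1 := ih₁.trans (Nat.mul_le_mul_left _ (mono_le hZ (w := fun i => (Exp.bin o e₁ e₂).weight (f i))
      fun i => le_max_left _ _))
    have h2 := ih₂.trans (Nat.mul_le_mul_left _ (mono_le hZ (w := fun i => (Exp.bin o e₁ e₂).weight (f i))
      fun i => le_max_right _ _))
    simp only [Exp.cost]
    nlinarith
  | any x y e ih =>
    have h0 := one_le_mono hZ (fun i => e.weight (f i))
    have h1 := one_le_mono hZ (f · y)
    have hm : mono Z (fun i => (Exp.any x y e).weight (f i)) =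
        mono Z (f · y) * mono Z (fun i => e.weight (f i)) := by
      simp only [mono, Exp.weight, pow_add, Finset.prod_mul_distrib]
    have h2 : e.cost ρ + 7 ≤ (e.cost (fun _ => κ) + 7) * mono Z (fun i => e.weight (f i)) := by nlinarith
    have h3 := Nat.mul_le_mul (hρ y) h2
    have h4 := Nat.mul_le_mul h1 h0
    simp only [Exp.cost]
    rw [hm]
    calc _ ≤ κ * mono Z (f · y) * ((e.cost (fun _ => κ) + 7) * mono Z (fun i => e.weight (f i))) + 9 *
          (mono Z (f · y) * mono Z (fun i => e.weight (f i))) := by omega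
      _ = _ := by ring

/-- If the loop bounds are at most `κ` times monomials in the quantities `Z`, then the time is at most a
monomial times the time for the constant loop bounds `κ`; the exponents are read off the program. -/
theorem Cmd.cost_le {ι : Type*} [Fintype ι] {Z : ι → ℕ} (hZ : ∀ i, 1 ≤ Z i)
    {f : ι → ℕ → ℕ} {κ : ℕ} {ρ : ℕ → ℕ} (hρ : ∀ y, ρ y ≤ κ * mono Z (f · y)) (c : Cmd) :
    c.cost ρ ≤ c.cost (fun _ => κ) * mono Z (fun i => c.weight (f i)) := by
  induction c with
  | skip => simp [Cmd.cost]
  | set x e =>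
    have := one_le_mono hZ (fun i => e.weight (f i))
    have := Exp.cost_le hZ hρ e
    simp only [Cmd.cost, Cmd.weight]
    nlinarith
  | put a e₁ e₂ =>
    have h0 := one_le_mono hZ (fun i => (Cmd.put a e₁ e₂).weight (f i))
    have h1 := (Exp.cost_le hZ hρ e₁).trans (Nat.mul_le_mul_left _ (mono_le hZ
      (w := fun i => (Cmd.put a e₁ e₂).weight (f i)) fun i => le_max_left _ _))
    have h2 := (Exp.cost_le hZ hρ e₂).trans (Nat.mul_le_mul_left _ (mono_le hZ
      (w := fun i => (Cmd.put a e₁ e₂).weight (f i)) fun i => le_max_right _ _))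
    simp only [Cmd.cost]
    nlinarith
  | seq c₁ c₂ ih₁ ih₂ =>
    have h1 := ih₁.trans (Nat.mul_le_mul_left _ (mono_le hZ
      (w := fun i => (Cmd.seq c₁ c₂).weight (f i)) fun i => le_max_left _ _))
    have h2 := ih₂.trans (Nat.mul_le_mul_left _ (mono_le hZ
      (w := fun i => (Cmd.seq c₁ c₂).weight (f i)) fun i => le_max_right _ _))
    simp only [Cmd.cost, add_mul]
    omega
  | ite e c₁ c₂ ih₁ ih₂ =>
    have h0 := one_le_mono hZ (fun i => (Cmd.ite e c₁ c₂).weight (f i))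
    have h3 := (Exp.cost_le hZ hρ e).trans (Nat.mul_le_mul_left _ (mono_le hZ
      (w := fun i => (Cmd.ite e c₁ c₂).weight (f i)) fun i => le_max_left _ _))
    have h1 := ih₁.trans (Nat.mul_le_mul_left _ (mono_le hZ (w := fun i => (Cmd.ite e c₁ c₂).weight (f i))
      fun i => (le_max_left _ _).trans (le_max_right _ _)))
    have h2 := ih₂.trans (Nat.mul_le_mul_left _ (mono_le hZ (w := fun i => (Cmd.ite e c₁ c₂).weight (f i))
      fun i => (le_max_right _ _).trans (le_max_right _ _)))
    simp only [Cmd.cost, add_mul]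
    omega
  | loop x y c ih =>
    have h0 := one_le_mono hZ (fun i => c.weight (f i))
    have h1 := one_le_mono hZ (f · y)
    have hm : mono Z (fun i => (Cmd.loop x y c).weight (f i)) =
        mono Z (f · y) * mono Z (fun i => c.weight (f i)) := by
      simp only [mono, Cmd.weight, pow_add, Finset.prod_mul_distrib]
    have h2 : c.cost ρ + 6 ≤ (c.cost (fun _ => κ) + 6) * mono Z (fun i => c.weight (f i)) := by nlinarith
    have h3 := Nat.mul_le_mul (hρ y) h2
    have h4 := Nat.mul_le_mul h1 h0
    simp only [Cmd.cost]
    rw [hm]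
    calc _ ≤ κ * mono Z (f · y) * ((c.cost (fun _ => κ) + 6) * mono Z (fun i => c.weight (f i))) + 5 *
          (mono Z (f · y) * mono Z (fun i => c.weight (f i))) := by omega
      _ = _ := by ring

/-- The exponents of `L`, `D + 1`, `C` in the loop bounds. The last exponent is that of a bound on all
variables; it serves for variables that do not bound any loop of a round. -/
def boundWeight : Fin 4 → ℕ → ℕ
  | 0, y => if y = 1 ∨ y = 2 ∨ y = 7 then 1 else 0
  | 1, y => if y = 3 ∨ y = 4 ∨ y = 5 ∨ y = 7 then 1 else 0
  | 2, y => if y = 6 then 1 else 0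
  | 3, y => if 1 ≤ y ∧ y ≤ 7 then 0 else 1

/-- The time for checking a guide. The exponents come from the most expensive nests of loops, such as
the `L + 1` requests, with `D + 1` saturations each, with a closure over `L * (D + 1)` nodes, which takes
that many rounds, and tests an edge for each node in time `D`. The maximum of each exponent is taken on
its own. -/
theorem roundCmd_cost_le (h : Loaded Y U σ) {M : ℕ} (hM : ∀ y, σ.v y ≤ M) :
    roundCmd.cost σ.v ≤ roundCmd.cost (fun _ => 2) * (Y.L ^ 3 * (Y.D + 1) ^ 4 * Y.C ^ 2) := by
  have hL := Y.lead0_lt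
  have hC := Y.cont0_lt
  have := Cmd.cost_le (Z := ![Y.L, Y.D + 1, Y.C, M + 1]) (f := boundWeight) (κ := 2) (ρ := σ.v) (by
    intro i; fin_cases i <;> simp <;> omega) (by
    intro y
    simp only [mono, Fin.prod_univ_four, boundWeight, Matrix.cons_val]
    by_cases hy : 1 ≤ y ∧ y ≤ 7
    · obtain ⟨h1, h2⟩ := hy
      interval_cases y <;> simp [h.L, h.L1, h.D, h.D1, h.W, h.C, h.N] <;> omega
    · have : σ.v y ≤ M := hM y
      simp only [if_neg hy, show ¬ (y = 1 ∨ y = 2 ∨ y = 7) by omega,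
        show ¬ (y = 3 ∨ y = 4 ∨ y = 5 ∨ y = 7) by omega, show ¬ y = 6 by omega, if_false]
      simp
      omega) roundCmd
  have w : ∀ i, roundCmd.weight (boundWeight i) = ![3, 4, 2, 0] i := by decide
  simp only [w, mono, Fin.prod_univ_four, Matrix.cons_val, pow_zero, mul_one] at this
  exact this

/-- Reading and validating the input takes time linear in the bound `A` on its loops. -/
theorem preCmd_cost_le {b : ℕ} (hb : b ≤ 1) {A : ℕ} (hA : 1 ≤ A) :
    (preCmd b doublings).cost (fun _ => A) ≤ (preCmd b doublings).cost (fun _ => 1) * A := by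
  have := Cmd.cost_le (Z := fun _ : Unit => A) (f := fun _ _ => 1) (κ := 1) (ρ := fun _ => A)
    (fun _ => hA) (fun y => by simp [mono]) (preCmd b doublings)
  have w : (preCmd b doublings).weight (fun _ => 1) = 1 := by
    rcases Nat.le_one_iff_eq_zero_or_eq_one.1 hb with rfl | rfl <;> decide
  simpa [mono, w] using this

end Loop

/-! ### Correctness of the decision procedure -/

namespace Loop
open LCRInstance RAM

/-- The list `inp` holds the bits of `x` from position `b` on. -/
structure IsInput (b : ℕ) (x : List Bool) (inp : List ℕ) : Prop where
  length : inp.length = b + x.length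
  bit : ∀ i (h : i < x.length), inp.getD (b + i) 0 = x[i].toNat

theorem IsInput.source {b : ℕ} {x : List Bool} {inp : List ℕ} (h : IsInput b x inp)
    (hpos : 0 < b + x.length) {σ : St} (h0 : σ.v 0 = 2 ^ doublings * (b + x.length))
    (ha : ∀ i < b + x.length, σ.a 0 i = inp.getD i 0) : Source b x σ := by
  refine ⟨?_, fun i hi => by rw [ha _ (by omega), h.bit i hi]⟩
  rw [h0, doublings]
  omega

/-- The factor of the running time of the start, per cell of the input. -/
def startCost (b : ℕ) : ℕ := 2 ^ doublings * (7 + (preCmd b doublings).cost fun _ => 1)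

/-- The factor of the running time of a round. -/
def roundCost : ℕ := roundCmd.cost fun _ => 2

/-- The program decides encoded instances, given alone (`b = 0`) or after their parameter (`b = 1`). -/
theorem decides_encode {b M : ℕ} (hb : b ≤ 1) {I : LCRInstance} {inp : List ℕ}
    (hI : IsInput b I.encode inp) (hk : b = 0 ∨ I.D + I.L = inp.getD 0 0)
    (hle : ∀ i, inp.getD i 0 ≤ M) (hM : (stride + 1) * (2 ^ doublings * inp.length) ≤ M) :
    DecidesWithin (program b) inp I.Holds
      (startCost b * inp.length + 42 + (I.L * (I.D + 1)) ^ (I.L + 1) *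
        (roundCost * (I.L ^ 3 * (I.D + 1) ^ 4 * I.C ^ 2) + 2))
      (2 ^ doublings * inp.length + stride * M ^ regs + stride) := by
  generalize hn : inp.length = n at *
  have hpos : 0 < n := by
    rw [← hn, hI.length, length_encode]; omega
  have hn' : n = b + I.encode.length := hn.symm.trans hI.length
  have hM2 : 2 ≤ M := by
    have : stride = 16 := rfl
    have : doublings = 13 := rfl
    simp only [*] at hM
    omega
  obtain ⟨m, hm, σ, mem, r1, h0, ha, hA⟩ := runs_start hb hn hpos hM2 hle hM
  have hs := hI.source (hn' ▸ hpos) (hn' ▸ h0) (hn' ▸ ha)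
  obtain ⟨hl, h19, h20, hg⟩ := exec_preCmd hb hs (hn' ▸ h0) rfl (by rwa [ha 0 hpos])
  generalize (preCmd b doublings).exec σ = τ at *
  have hN : 0 < (I.L * (I.D + 1)) ^ (I.L + 1) :=
    Nat.pow_pos (Nat.mul_pos I.leader.init.pos (Nat.succ_pos _))
  set K := machine b n M 14 τ.v hpos hM2 with hK
  have hA' : K.At τ mem := ⟨hA.rep, hA.small, fun _ _ => rfl, hA.le⟩
  obtain ⟨m', hm', σ', mem', r2, hA'', e19, e20⟩ := runs_loop (K := K) rfl rfl rfl
    ((I.L * (I.D + 1)) ^ (I.L + 1)) 0 (zero_add _) hA' hl (fun i hi => by rw [hg i hi]; simp)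
    ⟨fun _ => hN, fun _ => h19⟩ (by simp [h20])
  refine decidesWithin_of_exit (K := K) (Runs.trans (V := K.V) r1 r2) ?_ hA'' e19 ?_
  · have hc := preCmd_cost_le hb (A := 2 ^ doublings * n) (Nat.mul_pos (by decide) hpos)
    have hr := roundCmd_cost_le hl hA.small.v
    have hp := Nat.mul_le_mul_left ((I.L * (I.D + 1)) ^ (I.L + 1)) (Nat.add_le_add_right hr 2)
    have e : startCost b * n = 7 * (2 ^ doublings * n) +
        (preCmd b doublings).cost (fun _ => 1) * (2 ^ doublings * n) := by
      rw [startCost]; ring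
    have hm'' : m' ≤ _ := hm'.trans hp
    rw [e]
    change m + m' + 2 ≤ 7 * (2 ^ doublings * n) +
        (preCmd b doublings).cost (fun _ => 1) * (2 ^ doublings * n) + 42 +
        (I.L * (I.D + 1)) ^ (I.L + 1) *
        (roundCmd.cost (fun _ => 2) * (I.L ^ 3 * (I.D + 1) ^ 4 * I.C ^ 2) + 2)
    have hm''' : m' ≤ (I.L * (I.D + 1)) ^ (I.L + 1) *
        (roundCmd.cost (fun _ => 2) * (I.L ^ 3 * (I.D + 1) ^ 4 * I.C ^ 2) + 2) := hm''
    omega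
  · rw [e20, I.holds_iff_reach]
    exact ((I.toAbs.exists_reach_iff_exists_guide I.numUnsafe).trans exists_guide_iff).symm

/-- The program rejects inputs that are not an encoded instance after its parameter. -/
theorem decides_invalid {M : ℕ} {x : List Bool} {inp : List ℕ} (hI : IsInput 1 x inp)
    (hx : ∀ I : LCRInstance, x = I.encode → I.D + I.L ≠ inp.getD 0 0)
    (hle : ∀ i, inp.getD i 0 ≤ M) (hM : (stride + 1) * (2 ^ doublings * inp.length) ≤ M) :
    DecidesWithin (program 1) inp False (startCost 1 * inp.length + 42)
      (2 ^ doublings * inp.length + stride * M ^ regs + stride) := by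
  generalize hn : inp.length = n at *
  have hn' : n = 1 + x.length := hn.symm.trans hI.length
  have hpos : 0 < n := by omega
  have hM2 : 2 ≤ M := by
    have : stride = 16 := rfl
    have : doublings = 13 := rfl
    simp only [*] at hM
    omega
  obtain ⟨m, hm, σ, mem, r1, h0, ha, hA⟩ := runs_start le_rfl hn hpos hM2 hle hM
  have hs := hI.source (hn' ▸ hpos) (hn' ▸ h0) (hn' ▸ ha)
  have h19 : ((preCmd 1 doublings).exec σ).v 19 = 0 := by
    by_contra h
    obtain ⟨I, hI, hk⟩ := exists_encode_of_valid le_rfl hs (hn' ▸ h0) h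
    rw [ha 0 hpos] at hk
    exact hx I hI (hk.resolve_left one_ne_zero)
  have h20 : ((preCmd 1 doublings).exec σ).v 20 = 0 := (exec_setupCmd le_rfl).res
  refine decidesWithin_of_exit r1 ?_ hA h19 (by simp [h20])
  have hc := preCmd_cost_le le_rfl (A := 2 ^ doublings * n) (Nat.mul_pos (by decide) hpos)
  have e : startCost 1 * n = 7 * (2 ^ doublings * n) +
      (preCmd 1 doublings).cost (fun _ => 1) * (2 ^ doublings * n) := by
    rw [startCost]; ring
  omega

end Loop

/-! ### The bounds -/

namespace Loop
open LCRInstance RAM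

theorem decidesWithin_mono {p : Prog} {inp : List ℕ} {ans : Prop} {T T' V V' : ℕ}
    (h : DecidesWithin p inp ans T V) (hT : T ≤ T') (hV : V ≤ V') : DecidesWithin p inp ans T' V' := by
  obtain ⟨n, hn, b, h1, h2, h3⟩ := h
  exact ⟨n, hn.trans hT, b, h1, h2, fun m hm i => (h3 m hm i).trans hV⟩

/-- Since a guide has only `L + 1` entries, there are far fewer guides than witnesses for large `D`, which
makes up for the larger power of `D + 1` in the time of a check. For small `D`, the constant
`7776 = 6 ^ 5` does. -/
theorem pow_succ_le_wit {L D : ℕ} (hD : 0 < D) (hL : 0 < L) :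
    (L * (D + 1)) ^ L * (D + 1) ^ 5 ≤ 7776 * ((L * (D + 1)) ^ (L * D) * D ^ D * D ^ 2) := by
  obtain ⟨d, rfl⟩ := Nat.exists_eq_succ_of_ne_zero hD.ne'
  have h1 : (d + 1 + 1) ^ 5 ≤ 7776 * (d + 1 + 1) ^ d := by
    by_cases hd : d ≤ 4
    · calc (d + 1 + 1) ^ 5 ≤ 6 ^ 5 := Nat.pow_le_pow_left (by omega) 5
        _ = 7776 * 1 := by norm_num
        _ ≤ _ := Nat.mul_le_mul_left _ (Nat.one_le_pow _ _ (by omega))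
    · calc (d + 1 + 1) ^ 5 ≤ (d + 1 + 1) ^ d := Nat.pow_le_pow_right (by omega) (by omega)
        _ ≤ _ := Nat.le_mul_of_pos_left _ (by norm_num)
  have h2 : (d + 1 + 1) ^ d ≤ (L * (d + 1 + 1)) ^ (L * d) :=
    (Nat.pow_le_pow_left (Nat.le_mul_of_pos_left _ hL) d).trans
      (Nat.pow_le_pow_right (by positivity) (Nat.le_mul_of_pos_left _ hL))
  have h3 : 1 ≤ (d + 1) ^ (d + 1) * (d + 1) ^ 2 := Nat.one_le_iff_ne_zero.2 (by positivity)
  simp only [Nat.succ_eq_add_one]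
  calc (L * (d + 1 + 1)) ^ L * (d + 1 + 1) ^ 5
      ≤ (L * (d + 1 + 1)) ^ L * (7776 * (L * (d + 1 + 1)) ^ (L * d)) :=
        Nat.mul_le_mul_left _ (h1.trans (Nat.mul_le_mul_left _ h2))
    _ = 7776 * (L * (d + 1 + 1)) ^ (L * (d + 1)) * 1 := by ring
    _ ≤ 7776 * (L * (d + 1 + 1)) ^ (L * (d + 1)) * ((d + 1) ^ (d + 1) * (d + 1) ^ 2) :=
        Nat.mul_le_mul_left _ h3
    _ = _ := by ring

/-- The number of guides times the time for one of them, up to a constant factor. -/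
theorem rounds_le (I : LCRInstance) :
    (I.L * (I.D + 1)) ^ (I.L + 1) * (I.L ^ 3 * (I.D + 1) ^ 4 * I.C ^ 2) ≤
      7776 * (Wit I.L I.D * Valid I.L I.D I.C) := by
  have h := pow_succ_le_wit I.init.pos I.leader.init.pos
  calc _ = (I.L * (I.D + 1)) ^ I.L * (I.D + 1) ^ 5 * (I.L ^ 4 * I.C ^ 2) := by ring
    _ ≤ _ := Nat.mul_le_mul_right _ h
    _ = _ := by rw [Wit, Valid]; ring

/-- Reading the input takes no longer than checking one guide, up to a constant factor. -/
theorem length_encode_le (I : LCRInstance) :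
    I.encode.length ≤ 14 * (I.L ^ 3 * (I.D + 1) ^ 4 * I.C ^ 2) := by
  have hL : 1 ≤ I.L := I.leader.init.pos
  have hC : 1 ≤ I.C := I.contributor.init.pos
  have hi := I.init.2
  have hq := I.leader.init.2
  have hp := I.contributor.init.2
  rw [length_encode]
  generalize I.init.val = i at *
  generalize I.leader.init.val = q at *
  generalize I.contributor.init.val = p at *
  generalize I.L = L at *
  generalize I.D = D at *
  generalize I.C = C at *
  have key : ∀ a b c, a ≤ 3 → b ≤ 4 → c ≤ 2 → L ^ a * (D + 1) ^ b * C ^ c ≤ L ^ 3 * (D + 1) ^ 4 * C ^ 2 :=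
    fun a b c ha hb hc => Nat.mul_le_mul (Nat.mul_le_mul (Nat.pow_le_pow_right hL ha)
      (Nat.pow_le_pow_right (Nat.succ_pos _) hb)) (Nat.pow_le_pow_right hC hc)
  have k0 := key 0 0 0 (by norm_num) (by norm_num) (by norm_num)
  have k1 := key 1 0 0 (by norm_num) (by norm_num) (by norm_num)
  have k2 := key 0 1 0 (by norm_num) (by norm_num) (by norm_num)
  have k3 := key 0 0 1 (by norm_num) (by norm_num) (by norm_num)
  have k4 := key 2 1 0 (by norm_num) (by norm_num) (by norm_num)
  have k5 := key 0 1 2 (by norm_num) (by norm_num) (by norm_num)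
  have e1 : L * ((2 * D + 1) * L) ≤ 2 * (L ^ 2 * (D + 1) ^ 1 * C ^ 0) := by
    have : L * ((2 * D + 1) * L) ≤ L * ((2 * (D + 1)) * L) := by gcongr; omega
    calc _ ≤ _ := this
      _ = _ := by ring
  have e2 : C * ((2 * D + 1) * C) ≤ 2 * (L ^ 0 * (D + 1) ^ 1 * C ^ 2) := by
    have : C * ((2 * D + 1) * C) ≤ C * ((2 * (D + 1)) * C) := by gcongr; omega
    calc _ ≤ _ := this
      _ = _ := by ring
  simp only [pow_zero, pow_one, one_mul, mul_one] at *
  omega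

theorem isInput_bits (x : List Bool) : IsInput 0 x (bits x) := by
  refine ⟨by simp [bits], fun i hi => ?_⟩
  rw [zero_add, List.getD_eq_getElem?_getD, List.getElem?_eq_getElem (by simpa [bits] using hi)]
  simp [bits]

theorem isInput_cons_bits (k : ℕ) (x : List Bool) : IsInput 1 x (k :: bits x) := by
  refine ⟨by simp [bits, add_comm], fun i hi => ?_⟩
  rw [add_comm, List.getD_cons_succ]
  simpa using (isInput_bits x).bit i hi

theorem bits_getD_le (x : List Bool) (i : ℕ) : (bits x).getD i 0 ≤ 1 := by
  by_cases hi : i < x.length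
  · have := (isInput_bits x).bit i hi
    rw [zero_add] at this
    rw [this]
    exact Bool.toNat_le _
  · rw [List.getD_eq_default _ _ (by simpa [bits] using hi)]
    exact Nat.zero_le _

/-- A bound on the numbers that occur in a run, in terms of a number `s` above the input. -/
theorem space_le {n s T : ℕ} (hs : 2 ≤ s) (hn : n ≤ s) (hT : 1 ≤ T) :
    2 ^ 13 * n + 16 * (17 * (2 ^ 13 * n)) ^ T + 16 ≤ s ^ (19 * T + 6) := by
  have two : ∀ a, 2 ^ a ≤ s ^ a := fun a => Nat.pow_le_pow_left hs a
  have hmono : ∀ {a b}, a ≤ b → s ^ a ≤ s ^ b := fun h => Nat.pow_le_pow_right (by omega) h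
  have h1 : 2 ^ 13 * n ≤ s ^ (19 * T + 4) :=
    calc 2 ^ 13 * n ≤ s ^ 13 * s := Nat.mul_le_mul (two 13) hn
      _ = s ^ 14 := by ring
      _ ≤ _ := hmono (by omega)
  have h2 : 17 * (2 ^ 13 * n) ≤ s ^ 19 :=
    calc 17 * (2 ^ 13 * n) ≤ 2 ^ 5 * (2 ^ 13 * n) := Nat.mul_le_mul_right _ (by norm_num)
      _ ≤ s ^ 5 * (s ^ 13 * s) := Nat.mul_le_mul (two 5) (Nat.mul_le_mul (two 13) hn)
      _ = s ^ 19 := by ring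
  have h3 : 16 * (17 * (2 ^ 13 * n)) ^ T ≤ s ^ (19 * T + 4) :=
    calc 16 * (17 * (2 ^ 13 * n)) ^ T ≤ s ^ 4 * (s ^ 19) ^ T :=
          Nat.mul_le_mul (two 4) (Nat.pow_le_pow_left h2 T)
      _ = s ^ (19 * T + 4) := by rw [← pow_mul, ← pow_add]; congr 1; ring
  have h4 : 16 ≤ s ^ (19 * T + 4) := (two 4).trans (hmono (by omega))
  have h5 : 2 ^ 2 * s ^ (19 * T + 4) ≤ s ^ (19 * T + 6) :=
    calc 2 ^ 2 * s ^ (19 * T + 4) ≤ s ^ 2 * s ^ (19 * T + 4) := Nat.mul_le_mul_right _ (two 2)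
      _ = _ := by ring
  omega

/-- The time bound in terms of witnesses and their validation. -/
theorem exists_program_wit_valid : ∃ (p : Prog) (c : ℕ), ∀ I : LCRInstance,
    DecidesWithin p (bits I.encode) I.Holds (c * (Wit I.L I.D * Valid I.L I.D I.C))
      ((I.encode.length + 2) ^ c) := by
  refine ⟨program 0, max (7776 * (14 * startCost 0 + 44 + roundCost)) (19 * regs + 6), fun I => ?_⟩
  have hlen : (bits I.encode).length = I.encode.length := by simp [bits]
  have hpos : 0 < I.encode.length := by rw [length_encode]; omega
  refine decidesWithin_mono (decides_encode (M := (stride + 1) * (2 ^ doublings * I.encode.length))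
    (Nat.zero_le _) (isInput_bits _) (Or.inl rfl)
    (fun i => (bits_getD_le _ i).trans (Nat.mul_pos (by decide) (Nat.mul_pos (by decide) hpos)))
    (by rw [hlen])) ?_ ?_
  · rw [hlen]
    have h1 := rounds_le I
    have h2 := length_encode_le I
    have hP : 1 ≤ I.L ^ 3 * (I.D + 1) ^ 4 * I.C ^ 2 := Nat.one_le_iff_ne_zero.2 (by
      have := I.leader.init.pos
      have := I.contributor.init.pos
      positivity)
    have hN : 1 ≤ (I.L * (I.D + 1)) ^ (I.L + 1) := Nat.one_le_iff_ne_zero.2 (by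
      have := I.leader.init.pos
      positivity)
    generalize I.L ^ 3 * (I.D + 1) ^ 4 * I.C ^ 2 = P at *
    generalize (I.L * (I.D + 1)) ^ (I.L + 1) = N at *
    generalize Wit I.L I.D * Valid I.L I.D I.C = B at *
    generalize I.encode.length = n at *
    generalize startCost 0 = a
    generalize roundCost = r
    have hPN : P ≤ N * P := Nat.le_mul_of_pos_left _ hN
    have hNN : N ≤ N * P := Nat.le_mul_of_pos_right _ hP
    calc a * n + 42 + N * (r * P + 2) ≤ a * (14 * (N * P)) + 42 * (N * P) + (r * (N * P) + 2 * (N * P)) := by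
          have : a * n ≤ a * (14 * (N * P)) := Nat.mul_le_mul_left _ (by omega)
          have e : N * (r * P + 2) = r * (N * P) + 2 * N := by ring
          omega
      _ = (14 * a + 44 + r) * (N * P) := by ring
      _ ≤ (14 * a + 44 + r) * (7776 * B) := Nat.mul_le_mul_left _ h1
      _ = 7776 * (14 * a + 44 + r) * B := by ring
      _ ≤ _ := Nat.mul_le_mul_right _ (le_max_left _ _)
  · rw [hlen]
    refine (space_le (n := I.encode.length) (s := I.encode.length + 2) (T := regs) (by omega) (by omega)
      (by decide)).trans (Nat.pow_le_pow_right (by omega) (le_max_right _ _))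

/-! ### Fixed-parameter tractability -/

theorem computable_mul_pow (κ e : ℕ) : Computable fun k : ℕ => κ * (k + 2) ^ (2 * k + e) := by
  refine Primrec.to_comp (Primrec.nat_mul.comp (Primrec.const κ) ((Primrec₂.unpaired'.1 Nat.Primrec.pow).comp ?_ ?_))
  · exact Primrec.nat_add.comp Primrec.id (Primrec.const 2)
  · exact Primrec.nat_add.comp (Primrec.nat_mul.comp (Primrec.const 2) Primrec.id) (Primrec.const e)

/-- A bound on the numbers that occur in a run on an input of length `n` with parameter `k`. -/
theorem fpt_space_le {k n T : ℕ} (hn : 1 ≤ n) (hT : 1 ≤ T) :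
    2 ^ 13 * n + 16 * (17 * (2 ^ 13 * n) + k) ^ T + 16 ≤
      (16 * (17 * 2 ^ 13) ^ T + 2 ^ 13 + 16) * (k + 2) ^ T * n ^ T := by
  have h1 : 17 * (2 ^ 13 * n) + k ≤ 17 * 2 ^ 13 * ((k + 2) * n) := by nlinarith
  have h2 : (17 * (2 ^ 13 * n) + k) ^ T ≤ (17 * 2 ^ 13) ^ T * ((k + 2) ^ T * n ^ T) := by
    rw [← mul_pow, ← mul_pow]; exact Nat.pow_le_pow_left h1 T
  have h3 : n ≤ n ^ T := Nat.le_self_pow (by omega) n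
  have h4 : 1 ≤ (k + 2) ^ T := Nat.one_le_pow _ _ (by omega)
  have h5 : n ≤ (k + 2) ^ T * n ^ T := h3.trans (Nat.le_mul_of_pos_left _ h4)
  rw [mul_assoc _ ((k + 2) ^ T)]
  generalize (k + 2) ^ T * n ^ T = B at *
  calc _ ≤ 2 ^ 13 * B + 16 * ((17 * 2 ^ 13) ^ T * B) + 16 * B := by omega
    _ = _ := by ring

/-- The time bound in terms of the parameter `k = D + L` and the length `n` of the input. -/
theorem fpt_time_le (I : LCRInstance) {k n a r : ℕ} (hk : I.D + I.L = k) (hn : I.C ≤ n) (hn1 : 1 ≤ n) :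
    a * n + 42 + (I.L * (I.D + 1)) ^ (I.L + 1) * (r * (I.L ^ 3 * (I.D + 1) ^ 4 * I.C ^ 2) + 2) ≤
      (a + 44 + r) * ((k + 2) ^ (2 * k + 7) * n ^ 2) := by
  have hD := I.init.pos
  have hL := I.leader.init.pos
  have h1 : (I.L * (I.D + 1)) ^ (I.L + 1) ≤ (k + 2) ^ (2 * k) :=
    calc (I.L * (I.D + 1)) ^ (I.L + 1) ≤ ((k + 2) * (k + 2)) ^ (I.L + 1) :=
          Nat.pow_le_pow_left (Nat.mul_le_mul (by omega) (by omega)) _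
      _ ≤ ((k + 2) * (k + 2)) ^ k := Nat.pow_le_pow_right (by positivity) (by omega)
      _ = (k + 2) ^ (2 * k) := by rw [← sq, ← pow_mul]
  have h2 : I.L ^ 3 * (I.D + 1) ^ 4 * I.C ^ 2 ≤ (k + 2) ^ 7 * n ^ 2 :=
    calc I.L ^ 3 * (I.D + 1) ^ 4 * I.C ^ 2 ≤ (k + 2) ^ 3 * (k + 2) ^ 4 * n ^ 2 :=
          Nat.mul_le_mul (Nat.mul_le_mul (Nat.pow_le_pow_left (by omega) _)
            (Nat.pow_le_pow_left (by omega) _)) (Nat.pow_le_pow_left hn _)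
      _ = _ := by ring
  have h3 : n ≤ n ^ 2 := Nat.le_self_pow two_ne_zero n
  have h4 : 1 ≤ (k + 2) ^ (2 * k) := Nat.one_le_pow _ _ (by omega)
  have h5 : 1 ≤ (k + 2) ^ 7 := Nat.one_le_pow _ _ (by omega)
  have h6 : n ≤ (k + 2) ^ 7 * n ^ 2 := h3.trans (Nat.le_mul_of_pos_left _ h5)
  rw [pow_add (k + 2), mul_assoc ((k + 2) ^ (2 * k))]
  generalize (I.L * (I.D + 1)) ^ (I.L + 1) = N at *
  generalize I.L ^ 3 * (I.D + 1) ^ 4 * I.C ^ 2 = P at *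
  generalize (k + 2) ^ 7 * n ^ 2 = Q at *
  generalize (k + 2) ^ (2 * k) = G at *
  have h7 : Q ≤ G * Q := Nat.le_mul_of_pos_left _ h4
  calc a * n + 42 + N * (r * P + 2) ≤ a * (G * Q) + 42 * (G * Q) + G * (r * Q + 2 * Q) := by
        have e1 : a * n ≤ a * (G * Q) := Nat.mul_le_mul_left _ (h6.trans h7)
        have e2 : N * (r * P + 2) ≤ G * (r * Q + 2 * Q) :=
          Nat.mul_le_mul h1 (Nat.add_le_add (Nat.mul_le_mul_left _ h2) (by omega))
        omega
    _ = _ := by ring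

theorem isFPT_lcr : IsFPT LCRByDomainAndLeader := by
  -- the constants are replaced by variables, since powers with them must not be evaluated
  obtain ⟨T, hT⟩ : ∃ T, T = regs := ⟨_, rfl⟩
  have hT2 : 2 ≤ T := by rw [hT]; decide
  obtain ⟨κ, hκ1, hκ2⟩ : ∃ κ, 16 * (17 * 2 ^ 13) ^ T + 2 ^ 13 + 16 ≤ κ ∧
      startCost 1 + 44 + roundCost ≤ κ := ⟨max _ _, le_max_left _ _, le_max_right _ _⟩
  refine ⟨program 1, fun k => κ *
    (k + 2) ^ (2 * k + (T + 7)), T, computable_mul_pow _ _, fun x k => ?_⟩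
  have hlen : (k :: bits x).length = x.length + 1 := by simp [bits]
  have hle : ∀ i, (k :: bits x).getD i 0 ≤ 17 * (2 ^ 13 * (x.length + 1)) + k := by
    rintro (_ | i)
    · simp
    · rw [List.getD_cons_succ]
      have := bits_getD_le x i
      omega
  have hM : (stride + 1) * (2 ^ doublings * (k :: bits x).length) ≤
      17 * (2 ^ 13 * (x.length + 1)) + k := by
    rw [hlen]; exact Nat.le_add_right _ _
  have hn1 : 1 ≤ x.length + 1 := by omega
  -- bounds common to valid and invalid inputs
  have hG : 1 ≤ (k + 2) ^ (2 * k) := Nat.one_le_pow _ _ (by omega)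
  have hspace : 2 ^ doublings * (k :: bits x).length + stride *
      (17 * (2 ^ 13 * (x.length + 1)) + k) ^ regs + stride ≤
      κ *
        (k + 2) ^ (2 * k + (T + 7)) * (x.length + 1) ^ T := by
    rw [hlen, ← hT]
    refine (fpt_space_le hn1 (by omega)).trans ?_
    exact Nat.mul_le_mul_right _ (Nat.mul_le_mul hκ1
      (Nat.pow_le_pow_right (by omega) (by omega)))
  have htime : (startCost 1 + 44 + roundCost) * ((k + 2) ^ (2 * k + 7) * (x.length + 1) ^ 2) ≤
      κ *
        (k + 2) ^ (2 * k + (T + 7)) * (x.length + 1) ^ T := by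
    rw [← mul_assoc]
    exact Nat.mul_le_mul (Nat.mul_le_mul hκ2
      (Nat.pow_le_pow_right (by omega) (by omega))) (Nat.pow_le_pow_right (by omega) hT2)
  have valid : ∀ I : LCRInstance, x = I.encode → I.D + I.L = k → ∀ ans : Prop, (I.Holds ↔ ans) →
      DecidesWithin (program 1) (k :: bits x) ans
        (κ *
          (k + 2) ^ (2 * k + (T + 7)) * (x.length + 1) ^ T)
        (κ *
          (k + 2) ^ (2 * k + (T + 7)) * (x.length + 1) ^ T) := by
    intro I hx hk ans hans
    have hC : I.C ≤ x.length + 1 := by rw [hx, length_encode]; omega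
    obtain rfl : I.Holds = ans := propext hans
    have hin : IsInput 1 I.encode (k :: bits x) := by
      rw [← hx]
      exact isInput_cons_bits k x
    have hk' : I.D + I.L = (k :: bits x).getD 0 0 := by
      rw [List.getD_cons_zero]
      exact hk
    have hdec := decides_encode (b := 1) (le_refl 1) hin (Or.inr hk') hle hM
    refine decidesWithin_mono hdec ?_ hspace
    rw [hlen]
    exact (fpt_time_le I hk hC hn1).trans htime
  by_cases hmem : (x, k) ∈ LCRByDomainAndLeader
  · obtain ⟨I, hI, hH⟩ := id hmem
    rw [Prod.mk.injEq] at hI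
    exact valid I hI.1 hI.2.symm _ (by simp [hmem, hH])
  · by_cases hex : ∃ I : LCRInstance, x = I.encode ∧ I.D + I.L = k
    · obtain ⟨I, hx, hk⟩ := hex
      refine valid I hx hk _ (iff_of_false (fun hH => hmem ⟨I, ?_, hH⟩) hmem)
      rw [hx, hk]
    · have hinv := decides_invalid (isInput_cons_bits k x) (fun I hx hk => hex ⟨I, hx, by
        rwa [List.getD_cons_zero] at hk⟩) hle hM
      rw [eq_false hmem]
      refine decidesWithin_mono hinv ?_ hspace
      rw [hlen]
      refine le_trans ?_ htime
      have h1 : 1 ≤ (k + 2) ^ (2 * k + 7) := Nat.one_le_pow _ _ (by omega)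
      have h2 : x.length + 1 ≤ (x.length + 1) ^ 2 := Nat.le_self_pow two_ne_zero _
      have h3 := h2.trans (Nat.le_mul_of_pos_left _ h1)
      generalize (k + 2) ^ (2 * k + 7) * (x.length + 1) ^ 2 = B at *
      have h4 := Nat.mul_le_mul_left (startCost 1) h3
      rw [add_mul, add_mul]
      omega

end Loop

theorem mainTheorem1 :
    (∃ (p : RAM.Prog) (c : ℕ), ∀ I : LCRInstance,
      RAM.DecidesWithin p (RAM.bits I.encode) I.Holds
        (c * (Wit I.L I.D * Valid I.L I.D I.C)) ((I.encode.length + 2) ^ c)) ∧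
    IsFPT LCRByDomainAndLeader :=
  ⟨Loop.exists_program_wit_valid, Loop.isFPT_lcr⟩
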